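/- Let $(\mathbb S,\omega)$ be a simply connected solvable Lie group with Lie algebra $\mathfrak s$, endowed with a left-invariant symplectic form, and write $C^\infty(\mathbb S)$ for the $\mathbb K$-valued smooth functions, $\mathbb K=\mathbb R$ or $\mathbb C$. A Drinfel'd twist based on $(\mathfrak s,\omega_e)$ is a series $F=1\otimes1+\sum_{k\ge1}\nu^kF_k\in(\mathcal U(\mathfrak s)\otimes\mathcal U(\mathfrak s))[[\nu]]$ (coefficients in $\mathbb K$) with $(\Delta\otimes\mathrm{id})(F)\cdot(F\otimes1)=(\mathrm{id}\otimes\Delta)(F)\cdot(1\otimes F)$ such that the left-invariant bidifferential operators $\widetilde F_k$ on $\mathbb S$ associated with the $F_k$ satisfy $\widetilde F_1(u,v)-\widetilde F_1(v,u)=\{u,v\}^\omega$. It defines a left-invariant star-product $u\star v=uv+\sum_{k\ge1}\nu^k\widetilde F_k(u,v)$ on $C^\infty(\mathbb S)[[\nu]]$. Its Lie algebra of derivations $\mathfrak{Der}(\star)$ consists of the formal series $D=\sum_{k\ge0}\nu^kD_k$ of differential operators on $\mathbb S$ with $D(u\star v)=(Du)\star v+u\star(Dv)$. The twist is natural if $\widetilde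 F_2$ is a bidifferential operator of order at most two in each argument. Let $F$ be a natural Drinfel'd twist based on $(\mathfrak s,\omega_e)$, with star-product $\sharp$, and let $\mathfrak g$ be its internal symmetry Lie algebra, i.e. the real Lie algebra of smooth vector fields on $\mathbb S$ that are derivations of $\sharp$. It contains $\mathfrak s$ through $X\mapsto X^\star$, $X^\star_x=\frac{d}{dt}\big|_0\exp(-tX)x$. Let $F'$ be another Drinfel'd twist based on $(\mathfrak s,\omega_e)$, with star-product $\star$, that is equivalent to $F$: there is a formal series $T=\mathrm{id}+\sum_{k\ge1}\nu^kT_k$ of differential operators commuting with the left translations such that $T(u)\star T(v)=T(u\,\sharp\,v)$ for all $u,v\in C^\infty(\mathbb S)$. Let $\mathrm{Hom}_{\mathfrak s}(\mathfrak g,\mathfrak{Der}(\star))$ be the set of homomorphisms of real Lie algebras $D:\mathfrak g\to\mathfrak{Der}(\star)$ with $D_{X^\star}=X^\star$ for all $X\in\mathfrak s$. Then $\mathfrak g$ is finite-dimensional, and $\mathrm{Hom}_{\mathfrak s}(\mathfrak g,\mathfrak{Der}(\star))$ is finite-dimensional over $\mathbb R[[\nu]]$, in the sense that the $\mathbb R[[\nu]]$-submodule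 it spans in $\mathrm{Hom}_{\mathbb R}(\mathfrak g,\mathfrak{Der}(\star))$ is finitely generated. -/

import Mathlib

open scoped Manifold ContDiff TensorProduct PowerSeries

attribute [local instance 100] LieRing.ofAssociativeRing

noncomputable section

namespace DrinfeldTwist

section Functions

variable (𝕜 : Type*) [RCLike 𝕜] (n : ℕ) (S : Type*) [TopologicalSpace S]
  [ChartedSpace (EuclideanSpace ℝ (Fin n)) S]

/-- The algebra `C^∞(S)` of smooth `𝕜`-valued functions (`𝕜 = ℝ` or `ℂ`) on a real manifold. -/
def SmoothFn : Subalgebra 𝕜 (S → 𝕜) where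
  carrier := {f | ContMDiff (𝓡 n) 𝓘(ℝ, 𝕜) ∞ f}
  mul_mem' := fun hf hg => (contDiff_mul (𝕜 := ℝ) (𝔸 := 𝕜)).contMDiff.comp (ContMDiff.prodMk_space hf hg)
  add_mem' := fun hf hg => ContMDiff.add hf hg
  algebraMap_mem' := fun _ => contMDiff_const

/-- Linear operators on `C^∞(S)`. -/
abbrev Op : Type _ := Module.End 𝕜 (SmoothFn 𝕜 n S)

instance : Module ℝ (SmoothFn 𝕜 n S) := Subalgebra.module' _

instance : SMulCommClass ℝ 𝕜 (SmoothFn 𝕜 n S) :=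
  ⟨fun a b f => Subtype.ext (smul_comm a b (f : S → 𝕜))⟩

instance : SMulCommClass 𝕜 ℝ (SmoothFn 𝕜 n S) := SMulCommClass.symm _ _ _

instance : IsScalarTower ℝ 𝕜 (SmoothFn 𝕜 n S) :=
  ⟨fun a b f => Subtype.ext (smul_assoc a b (f : S → 𝕜))⟩

instance : Algebra ℝ (Op 𝕜 n S) := Module.End.instAlgebra ℝ 𝕜 (SmoothFn 𝕜 n S)

/-- Formal power series of operators; the product is the composition of (the
`𝕜[[ν]]`-linear extensions of) the series. -/
abbrev OpSeries : Type _ := (Op 𝕜 n S)⟦X⟧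

/-- Formal power series of operators as an algebra over `ℝ[[ν]]`. -/
instance opSeriesAlgebra : Algebra ℝ⟦X⟧ (OpSeries 𝕜 n S) :=
  RingHom.toAlgebra' (PowerSeries.map (algebraMap ℝ (Op 𝕜 n S))) (by
    intro c x
    ext1 k
    rw [PowerSeries.coeff_mul, PowerSeries.coeff_mul, ← Finset.Nat.sum_antidiagonal_swap]
    refine Finset.sum_congr rfl fun p _ => ?_
    simp only [PowerSeries.coeff_map, Prod.fst_swap, Prod.snd_swap]
    exact Algebra.commutes _ _)

variable {𝕜 n S} in
theorem SmoothFn.contMDiff (f : SmoothFn 𝕜 n S) : ContMDiff (𝓡 n) 𝓘(ℝ, 𝕜) ∞ (f : S → 𝕜) := f.2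

variable {n S} [IsManifold (𝓡 n) ∞ S]

/-- The vector field `V` is smooth. -/
def IsSmoothVF (V : ∀ x : S, TangentSpace (𝓡 n) x) : Prop :=
  ContMDiff (𝓡 n) (𝓡 n).tangent ∞ (fun x => (⟨x, V x⟩ : TangentBundle (𝓡 n) S))

variable {𝕜}

/-- The differential at `x` of a `𝕜`-valued function. -/
def differential (f : S → 𝕜) (x : S) : TangentSpace (𝓡 n) x →ₗ[ℝ] 𝕜 :=
  (mfderiv (𝓡 n) 𝓘(ℝ, 𝕜) f x).toLinearMap

theorem contMDiff_differential {f : S → 𝕜} (hf : ContMDiff (𝓡 n) 𝓘(ℝ, 𝕜) ∞ f)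
    {V : ∀ x : S, TangentSpace (𝓡 n) x} (hV : IsSmoothVF V) :
    ContMDiff (𝓡 n) 𝓘(ℝ, 𝕜) ∞ (fun x => differential f x (V x)) := by
  have h1 : ContMDiff (𝓡 n).tangent 𝓘(ℝ, 𝕜).tangent ∞ (tangentMap (𝓡 n) 𝓘(ℝ, 𝕜) f) :=
    hf.contMDiff_tangentMap (by simp)
  exact (contMDiff_snd_tangentBundle_modelSpace 𝕜 𝓘(ℝ, 𝕜)).comp (h1.comp hV)

variable (𝕜)

/-- The operator `f ↦ df(V)` on `C^∞(S)` given by a smooth vector field `V`. -/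
def vfOp (V : ∀ x : S, TangentSpace (𝓡 n) x) (hV : IsSmoothVF V) : Op 𝕜 n S where
  toFun f := ⟨fun x => differential (f : S → 𝕜) x (V x), contMDiff_differential (SmoothFn.contMDiff f) hV⟩
  map_add' f g := by
    ext x
    have hf := ((SmoothFn.contMDiff f).mdifferentiable (by simp)) x
    have hg := ((SmoothFn.contMDiff g).mdifferentiable (by simp)) x
    change mfderiv (𝓡 n) 𝓘(ℝ, 𝕜) ((f : S → 𝕜) + (g : S → 𝕜)) x (V x) = _
    rw [mfderiv_add hf hg]
    rfl
  map_smul' c f := by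
    ext x
    have hf := ((SmoothFn.contMDiff f).mdifferentiable (by simp)) x
    change mfderiv (𝓡 n) 𝓘(ℝ, 𝕜) (c • (f : S → 𝕜)) x (V x)
      = c * differential (f : S → 𝕜) x (V x)
    have h := ((ContinuousLinearMap.mul ℝ 𝕜 c).hasMFDerivAt.comp x hf.hasMFDerivAt).mfderiv
    have e : (ContinuousLinearMap.mul ℝ 𝕜 c) ∘ (f : S → 𝕜) = c • (f : S → 𝕜) := rfl
    rw [e] at h
    rw [h]
    rfl

end Functions

section Group

variable {n : ℕ} {S : Type*} [TopologicalSpace S]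
  [ChartedSpace (EuclideanSpace ℝ (Fin n)) S] [Group S] [LieGroup (𝓡 n) ∞ S]

instance lieGroupMinSmoothness : LieGroup (𝓡 n) (minSmoothness ℝ 3) S :=
  LieGroup.of_le (n := ∞) (by simpa using ENat.LEInfty.out)

instance isManifoldMinSmoothness : IsManifold (𝓡 n) (minSmoothness ℝ 3) S :=
  IsManifold.of_le (n := ∞) (by simpa using ENat.LEInfty.out)

/-- The vector field `X^⋆` with `X^⋆_x = d/dt|₀ exp(-tX) x`, i.e. minus the image of `X` under
the differential at `1` of the right translation by `x`. -/
def starField (X : GroupLieAlgebra (𝓡 n) S) (x : S) : TangentSpace (𝓡 n) x :=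
  -((mfderiv (𝓡 n) (𝓡 n) (fun y : S => y * x) 1 X : TangentSpace (𝓡 n) (1 * x)) :
    EuclideanSpace ℝ (Fin n))

theorem isSmoothVF_mulInvariantVectorField (X : GroupLieAlgebra (𝓡 n) S) :
    IsSmoothVF (mulInvariantVectorField (I := 𝓡 n) X) := by
  let E := EuclideanSpace ℝ (Fin n)
  let fg : S → TangentBundle (𝓡 n) S := fun g => Bundle.TotalSpace.mk' E g 0
  have sfg : ContMDiff (𝓡 n) (𝓡 n).tangent ∞ fg := Bundle.contMDiff_zeroSection _ _
  let fv : S → TangentBundle (𝓡 n) S := fun _ => Bundle.TotalSpace.mk' E 1 X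
  have sfv : ContMDiff (𝓡 n) (𝓡 n).tangent ∞ fv := contMDiff_const
  have S₂ := contMDiff_equivTangentBundleProd_symm (I := 𝓡 n) (I' := 𝓡 n) (M := S) (M' := S)
    (n := ∞)
  have S₃ : ContMDiff ((𝓡 n).prod (𝓡 n)).tangent (𝓡 n).tangent ∞
      (tangentMap ((𝓡 n).prod (𝓡 n)) (𝓡 n) (fun p : S × S => p.1 * p.2)) :=
    (contMDiff_mul (𝓡 n) ∞).contMDiff_tangentMap (by simp)
  have h := (S₃.comp S₂).comp (sfg.prodMk sfv)
  unfold IsSmoothVF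
  convert! h with g
  · simp [fg, fv]
  · simp only [Function.comp_apply, tangentMap, fg, fv]
    rw [mfderiv_prod_eq_add_apply ((contMDiff_mul (𝓡 n) ∞).mdifferentiableAt (by simp))]
    change mfderiv (𝓡 n) (𝓡 n) (fun z : S => g * z) 1 X =
      (mfderiv (𝓡 n) (𝓡 n) (fun z : S => z * 1) g 0 : EuclideanSpace ℝ (Fin n)) +
        (mfderiv (𝓡 n) (𝓡 n) (fun z : S => g * z) 1 X : EuclideanSpace ℝ (Fin n))
    have h0 : (mfderiv (𝓡 n) (𝓡 n) (fun z : S => z * 1) g 0 : EuclideanSpace ℝ (Fin n)) = 0 :=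
      map_zero (mfderiv (𝓡 n) (𝓡 n) (fun z : S => z * 1) g)
    rw [h0]
    exact (zero_add (M := EuclideanSpace ℝ (Fin n)) _).symm

theorem isSmoothVF_starField (X : GroupLieAlgebra (𝓡 n) S) :
    IsSmoothVF (starField X) := by
  let E := EuclideanSpace ℝ (Fin n)
  let fg : S → TangentBundle (𝓡 n) S := fun g => Bundle.TotalSpace.mk' E g 0
  have sfg : ContMDiff (𝓡 n) (𝓡 n).tangent ∞ fg := Bundle.contMDiff_zeroSection _ _
  let fv : S → TangentBundle (𝓡 n) S := fun _ => Bundle.TotalSpace.mk' E 1 (-X)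
  have sfv : ContMDiff (𝓡 n) (𝓡 n).tangent ∞ fv := contMDiff_const
  have S₂ := contMDiff_equivTangentBundleProd_symm (I := 𝓡 n) (I' := 𝓡 n) (M := S) (M' := S)
    (n := ∞)
  have S₃ : ContMDiff ((𝓡 n).prod (𝓡 n)).tangent (𝓡 n).tangent ∞
      (tangentMap ((𝓡 n).prod (𝓡 n)) (𝓡 n) (fun p : S × S => p.1 * p.2)) :=
    (contMDiff_mul (𝓡 n) ∞).contMDiff_tangentMap (by simp)
  have h := (S₃.comp S₂).comp (sfv.prodMk sfg)
  unfold IsSmoothVF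
  convert! h with g
  · simp [fg, fv]
  · simp only [Function.comp_apply, tangentMap, fg, fv]
    rw [mfderiv_prod_eq_add_apply ((contMDiff_mul (𝓡 n) ∞).mdifferentiableAt (by simp))]
    change -(mfderiv (𝓡 n) (𝓡 n) (fun z : S => z * g) 1 X : EuclideanSpace ℝ (Fin n)) =
      (mfderiv (𝓡 n) (𝓡 n) (fun z : S => z * g) 1 (-X) : EuclideanSpace ℝ (Fin n)) +
        (mfderiv (𝓡 n) (𝓡 n) (fun z : S => 1 * z) g 0 : EuclideanSpace ℝ (Fin n))
    have h0 : (mfderiv (𝓡 n) (𝓡 n) (fun z : S => 1 * z) g 0 : EuclideanSpace ℝ (Fin n)) = 0 :=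
      map_zero (mfderiv (𝓡 n) (𝓡 n) (fun z : S => 1 * z) g)
    have h1 : (mfderiv (𝓡 n) (𝓡 n) (fun z : S => z * g) 1 (-X) : EuclideanSpace ℝ (Fin n)) =
        -(mfderiv (𝓡 n) (𝓡 n) (fun z : S => z * g) 1 X : EuclideanSpace ℝ (Fin n)) :=
      map_neg (mfderiv (𝓡 n) (𝓡 n) (fun z : S => z * g) 1) X
    rw [h0, h1]
    exact (add_zero (M := EuclideanSpace ℝ (Fin n)) _).symm

theorem isSmoothVF_mlieBracket {V W : ∀ x : S, TangentSpace (𝓡 n) x}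
    (hV : IsSmoothVF V) (hW : IsSmoothVF W) :
    IsSmoothVF (VectorField.mlieBracket (𝓡 n) V W) := by
  intro x
  have : IsManifold (𝓡 n) ((⊤ : ℕ∞) + 1) S := inferInstanceAs (IsManifold (𝓡 n) ∞ S)
  have := ContMDiffAt.mlieBracket_vectorField (m := ⊤) (n := ⊤) (hV x) (hW x) (by simp)
  exact this

theorem exists_invariant_eq (x : S) (u : TangentSpace (𝓡 n) x) :
    ∃ w : GroupLieAlgebra (𝓡 n) S, mulInvariantVectorField w x = u := by
  have hd : ∀ a b : S, MDifferentiableAt (𝓡 n) (𝓡 n) (fun y : S => a * y) b := fun a b =>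
    (contMDiff_mul_left (I := 𝓡 n) (n := ∞)).mdifferentiable (by simp) b
  refine ⟨(mfderiv (𝓡 n) (𝓡 n) (fun y : S => x⁻¹ * y) x u : EuclideanSpace ℝ (Fin n)), ?_⟩
  have h := mfderiv_comp_of_eq (I := 𝓡 n) (I' := 𝓡 n) (I'' := 𝓡 n) (x := x) (y := (1 : S))
    (g := fun y : S => x * y) (f := fun y : S => x⁻¹ * y) (hd _ _) (hd _ _) (by simp)
  have e : (fun y : S => x * y) ∘ (fun y : S => x⁻¹ * y) = id := by ext y; simp
  rw [e, mfderiv_id] at h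
  have e2 : ∀ b : S, b = 1 → ∀ v : EuclideanSpace ℝ (Fin n),
      (mfderiv (𝓡 n) (𝓡 n) (fun y : S => x * y) b v : EuclideanSpace ℝ (Fin n)) =
        mfderiv (𝓡 n) (𝓡 n) (fun y : S => x * y) 1 v := by
    rintro _ rfl _; rfl
  have h1 := DFunLike.congr_fun h u
  exact (e2 _ (inv_mul_cancel x) _).symm.trans h1.symm

theorem differential_mlieBracket_real {V W : ∀ x : S, TangentSpace (𝓡 n) x}
    (hV : IsSmoothVF V) (hW : IsSmoothVF W) {f : S → ℝ} (hf : ContMDiff (𝓡 n) 𝓘(ℝ, ℝ) ∞ f)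
    (x : S) :
    differential f x (VectorField.mlieBracket (𝓡 n) V W x) =
      differential (fun y => differential f y (W y)) x (V x) -
        differential (fun y => differential f y (V y)) x (W x) := by
  by_cases hu : ∃ u : TangentSpace (𝓡 n) x, u ≠ 0
  swap
  · push Not at hu
    rw [hu (V x), hu (W x), hu (VectorField.mlieBracket (𝓡 n) V W x)]
    simp
  obtain ⟨u, hu⟩ := hu
  obtain ⟨w, hw⟩ := exists_invariant_eq x u
  set Z : ∀ x : S, TangentSpace (𝓡 n) x := mulInvariantVectorField w with hZdef
  have hZ : IsSmoothVF Z := isSmoothVF_mulInvariantVectorField w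
  have : IsManifold (𝓡 n) 2 S := IsManifold.of_le (n := ∞) ENat.LEInfty.out
  have hle : minSmoothness ℝ 2 ≤ (∞ : WithTop ℕ∞) := by simpa using ENat.LEInfty.out
  have hfZ : IsSmoothVF (f • Z) := ContMDiff.smul_section hf hZ
  have md : ∀ {U : ∀ x : S, TangentSpace (𝓡 n) x}, IsSmoothVF U → ∀ y,
      MDifferentiableAt (𝓡 n) (𝓡 n).tangent
        (fun x => (⟨x, U x⟩ : TangentBundle (𝓡 n) S)) y :=
    fun hU y => hU.mdifferentiable (by simp) y
  have key : ∀ {U Y : ∀ x : S, TangentSpace (𝓡 n) x} {g : S → ℝ}, IsSmoothVF U → IsSmoothVF Y →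
      ContMDiff (𝓡 n) 𝓘(ℝ, ℝ) ∞ g →
      VectorField.mlieBracket (𝓡 n) U (g • Y) =
        (fun y => differential g y (U y)) • Y + g • VectorField.mlieBracket (𝓡 n) U Y := by
    intro U Y g hU hY hg
    funext y
    exact VectorField.mlieBracket_smul_right (hg.mdifferentiable (by simp) y) (md hY y)
  have sm : ∀ {Y : ∀ x : S, TangentSpace (𝓡 n) x} {g : S → ℝ}, IsSmoothVF Y →
      ContMDiff (𝓡 n) 𝓘(ℝ, ℝ) ∞ g → IsSmoothVF (g • Y) :=
    fun hY hg => ContMDiff.smul_section hg hY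
  have J := fun {Y : ∀ x : S, TangentSpace (𝓡 n) x} (hY : IsSmoothVF Y) =>
    VectorField.leibniz_identity_mlieBracket_apply (I := 𝓡 n) (x := x)
    ((hV x).of_le hle) ((hW x).of_le hle) ((hY x).of_le hle)
  have J1 := J hfZ
  have J0 := J hZ
  have expand : ∀ {A B : ∀ x : S, TangentSpace (𝓡 n) x}, IsSmoothVF A → IsSmoothVF B →
      VectorField.mlieBracket (𝓡 n) A (VectorField.mlieBracket (𝓡 n) B (f • Z)) x =
        differential (fun y => differential f y (B y)) x (A x) • Z x +
        differential f x (B x) • VectorField.mlieBracket (𝓡 n) A Z x +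
        (differential f x (A x) • VectorField.mlieBracket (𝓡 n) B Z x +
          f x • VectorField.mlieBracket (𝓡 n) A (VectorField.mlieBracket (𝓡 n) B Z) x) := by
    intro A B hA hB
    have hBf := contMDiff_differential hf hB
    have hBZ := isSmoothVF_mlieBracket hB hZ
    rw [key hB hZ hf, VectorField.mlieBracket_add_right (md (sm hZ hBf) x) (md (sm hBZ hf) x),
      key hA hZ hBf, key hA hBZ hf]
    rfl
  rw [expand hV hW, expand hW hV, key (isSmoothVF_mlieBracket hV hW) hZ hf] at J1
  simp only [Pi.add_apply, Pi.smul_apply', J0, hw] at J1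
  have : (differential f x (VectorField.mlieBracket (𝓡 n) V W x) -
      (differential (fun y => differential f y (W y)) x (V x) -
        differential (fun y => differential f y (V y)) x (W x))) • u = 0 := by
    have aux : ∀ (a b c d e k : ℝ) (u p q A B : EuclideanSpace ℝ (Fin n)),
        a • u + b • p + (c • q + k • (A + B)) =
          e • u + k • A + (d • u + c • q + (b • p + k • B)) → (e - (a - d)) • u = 0 := by
      intro a b c d e k u p q A B h
      rw [← sub_eq_zero] at h
      rw [← neg_eq_zero, ← h]
      module
    exact aux _ _ _ _ _ _ _ _ _ _ _ J1
  exact sub_eq_zero.1 ((smul_eq_zero.1 this).resolve_right hu)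

theorem differential_mlieBracket {𝕜 : Type*} [RCLike 𝕜] {V W : ∀ x : S, TangentSpace (𝓡 n) x}
    (hV : IsSmoothVF V) (hW : IsSmoothVF W) {f : S → 𝕜} (hf : ContMDiff (𝓡 n) 𝓘(ℝ, 𝕜) ∞ f)
    (x : S) :
    differential f x (VectorField.mlieBracket (𝓡 n) V W x) =
      differential (fun y => differential f y (W y)) x (V x) -
        differential (fun y => differential f y (V y)) x (W x) := by
  have comp : ∀ (L : 𝕜 →L[ℝ] ℝ) {g : S → 𝕜}, ContMDiff (𝓡 n) 𝓘(ℝ, 𝕜) ∞ g →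
      ∀ y v, differential (n := n) (fun z => L (g z)) y v = L (differential g y v) := by
    intro L g hg y v
    exact DFunLike.congr_fun
      ((L.hasMFDerivAt.comp y (hg.mdifferentiable (by simp) y).hasMFDerivAt).mfderiv) v
  have main : ∀ L : 𝕜 →L[ℝ] ℝ,
      L (differential f x (VectorField.mlieBracket (𝓡 n) V W x)) =
      L (differential (fun y => differential f y (W y)) x (V x) -
        differential (fun y => differential f y (V y)) x (W x)) := by
    intro L
    have h := differential_mlieBracket_real hV hW
      (f := fun z => L (f z)) (L.contDiff.contMDiff.comp hf) x
    simp only [comp L hf] at h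
    rw [comp L (contMDiff_differential hf hW), comp L (contMDiff_differential hf hV)] at h
    rw [h, map_sub]
  exact RCLike.ext (main RCLike.reCLM) (main RCLike.imCLM)

theorem lie_vfOp (𝕜 : Type*) [RCLike 𝕜] {V W : ∀ x : S, TangentSpace (𝓡 n) x}
    (hV : IsSmoothVF V) (hW : IsSmoothVF W) :
    ⁅vfOp 𝕜 V hV, vfOp 𝕜 W hW⁆ =
      vfOp 𝕜 (VectorField.mlieBracket (𝓡 n) V W) (isSmoothVF_mlieBracket hV hW) := by
  ext f x
  exact (differential_mlieBracket hV hW (SmoothFn.contMDiff f) x).symm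

variable (𝕜 : Type*) [RCLike 𝕜]

/-- The action of the Lie algebra of `S` on `C^∞(S)` by left-invariant vector fields. -/
def leftAction : GroupLieAlgebra (𝓡 n) S →ₗ⁅ℝ⁆ Op 𝕜 n S where
  toFun X := vfOp 𝕜 (mulInvariantVectorField X) (isSmoothVF_mulInvariantVectorField X)
  map_add' X Y := by
    ext f x
    change differential (f : S → 𝕜) x _ = differential (f : S → 𝕜) x _ + differential (f : S → 𝕜) x _
    rw [mulInvariantVectorField_add, ← map_add]
    rfl
  map_smul' c X := by
    ext f x
    change differential (f : S → 𝕜) x _ = c • differential (f : S → 𝕜) x _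
    rw [mulInvariantVectorField_smul, ← map_smul]
    rfl
  map_lie' {X Y} := by
    rw [lie_vfOp]
    congr 1
    exact mulInvariantVector_mlieBracket X Y

end Group

section Enveloping

variable (𝕜 : Type*) [RCLike 𝕜] (𝔰 : Type*) [LieRing 𝔰] [LieAlgebra ℝ 𝔰]

/-- The enveloping algebra `U(𝔰)` of a real Lie algebra, with coefficients in `𝕜`. -/
abbrev EnvAlg : Type _ := 𝕜 ⊗[ℝ] UniversalEnvelopingAlgebra ℝ 𝔰

/-- The Lie homomorphism `X ↦ X ⊗ 1 + 1 ⊗ X`. -/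
def primitive : 𝔰 →ₗ⁅ℝ⁆ EnvAlg 𝕜 𝔰 ⊗[𝕜] EnvAlg 𝕜 𝔰 where
  toFun X := ((1 : 𝕜) ⊗ₜ[ℝ] UniversalEnvelopingAlgebra.ι ℝ X) ⊗ₜ[𝕜] (1 : EnvAlg 𝕜 𝔰) +
    (1 : EnvAlg 𝕜 𝔰) ⊗ₜ[𝕜] ((1 : 𝕜) ⊗ₜ[ℝ] UniversalEnvelopingAlgebra.ι ℝ X)
  map_add' X Y := by
    simp only [map_add, TensorProduct.tmul_add, TensorProduct.add_tmul]
    abel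
  map_smul' c X := by
    rw [map_smul, TensorProduct.tmul_smul, TensorProduct.tmul_smul, ← TensorProduct.smul_tmul',
      ← smul_add, RingHom.id_apply]
  map_lie' {X Y} := by
    simp only [LieHom.map_lie, Ring.lie_def, TensorProduct.tmul_sub, TensorProduct.sub_tmul,
      add_mul, mul_add, Algebra.TensorProduct.tmul_mul_tmul, one_mul, mul_one]
    abel

/-- The coproduct `Δ : U(𝔰) → U(𝔰) ⊗ U(𝔰)`, the algebra homomorphism with
`Δ X = X ⊗ 1 + 1 ⊗ X` for `X ∈ 𝔰`. -/
def comul : EnvAlg 𝕜 𝔰 →ₐ[𝕜] EnvAlg 𝕜 𝔰 ⊗[𝕜] EnvAlg 𝕜 𝔰 :=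
  Algebra.TensorProduct.lift (Algebra.ofId 𝕜 _)
    (UniversalEnvelopingAlgebra.lift ℝ (primitive 𝕜 𝔰))
    (fun c _ => Algebra.commutes c _)

variable {𝕜 𝔰}

/-- `F ∈ (U(𝔰) ⊗ U(𝔰))[[ν]]` is a Drinfel'd twist: `F = 1 ⊗ 1 + O(ν)`, and the cocycle relation
`(Δ ⊗ id)(F) · (F ⊗ 1) = (id ⊗ Δ)(F) · (1 ⊗ F)` holds in `(U(𝔰) ⊗ U(𝔰) ⊗ U(𝔰))[[ν]]`. -/
structure IsTwist (F : (EnvAlg 𝕜 𝔰 ⊗[𝕜] EnvAlg 𝕜 𝔰)⟦X⟧) : Prop where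
  coeff_zero : PowerSeries.coeff 0 F = 1
  cocycle :
    PowerSeries.map (((Algebra.TensorProduct.assoc 𝕜 𝕜 𝕜
        (EnvAlg 𝕜 𝔰) (EnvAlg 𝕜 𝔰) (EnvAlg 𝕜 𝔰)).toAlgHom.comp
          (Algebra.TensorProduct.map (comul 𝕜 𝔰) (AlgHom.id 𝕜 (EnvAlg 𝕜 𝔰)))).toRingHom) F *
      PowerSeries.map (((Algebra.TensorProduct.assoc 𝕜 𝕜 𝕜
        (EnvAlg 𝕜 𝔰) (EnvAlg 𝕜 𝔰) (EnvAlg 𝕜 𝔰)).toAlgHom.comp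
          (Algebra.TensorProduct.includeLeft :
            EnvAlg 𝕜 𝔰 ⊗[𝕜] EnvAlg 𝕜 𝔰 →ₐ[𝕜]
              (EnvAlg 𝕜 𝔰 ⊗[𝕜] EnvAlg 𝕜 𝔰) ⊗[𝕜] EnvAlg 𝕜 𝔰)).toRingHom) F =
    PowerSeries.map (Algebra.TensorProduct.map (AlgHom.id 𝕜 (EnvAlg 𝕜 𝔰))
        (comul 𝕜 𝔰)).toRingHom F *
      PowerSeries.map (Algebra.TensorProduct.includeRight :
        EnvAlg 𝕜 𝔰 ⊗[𝕜] EnvAlg 𝕜 𝔰 →ₐ[𝕜]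
          EnvAlg 𝕜 𝔰 ⊗[𝕜] (EnvAlg 𝕜 𝔰 ⊗[𝕜] EnvAlg 𝕜 𝔰)).toRingHom F

end Enveloping

section DifferentialOperators

variable {𝕜 : Type*} [Field 𝕜] {A : Type*} [CommRing A] [Algebra 𝕜 A]

/-- Differential operators of order at most `k` on a commutative algebra: the commutator with the
multiplication by any element vanishes (`k = 0`), resp. has order at most `k - 1`. On the algebra
of smooth functions of a manifold these are the usual differential operators. -/
def IsDiffOpOfOrder : ℕ → Module.End 𝕜 A → Prop
  | 0, D => ∀ a : A, D * LinearMap.mulLeft 𝕜 a - LinearMap.mulLeft 𝕜 a * D = 0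
  | k + 1, D => ∀ a : A,
      IsDiffOpOfOrder k (D * LinearMap.mulLeft 𝕜 a - LinearMap.mulLeft 𝕜 a * D)

/-- Differential operators, of arbitrary finite order. -/
def IsDiffOp (D : Module.End 𝕜 A) : Prop := ∃ k, IsDiffOpOfOrder k D

/-- Bilinear operators that are differential operators of order at most `k` in each argument. -/
def IsBidiffOpOfOrder (k : ℕ) (C : A →ₗ[𝕜] A →ₗ[𝕜] A) : Prop :=
  (∀ u, IsDiffOpOfOrder k (C u)) ∧ ∀ v, IsDiffOpOfOrder k (C.flip v)

theorem IsDiffOpOfOrder.zero : ∀ k, IsDiffOpOfOrder k (0 : Module.End 𝕜 A)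
  | 0 => fun a => by simp
  | k + 1 => fun a => by simpa using IsDiffOpOfOrder.zero k

theorem IsDiffOpOfOrder.succ : ∀ {k} {D : Module.End 𝕜 A},
    IsDiffOpOfOrder k D → IsDiffOpOfOrder (k + 1) D
  | 0, D, h => fun a => by rw [h a]; exact IsDiffOpOfOrder.zero 0
  | _ + 1, _, h => fun a => (h a).succ

theorem IsDiffOpOfOrder.mono {k l : ℕ} {D : Module.End 𝕜 A} (h : IsDiffOpOfOrder k D)
    (hkl : k ≤ l) : IsDiffOpOfOrder l D := by
  induction hkl with
  | refl => exact h
  | step _ ih => exact ih.succ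

theorem IsDiffOpOfOrder.add : ∀ {k} {D E : Module.End 𝕜 A},
    IsDiffOpOfOrder k D → IsDiffOpOfOrder k E → IsDiffOpOfOrder k (D + E)
  | 0, D, E, hD, hE => fun a => by
    have := congrArg₂ (· + ·) (hD a) (hE a)
    simp only [add_zero] at this
    rw [← this]
    noncomm_ring
  | k + 1, D, E, hD, hE => fun a => by
    have := (hD a).add (hE a)
    convert this using 1
    noncomm_ring

theorem IsDiffOpOfOrder.mul : ∀ {m k l : ℕ} {D E : Module.End 𝕜 A}, k + l ≤ m →
    IsDiffOpOfOrder k D → IsDiffOpOfOrder l E → IsDiffOpOfOrder m (D * E) := by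
  intro m
  induction m with
  | zero =>
    intro k l D E h hD hE a
    obtain rfl : k = 0 := by omega
    obtain rfl : l = 0 := by omega
    have h1 := sub_eq_zero.1 (hD a)
    have h2 := sub_eq_zero.1 (hE a)
    rw [mul_assoc, h2, ← mul_assoc, h1, mul_assoc, sub_self]
  | succ m ih =>
    intro k l D E h hD hE a
    have e : D * E * LinearMap.mulLeft 𝕜 a - LinearMap.mulLeft 𝕜 a * (D * E) =
        D * (E * LinearMap.mulLeft 𝕜 a - LinearMap.mulLeft 𝕜 a * E) +
          (D * LinearMap.mulLeft 𝕜 a - LinearMap.mulLeft 𝕜 a * D) * E := by noncomm_ring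
    rw [e]
    refine IsDiffOpOfOrder.add ?_ ?_
    · cases l with
      | zero => rw [hE a, mul_zero]; exact IsDiffOpOfOrder.zero m
      | succ l => exact ih (by omega) hD (hE a)
    · cases k with
      | zero => rw [hD a, zero_mul]; exact IsDiffOpOfOrder.zero m
      | succ k => exact ih (by omega) (hD a) hE

theorem IsDiffOp.zero : IsDiffOp (0 : Module.End 𝕜 A) := ⟨0, IsDiffOpOfOrder.zero 0⟩

theorem IsDiffOp.add {D E : Module.End 𝕜 A} (hD : IsDiffOp D) (hE : IsDiffOp E) :
    IsDiffOp (D + E) := by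
  obtain ⟨k, hk⟩ := hD
  obtain ⟨l, hl⟩ := hE
  exact ⟨max k l, (hk.mono (le_max_left _ _)).add (hl.mono (le_max_right _ _))⟩

theorem IsDiffOp.mul {D E : Module.End 𝕜 A} (hD : IsDiffOp D) (hE : IsDiffOp E) :
    IsDiffOp (D * E) := by
  obtain ⟨k, hk⟩ := hD
  obtain ⟨l, hl⟩ := hE
  exact ⟨k + l, IsDiffOpOfOrder.mul le_rfl hk hl⟩

theorem IsDiffOp.smul {D : Module.End 𝕜 A} (c : 𝕜) (hD : IsDiffOp D) : IsDiffOp (c • D) := by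
  have h : IsDiffOp (c • (1 : Module.End 𝕜 A)) := by
    refine ⟨0, fun a => ?_⟩
    ext x
    simp
  have := h.mul hD
  rwa [smul_mul_assoc, one_mul] at this

theorem IsDiffOp.sum {ι : Type*} (s : Finset ι) {D : ι → Module.End 𝕜 A}
    (h : ∀ i ∈ s, IsDiffOp (D i)) : IsDiffOp (∑ i ∈ s, D i) := by
  classical
  induction s using Finset.induction_on with
  | empty => simpa using IsDiffOp.zero
  | insert i s hi ih =>
    rw [Finset.sum_insert hi]
    exact (h i (Finset.mem_insert_self i s)).add
      (ih fun j hj => h j (Finset.mem_insert_of_mem hj))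

end DifferentialOperators

section Series

variable {𝕜 : Type*} [Field 𝕜] {A : Type*} [CommRing A] [Algebra 𝕜 A]

/-- The `𝕜[[ν]]`-bilinear extension `u ⋆ v = ∑ₖ νᵏ Cₖ(u, v)` to `A[[ν]]` of a sequence of
cochains `Cₖ : A × A → A`. -/
def starMul (C : ℕ → A →ₗ[𝕜] A →ₗ[𝕜] A) (u v : A⟦X⟧) : A⟦X⟧ :=
  PowerSeries.mk fun N => ∑ p ∈ Finset.HasAntidiagonal.antidiagonal N, ∑ q ∈ Finset.HasAntidiagonal.antidiagonal p.2,
    C p.1 (PowerSeries.coeff q.1 u) (PowerSeries.coeff q.2 v)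

/-- The `𝕜[[ν]]`-linear extension to `A[[ν]]` of a formal power series of operators on `A`. -/
def opApply (D : (Module.End 𝕜 A)⟦X⟧) (u : A⟦X⟧) : A⟦X⟧ :=
  PowerSeries.mk fun N => ∑ p ∈ Finset.HasAntidiagonal.antidiagonal N,
    (PowerSeries.coeff p.1 D) (PowerSeries.coeff p.2 u)

/-- `D = ∑ₖ νᵏ Dₖ` is a derivation of the product `⋆` with cochains `C`: each `Dₖ` is a
differential operator and `D(u ⋆ v) = (D u) ⋆ v + u ⋆ (D v)`. -/
def IsStarDerivation (C : ℕ → A →ₗ[𝕜] A →ₗ[𝕜] A) (D : (Module.End 𝕜 A)⟦X⟧) : Prop :=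
  (∀ k, IsDiffOp (PowerSeries.coeff k D)) ∧
    ∀ u v : A⟦X⟧, opApply D (starMul C u v) =
      starMul C (opApply D u) v + starMul C u (opApply D v)

theorem sum_antidiagonal_assoc {M : Type*} [AddCommMonoid M] (f : ℕ → ℕ → ℕ → M) (N : ℕ) :
    ∑ p ∈ Finset.HasAntidiagonal.antidiagonal N, ∑ q ∈ Finset.HasAntidiagonal.antidiagonal p.1,
      f q.1 q.2 p.2 =
    ∑ p ∈ Finset.HasAntidiagonal.antidiagonal N, ∑ q ∈ Finset.HasAntidiagonal.antidiagonal p.2,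
      f p.1 q.1 q.2 := by
  rw [Finset.sum_sigma', Finset.sum_sigma']
  refine Finset.sum_bij' (fun x _ => ⟨(x.2.1, x.2.2 + x.1.2), (x.2.2, x.1.2)⟩)
    (fun x _ => ⟨(x.1.1 + x.2.1, x.2.2), (x.1.1, x.2.1)⟩) ?_ ?_ ?_ ?_ ?_ <;>
    simp only [Finset.mem_sigma, Finset.HasAntidiagonal.mem_antidiagonal, Sigma.forall,
      Prod.forall, and_imp]
  · intros; refine ⟨?_, ?_⟩ <;> lia
  · intros; refine ⟨?_, ?_⟩ <;> lia
  · rintro a b c d h1 rfl; rfl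
  · rintro a b c d h1 rfl; rfl
  · intros; trivial

theorem sum_antidiagonal_left_comm {M : Type*} [AddCommMonoid M] (f : ℕ → ℕ → ℕ → M) (N : ℕ) :
    ∑ p ∈ Finset.HasAntidiagonal.antidiagonal N, ∑ q ∈ Finset.HasAntidiagonal.antidiagonal p.2,
      f p.1 q.1 q.2 =
    ∑ p ∈ Finset.HasAntidiagonal.antidiagonal N, ∑ q ∈ Finset.HasAntidiagonal.antidiagonal p.2,
      f q.1 p.1 q.2 := by
  rw [Finset.sum_sigma', Finset.sum_sigma']
  refine Finset.sum_bij' (fun x _ => ⟨(x.2.1, x.1.1 + x.2.2), (x.1.1, x.2.2)⟩)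
    (fun x _ => ⟨(x.2.1, x.1.1 + x.2.2), (x.1.1, x.2.2)⟩) ?_ ?_ ?_ ?_ ?_ <;>
    simp only [Finset.mem_sigma, Finset.HasAntidiagonal.mem_antidiagonal, Sigma.forall,
      Prod.forall, and_imp]
  · intros; refine ⟨?_, ?_⟩ <;> lia
  · intros; refine ⟨?_, ?_⟩ <;> lia
  · rintro a b c d h1 rfl; rfl
  · rintro a b c d h1 rfl; rfl
  · intros; trivial

theorem opApply_mul (D E : (Module.End 𝕜 A)⟦X⟧) (u : A⟦X⟧) :
    opApply (D * E) u = opApply D (opApply E u) := by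
  ext N
  simp only [opApply, PowerSeries.coeff_mk, PowerSeries.coeff_mul, LinearMap.sum_apply, map_sum]
  exact sum_antidiagonal_assoc (fun i j k => (PowerSeries.coeff i D)
    ((PowerSeries.coeff j E) (PowerSeries.coeff k u))) N

theorem opApply_add (D E : (Module.End 𝕜 A)⟦X⟧) (u : A⟦X⟧) :
    opApply (D + E) u = opApply D u + opApply E u := by
  ext N
  simp [opApply, Finset.sum_add_distrib]

theorem opApply_sub (D E : (Module.End 𝕜 A)⟦X⟧) (u : A⟦X⟧) :
    opApply (D - E) u = opApply D u - opApply E u := by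
  ext N
  simp [opApply, Finset.sum_sub_distrib]

theorem opApply_zero (u : A⟦X⟧) : opApply (0 : (Module.End 𝕜 A)⟦X⟧) u = 0 := by
  ext N
  simp [opApply]

theorem opApply_map_add (D : (Module.End 𝕜 A)⟦X⟧) (u v : A⟦X⟧) :
    opApply D (u + v) = opApply D u + opApply D v := by
  ext N
  simp [opApply, Finset.sum_add_distrib]

theorem starMul_add_left (C : ℕ → A →ₗ[𝕜] A →ₗ[𝕜] A) (u u' v : A⟦X⟧) :
    starMul C (u + u') v = starMul C u v + starMul C u' v := by
  ext N
  simp [starMul, Finset.sum_add_distrib]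

theorem starMul_add_right (C : ℕ → A →ₗ[𝕜] A →ₗ[𝕜] A) (u v v' : A⟦X⟧) :
    starMul C u (v + v') = starMul C u v + starMul C u v' := by
  ext N
  simp [starMul, Finset.sum_add_distrib]

theorem starMul_sub_left (C : ℕ → A →ₗ[𝕜] A →ₗ[𝕜] A) (u u' v : A⟦X⟧) :
    starMul C (u - u') v = starMul C u v - starMul C u' v := by
  ext N
  simp [starMul, Finset.sum_sub_distrib]

theorem starMul_sub_right (C : ℕ → A →ₗ[𝕜] A →ₗ[𝕜] A) (u v v' : A⟦X⟧) :
    starMul C u (v - v') = starMul C u v - starMul C u v' := by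
  ext N
  simp [starMul, Finset.sum_sub_distrib]

/-- A series of operators with scalar coefficients. -/
def IsScalarSeries (c : (Module.End 𝕜 A)⟦X⟧) : Prop :=
  ∃ z : ℕ → 𝕜, ∀ i, PowerSeries.coeff i c = z i • (1 : Module.End 𝕜 A)

theorem IsScalarSeries.starMul_left (C : ℕ → A →ₗ[𝕜] A →ₗ[𝕜] A) {c : (Module.End 𝕜 A)⟦X⟧}
    (hc : IsScalarSeries c) (u v : A⟦X⟧) :
    starMul C (opApply c u) v = opApply c (starMul C u v) := by
  obtain ⟨z, hz⟩ := hc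
  ext N
  simp only [starMul, opApply, PowerSeries.coeff_mk, hz, map_sum, LinearMap.sum_apply,
    LinearMap.smul_apply, Module.End.one_apply, map_smul]
  rw [sum_antidiagonal_left_comm (fun i k m => ∑ r ∈ Finset.HasAntidiagonal.antidiagonal m,
    z i • C k (PowerSeries.coeff r.1 u) (PowerSeries.coeff r.2 v)) N]
  refine Finset.sum_congr rfl fun p _ => ?_
  exact sum_antidiagonal_assoc (fun i a b =>
    z i • C p.1 (PowerSeries.coeff a u) (PowerSeries.coeff b v)) p.2

theorem IsScalarSeries.starMul_right (C : ℕ → A →ₗ[𝕜] A →ₗ[𝕜] A) {c : (Module.End 𝕜 A)⟦X⟧}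
    (hc : IsScalarSeries c) (u v : A⟦X⟧) :
    starMul C u (opApply c v) = opApply c (starMul C u v) := by
  obtain ⟨z, hz⟩ := hc
  ext N
  simp only [starMul, opApply, PowerSeries.coeff_mk, hz, map_sum,
    LinearMap.smul_apply, Module.End.one_apply, map_smul]
  rw [sum_antidiagonal_left_comm (fun i k m => ∑ r ∈ Finset.HasAntidiagonal.antidiagonal m,
    z i • C k (PowerSeries.coeff r.1 u) (PowerSeries.coeff r.2 v)) N]
  refine Finset.sum_congr rfl fun p _ => ?_
  exact sum_antidiagonal_left_comm (fun a i b =>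
    z i • C p.1 (PowerSeries.coeff a u) (PowerSeries.coeff b v)) p.2

variable {C : ℕ → A →ₗ[𝕜] A →ₗ[𝕜] A} {D E : (Module.End 𝕜 A)⟦X⟧}

theorem IsStarDerivation.zero : IsStarDerivation C (0 : (Module.End 𝕜 A)⟦X⟧) :=
  ⟨fun k => by simpa using IsDiffOp.zero, fun u v => by
    rw [opApply_zero, opApply_zero, opApply_zero]
    ext N
    simp [starMul]⟩

theorem IsStarDerivation.add (hD : IsStarDerivation C D) (hE : IsStarDerivation C E) :
    IsStarDerivation C (D + E) :=
  ⟨fun k => by rw [map_add]; exact (hD.1 k).add (hE.1 k), fun u v => by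
    simp only [opApply_add, hD.2, hE.2, starMul_add_left, starMul_add_right]
    abel⟩

theorem IsStarDerivation.scalar_mul {c : (Module.End 𝕜 A)⟦X⟧} (hc : IsScalarSeries c)
    (hD : IsStarDerivation C D) : IsStarDerivation C (c * D) :=
  ⟨fun k => by
    obtain ⟨z, hz⟩ := hc
    rw [PowerSeries.coeff_mul]
    refine IsDiffOp.sum _ fun p _ => ?_
    rw [hz, smul_mul_assoc, one_mul]
    exact (hD.1 _).smul _, fun u v => by
    simp only [opApply_mul, hD.2, opApply_map_add, hc.starMul_left, hc.starMul_right]⟩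

theorem IsStarDerivation.lie (hD : IsStarDerivation C D) (hE : IsStarDerivation C E) :
    IsStarDerivation C ⁅D, E⁆ := by
  have aux : ∀ {P Q : (Module.End 𝕜 A)⟦X⟧}, (∀ k, IsDiffOp (PowerSeries.coeff k P)) →
      (∀ k, IsDiffOp (PowerSeries.coeff k Q)) → ∀ k, IsDiffOp (PowerSeries.coeff k (P * Q)) :=
    fun hP hQ k => by
      rw [PowerSeries.coeff_mul]
      exact IsDiffOp.sum _ fun p _ => (hP _).mul (hQ _)
  refine ⟨fun k => ?_, fun u v => ?_⟩
  · have h := (aux hE.1 hD.1 k).smul (-1 : 𝕜)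
    have := (aux hD.1 hE.1 k).add h
    rwa [neg_one_smul, ← sub_eq_add_neg, ← map_sub, ← Ring.lie_def] at this
  · simp only [Ring.lie_def, opApply_sub, opApply_mul, hD.2, hE.2, opApply_map_add,
      starMul_sub_left, starMul_sub_right]
    abel

end Series

section StarProducts

variable {𝕜 : Type*} [RCLike 𝕜] {n : ℕ} {S : Type*} [TopologicalSpace S]
  [ChartedSpace (EuclideanSpace ℝ (Fin n)) S]

theorem isScalarSeries_algebraMap (c : ℝ⟦X⟧) :
    IsScalarSeries (algebraMap ℝ⟦X⟧ (OpSeries 𝕜 n S) c) := by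
  refine ⟨fun i => ((PowerSeries.coeff i c : ℝ) : 𝕜), fun i => ?_⟩
  ext f x
  change (PowerSeries.coeff i c : ℝ) • (f : S → 𝕜) x = _
  rw [RCLike.real_smul_eq_coe_mul]
  rfl

/-- The cochains `Cₖ : C^∞(S) × C^∞(S) → C^∞(S)` of a formal product on `C^∞(S)[[ν]]`. -/
abbrev Cochains (𝕜 : Type*) [RCLike 𝕜] (n : ℕ) (S : Type*) [TopologicalSpace S]
    [ChartedSpace (EuclideanSpace ℝ (Fin n)) S] : Type _ :=
  ℕ → SmoothFn 𝕜 n S →ₗ[𝕜] SmoothFn 𝕜 n S →ₗ[𝕜] SmoothFn 𝕜 n S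

/-- The Lie algebra `Der(⋆)` over `ℝ[[ν]]` of derivations of the product with cochains `C`. -/
def Der (C : Cochains 𝕜 n S) : LieSubalgebra ℝ⟦X⟧ (OpSeries 𝕜 n S) where
  carrier := {D | IsStarDerivation C D}
  zero_mem' := IsStarDerivation.zero
  add_mem' := IsStarDerivation.add
  smul_mem' c D hD := by
    change IsStarDerivation C (c • D)
    rw [Algebra.smul_def]
    exact hD.scalar_mul (isScalarSeries_algebraMap c)
  lie_mem' := IsStarDerivation.lie

instance : IsScalarTower ℝ ℝ⟦X⟧ (OpSeries 𝕜 n S) :=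
  ⟨fun a c D => by
    rw [Algebra.smul_def (a • c), Algebra.smul_def c]
    have : algebraMap ℝ⟦X⟧ (OpSeries 𝕜 n S) (a • c) = a • algebraMap ℝ⟦X⟧ (OpSeries 𝕜 n S) c := by
      ext1 k
      change algebraMap ℝ (Op 𝕜 n S) (PowerSeries.coeff k (a • c)) =
        a • algebraMap ℝ (Op 𝕜 n S) (PowerSeries.coeff k c)
      simp [Algebra.smul_def]
    rw [this, smul_mul_assoc]⟩

instance (C : Cochains 𝕜 n S) : IsScalarTower ℝ ℝ⟦X⟧ (Der C) :=
  ⟨fun a c D => Subtype.ext (smul_assoc a c (D : OpSeries 𝕜 n S))⟩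

instance (C : Cochains 𝕜 n S) : SMulCommClass ℝ ℝ⟦X⟧ (Der C) := IsScalarTower.to_smulCommClass

/-- A product is natural when its second cochain `C₂` is a bidifferential operator of order (at
most) two in each argument. -/
def IsNatural (C : Cochains 𝕜 n S) : Prop := IsBidiffOpOfOrder 2 (C 2)

variable [Group S] [LieGroup (𝓡 n) ∞ S]

variable (𝕜) in
/-- The operator on `C^∞(S)` given by the vector field `X^⋆`. -/
def starOp (X : GroupLieAlgebra (𝓡 n) S) : Op 𝕜 n S :=
  vfOp 𝕜 (starField X) (isSmoothVF_starField X)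

/-- The Lie algebra of the smooth real vector fields (acting on functions, with the
commutator as bracket) that are derivations of the product with cochains `C`. -/
def InternalSymmetry (C : Cochains 𝕜 n S) : LieSubalgebra ℝ (Op 𝕜 n S) where
  carrier := {T | (∃ V, ∃ hV : IsSmoothVF V, T = vfOp 𝕜 V hV) ∧
    (PowerSeries.C T : OpSeries 𝕜 n S) ∈ Der C}
  zero_mem' := by
    refine ⟨⟨0, Bundle.contMDiff_zeroSection _ _, ?_⟩, ?_⟩
    · ext f x
      exact (map_zero (differential (f : S → 𝕜) x)).symm
    · rw [map_zero]
      exact zero_mem _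
  add_mem' := by
    rintro _ _ ⟨⟨V, hV, rfl⟩, h⟩ ⟨⟨W, hW, rfl⟩, h'⟩
    refine ⟨⟨V + W, ContMDiff.add_section hV hW, ?_⟩, ?_⟩
    · ext f x
      exact (map_add (differential (f : S → 𝕜) x) _ _).symm
    · rw [map_add]
      exact add_mem h h'
  smul_mem' := by
    rintro c _ ⟨⟨V, hV, rfl⟩, h⟩
    refine ⟨⟨c • V, ContMDiff.const_smul_section hV, ?_⟩, ?_⟩
    · ext f x
      exact (map_smul (differential (f : S → 𝕜) x) c _).symm
    · have : (PowerSeries.C (c • vfOp 𝕜 V hV) : OpSeries 𝕜 n S) =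
          (PowerSeries.C c : ℝ⟦X⟧) • (PowerSeries.C (vfOp 𝕜 V hV) : OpSeries 𝕜 n S) := by
        rw [Algebra.smul_def, Algebra.smul_def, map_mul]
        congr 1
        exact (PowerSeries.map_C _ _).symm
      rw [this]
      exact (Der C).smul_mem _ h
  lie_mem' := by
    rintro _ _ ⟨⟨V, hV, rfl⟩, h⟩ ⟨⟨W, hW, rfl⟩, h'⟩
    refine ⟨⟨_, isSmoothVF_mlieBracket hV hW, lie_vfOp 𝕜 hV hW⟩, ?_⟩
    rw [Ring.lie_def, map_sub, map_mul, map_mul]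
    exact (Der C).lie_mem h h'

/-- The `𝔰`-relative Lie algebra homomorphisms `D : 𝔤 → Der(⋆)`, where `𝔤` is the internal symmetry
Lie algebra of the product with cochains `C₁`, and `⋆` is the product with cochains `C₂`: those with
`D_X = X^⋆` for `X ∈ 𝔰`, where `𝔰` is seen in `𝔤` by means of `X ↦ X^⋆`. -/
def RelHom (C₁ C₂ : Cochains 𝕜 n S) : Set (InternalSymmetry C₁ →ₗ[ℝ] Der C₂) :=
  {D | (∀ Y Z : InternalSymmetry C₁, D ⁅Y, Z⁆ = ⁅D Y, D Z⁆) ∧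
    ∀ (X : GroupLieAlgebra (𝓡 n) S) (hX : starOp 𝕜 X ∈ InternalSymmetry C₁),
      (D ⟨starOp 𝕜 X, hX⟩ : OpSeries 𝕜 n S) = PowerSeries.C (starOp 𝕜 X)}

/-- The pull-back `f ↦ f(g ·)` of functions by a left translation. -/
def leftTranslate (g : S) (f : SmoothFn 𝕜 n S) : SmoothFn 𝕜 n S :=
  ⟨fun x => (f : S → 𝕜) (g * x),
    (SmoothFn.contMDiff f).comp (contMDiff_mul_left (I := 𝓡 n) (n := ∞) (a := g))⟩

/-- Two products are left-equivariantly equivalent: there is a formal series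
`T = id + ∑_{k ≥ 1} νᵏ Tₖ` of differential operators that commutes with the left translations and
satisfies `T(u) ⋆₂ T(v) = T(u ⋆₁ v)`. -/
def IsLeftEquivalent (C₁ C₂ : Cochains 𝕜 n S) : Prop :=
  ∃ T : OpSeries 𝕜 n S, PowerSeries.coeff 0 T = 1 ∧
    (∀ k, IsDiffOp (PowerSeries.coeff k T)) ∧
    (∀ (k : ℕ) (g : S) (u : SmoothFn 𝕜 n S), PowerSeries.coeff k T (leftTranslate g u) =
      leftTranslate g (PowerSeries.coeff k T u)) ∧
    ∀ u v : SmoothFn 𝕜 n S,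
      starMul C₂ (opApply T (PowerSeries.C u)) (opApply T (PowerSeries.C v)) =
        opApply T (starMul C₁ (PowerSeries.C u) (PowerSeries.C v))

variable (𝕜) in
/-- The action of `U(𝔰)` on `C^∞(S)` by left-invariant differential operators. -/
def leftInvOp : EnvAlg 𝕜 (GroupLieAlgebra (𝓡 n) S) →ₐ[𝕜] Op 𝕜 n S :=
  Algebra.TensorProduct.lift (Algebra.ofId 𝕜 _)
    (UniversalEnvelopingAlgebra.lift ℝ (leftAction 𝕜))
    (fun c _ => Algebra.commutes c _)

/-- The left-invariant bidifferential operator on `C^∞(S)` associated with an element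
of `U(𝔰) ⊗ U(𝔰)`: to `a ⊗ b` corresponds `(u, v) ↦ (a u) (b v)`. -/
def leftInvBidiffOp
    (w : EnvAlg 𝕜 (GroupLieAlgebra (𝓡 n) S) ⊗[𝕜] EnvAlg 𝕜 (GroupLieAlgebra (𝓡 n) S)) :
    SmoothFn 𝕜 n S →ₗ[𝕜] SmoothFn 𝕜 n S →ₗ[𝕜] SmoothFn 𝕜 n S :=
  TensorProduct.lift (LinearMap.mk₂ 𝕜
    (fun a b => (LinearMap.mul 𝕜 (SmoothFn 𝕜 n S)).compl₁₂ (leftInvOp 𝕜 a) (leftInvOp 𝕜 b))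
    (fun _ _ _ => by ext1; ext1; simp)
    (fun _ _ _ => by ext1; ext1; simp)
    (fun _ _ _ => by ext1; ext1; simp [mul_add])
    (fun _ _ _ => by ext1; ext1; simp)) w

/-- The cochains of the left-invariant product on `C^∞(S)[[ν]]` associated with a formal series
`F ∈ (U(𝔰) ⊗ U(𝔰))[[ν]]`. -/
def twistCochains (F : (EnvAlg 𝕜 (GroupLieAlgebra (𝓡 n) S) ⊗[𝕜]
    EnvAlg 𝕜 (GroupLieAlgebra (𝓡 n) S))⟦X⟧) : Cochains 𝕜 n S :=
  fun k => leftInvBidiffOp (PowerSeries.coeff k F)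

end StarProducts

section Symplectic

variable (n : ℕ) (S : Type*) [TopologicalSpace S]
  [ChartedSpace (EuclideanSpace ℝ (Fin n)) S] [Group S] [LieGroup (𝓡 n) ∞ S]

/-- A left-invariant symplectic form on the Lie group `S`: a smooth, closed, nondegenerate
two-form that is invariant under the left translations. Closedness is expressed by the vanishing
of `dω(U, V, W) = ∑_cyclic (U ω(V, W) - ω([U, V], W))` on smooth vector fields. -/
structure InvariantSymplecticForm where
  form : ∀ x : S, TangentSpace (𝓡 n) x →ₗ[ℝ] TangentSpace (𝓡 n) x →ₗ[ℝ] ℝ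
  smooth : ∀ V W : ∀ x : S, TangentSpace (𝓡 n) x, IsSmoothVF V → IsSmoothVF W →
    ContMDiff (𝓡 n) 𝓘(ℝ, ℝ) ∞ (fun x => form x (V x) (W x))
  alt : ∀ x v, form x v v = 0
  nondegenerate : ∀ x v, (∀ w, form x v w = 0) → v = 0
  closed : ∀ U V W : ∀ x : S, TangentSpace (𝓡 n) x,
    IsSmoothVF U → IsSmoothVF V → IsSmoothVF W → ∀ x,
      (differential (fun y => form y (V y) (W y)) x (U x)
        + differential (fun y => form y (W y) (U y)) x (V x)
        + differential (fun y => form y (U y) (V y)) x (W x))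
      - (form x (VectorField.mlieBracket (𝓡 n) U V x) (W x)
        + form x (VectorField.mlieBracket (𝓡 n) V W x) (U x)
        + form x (VectorField.mlieBracket (𝓡 n) W U x) (V x)) = 0
  leftInvariant : ∀ (g x : S) (v w : TangentSpace (𝓡 n) x),
    form (g * x) (mfderiv (𝓡 n) (𝓡 n) (fun y : S => g * y) x v)
      (mfderiv (𝓡 n) (𝓡 n) (fun y : S => g * y) x w) = form x v w

variable {n S}

/-- The musical isomorphism `v ↦ ωS_x(v, ·)`. -/
def InvariantSymplecticForm.flat (ωS : InvariantSymplecticForm n S) (x : S) :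
    TangentSpace (𝓡 n) x ≃ₗ[ℝ] (TangentSpace (𝓡 n) x →ₗ[ℝ] ℝ) :=
  haveI : FiniteDimensional ℝ (TangentSpace (𝓡 n) x) :=
    inferInstanceAs (FiniteDimensional ℝ (EuclideanSpace ℝ (Fin n)))
  LinearEquiv.ofInjectiveOfFinrankEq (ωS.form x)
    ((injective_iff_map_eq_zero (ωS.form x)).2 fun v hv =>
      ωS.nondegenerate x v fun w => by rw [hv]; rfl)
    (Subspace.dual_finrank_eq (K := ℝ) (V := TangentSpace (𝓡 n) x)).symm

variable {𝕜 : Type*} [RCLike 𝕜]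

/-- The Poisson bracket of `ωS`, extended `𝕜`-bilinearly: `{u, v} = dv(Ξ_u)`, where, for a real
function `u`, the vector field `Ξ_u` is defined by `ωS(Ξ_u, ·) = du`. -/
def InvariantSymplecticForm.poisson (ωS : InvariantSymplecticForm n S) (u v : S → 𝕜) (x : S) : 𝕜 :=
  differential v x ((ωS.flat x).symm ((RCLike.reCLM : 𝕜 →L[ℝ] ℝ).toLinearMap ∘ₗ differential u x)) +
    RCLike.I * differential v x
      ((ωS.flat x).symm ((RCLike.imCLM : 𝕜 →L[ℝ] ℝ).toLinearMap ∘ₗ differential u x))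

/-- The Drinfel'd twist `F` is based on `(𝔰, Ω)`, where `Ω` is the value at the unit of `ωS`: its
left-invariant Poisson structure `{u, v}^F = F₁(u, v) - F₁(v, u)` is the Poisson bracket of `ωS`. -/
structure IsTwistBasedOn (ωS : InvariantSymplecticForm n S)
    (F : (EnvAlg 𝕜 (GroupLieAlgebra (𝓡 n) S) ⊗[𝕜] EnvAlg 𝕜 (GroupLieAlgebra (𝓡 n) S))⟦X⟧) :
    Prop where
  isTwist : IsTwist F
  poisson_eq : ∀ (u v : SmoothFn 𝕜 n S) (x : S),
    (twistCochains F 1 u v : S → 𝕜) x - (twistCochains F 1 v u : S → 𝕜) x = ωS.poisson u v x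

end Symplectic

end DrinfeldTwist
end

open DrinfeldTwist

open scoped Manifold ContDiff TensorProduct PowerSeries
attribute [local instance 100] LieRing.ofAssociativeRing
noncomputable section
-- Finite-dimensionality of the symmetry algebra is a rigidity statement: a symmetry is determined
-- by its one-jet at the unit. Preserving the Poisson bracket alone is far from enough, since
-- Hamiltonian vector fields form an infinite-dimensional algebra; naturality supplies the missing
-- structure. Associativity at order `ν²`, with `C₂` of order two, forces `C₁` to have order one, so
-- that after normalization `C₁` is a biderivation `Λ` whose skew-symmetrization is the symplectic
-- Poisson bracket. The second order symbol `K(f, f')` of `C₂` in its first argument is then, in the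
-- other argument, a second order operator with the same leading part as `Λ_f ∘ Λ_f'`. A symmetry
-- preserves both `Λ` and `K`, much as an affine symplectic map preserves the form and a connection.
-- If its one-jet at the unit vanishes, its two-jet there is a tensor, and the two invariances kill
-- it (`ev_leibniz_leibniz_eq_zero`).
--
-- Consequently the first derivatives, at the unit, of the one-jet of a symmetry are linear
-- functions of this one-jet. Symmetries are stable under conjugation by left translations, so in
-- the left-invariant frame the same constants work at every point: the one-jets solve a closed
-- linear first order system with constant coefficients (`exists_leftFrame_jetFn_eq`). On a
-- connected manifold a solution of such a system that vanishes at one point vanishes everywhere, by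
-- Gronwall along segments in charts (`eq_zero_of_frame_system`). The one-jet at the unit is
-- therefore an injective linear map into a finite-dimensional space.
--
-- For the second assertion, the homomorphism condition is not linear, but its restriction to
-- brackets with `X^⋆` is: it says that the map is `𝔰`-equivariant. The span thus lies in the
-- `ℝ⟦X⟧`-module `equivariantMaps`. If the coefficients of an equivariant map vanish below `νᵏ`, its
-- `k`-th coefficient takes values in derivations of the pointwise product
-- (`isLeibniz_coeff_of_mem_Der`). The fields `X^⋆` commute with the left-invariant frame, so the
-- frame components of the images of a basis solve a linear system along the `X^⋆`, and are again
-- determined by their values at the unit (`equivariant_eq_zero`). Induction on `k` embeds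
-- `equivariantMaps` into a finite free module over the Noetherian ring `ℝ⟦X⟧`, whence finite
-- generation.
namespace DrinfeldTwist

/-! ### Derivations at a point of a commutative algebra, and the vanishing of two-jets -/

section DerivationAlgebra

variable {𝕜 : Type*} [Field 𝕜] {A : Type*} [CommRing A] [Algebra 𝕜 A]

/-- The Leibniz rule for a linear operator on a commutative algebra. -/
def IsLeibniz (D : Module.End 𝕜 A) : Prop := ∀ f g, D (f * g) = f * D g + g * D f

theorem IsLeibniz.map_one {D : Module.End 𝕜 A} (hD : IsLeibniz D) : D 1 = 0 := by
  have := hD 1 1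
  simpa using this

theorem IsLeibniz.add {D E : Module.End 𝕜 A} (hD : IsLeibniz D) (hE : IsLeibniz E) :
    IsLeibniz (D + E) := fun f g => by
  simp only [LinearMap.add_apply, hD f g, hE f g]; ring

theorem IsLeibniz.sub {D E : Module.End 𝕜 A} (hD : IsLeibniz D) (hE : IsLeibniz E) :
    IsLeibniz (D - E) := fun f g => by
  simp only [LinearMap.sub_apply, hD f g, hE f g]; ring

variable (ev : A →ₐ[𝕜] 𝕜)

/-- The ideal of the elements at which a character vanishes. -/
abbrev pointIdeal : Ideal A := RingHom.ker ev

variable {ev}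

theorem mem_pointIdeal {f : A} : f ∈ pointIdeal ev ↔ ev f = 0 := RingHom.mem_ker

theorem IsLeibniz.mem_pow {D : Module.End 𝕜 A} (hD : IsLeibniz D) :
    ∀ {k : ℕ} {h : A}, h ∈ pointIdeal ev ^ (k + 1) → D h ∈ pointIdeal ev ^ k := by
  intro k
  induction k with
  | zero => intro h _; simp
  | succ k ih =>
    intro h hh
    rw [pow_succ] at hh
    induction hh using Submodule.mul_induction_on' with
    | mem_mul_mem f hf g hg =>
      rw [hD]
      refine add_mem ?_ (by rw [pow_succ']; exact Ideal.mul_mem_mul hg (ih hf))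
      exact Ideal.mul_mem_right _ _ hf
    | add f _ g _ hf hg => rw [map_add]; exact add_mem hf hg

theorem IsLeibniz.ev_sq {D : Module.End 𝕜 A} (hD : IsLeibniz D) {h : A}
    (hh : h ∈ pointIdeal ev ^ 2) : ev (D h) = 0 := by
  have := hD.mem_pow (k := 1) hh
  rwa [pow_one, mem_pointIdeal] at this

theorem sq_induction {p : A → Prop} {h : A} (hh : h ∈ pointIdeal ev ^ 2)
    (mul : ∀ f g, ev f = 0 → ev g = 0 → p (f * g)) (add : ∀ f g, p f → p g → p (f + g)) : p h := by
  rw [pow_two] at hh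
  induction hh using Submodule.mul_induction_on' with
  | mem_mul_mem f hf g hg => exact mul f g (mem_pointIdeal.1 hf) (mem_pointIdeal.1 hg)
  | add f _ g _ hf hg => exact add f g hf hg

theorem ev_leibniz_leibniz_mul {D E : Module.End 𝕜 A} (hD : IsLeibniz D) (hE : IsLeibniz E)
    {f g : A} (hf : ev f = 0) (hg : ev g = 0) :
    ev (D (E (f * g))) = ev (D f) * ev (E g) + ev (D g) * ev (E f) := by
  rw [hE, map_add, hD, hD]
  simp only [map_add, map_mul, hf, hg]
  ring

/-- On a product of two elements vanishing at the point, `D ∘ E` only sees first derivatives of the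
factors. Hence on the square of the ideal it depends only on the values of `D` and `E` at the point,
and is symmetric in them. -/
theorem ev_leibniz_congr {D E D' E' : Module.End 𝕜 A} (hD : IsLeibniz D) (hE : IsLeibniz E)
    (hD' : IsLeibniz D') (hE' : IsLeibniz E') (h1 : ∀ g, ev (D g) = ev (D' g))
    (h2 : ∀ g, ev (E g) = ev (E' g)) {h : A} (hh : h ∈ pointIdeal ev ^ 2) :
    ev (D (E h)) = ev (D' (E' h)) := by
  refine sq_induction (p := fun h => ev (D (E h)) = ev (D' (E' h))) hh
    (fun f g hf hg => ?_) fun f g hf hg => ?_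
  · rw [ev_leibniz_leibniz_mul hD hE hf hg, ev_leibniz_leibniz_mul hD' hE' hf hg]
    simp only [h1, h2]
  · simp only [map_add, hf, hg]

theorem ev_leibniz_comm {D E : Module.End 𝕜 A} (hD : IsLeibniz D) (hE : IsLeibniz E)
    {h : A} (hh : h ∈ pointIdeal ev ^ 2) : ev (D (E h)) = ev (E (D h)) := by
  refine sq_induction (p := fun h => ev (D (E h)) = ev (E (D h))) hh
    (fun f g hf hg => ?_) fun f g hf hg => ?_
  · rw [ev_leibniz_leibniz_mul hD hE hf hg, ev_leibniz_leibniz_mul hE hD hf hg]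
    ring
  · simp only [map_add, hf, hg]

/-- A derivation that preserves a biderivation `Λ` with nondegenerate skew-symmetrization at a
point, and a cochain `K` with second order symbol `Λ²`, and whose one-jet at the point vanishes,
has vanishing two-jet. -/
theorem ev_leibniz_leibniz_eq_zero [CharZero 𝕜] {Λ : A →ₗ[𝕜] A →ₗ[𝕜] A} {V : Module.End 𝕜 A}
    {K : A → A → A →ₗ[𝕜] A}
    (hΛ : ∀ u, IsLeibniz (Λ u)) (hΛ' : ∀ u, IsLeibniz (Λ.flip u))
    (hnd : ∀ X : Module.End 𝕜 A, IsLeibniz X →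
      ∃ u, ∀ g, ev (X g) = ev (Λ u g - Λ g u))
    (hV : ∀ f, V f ∈ pointIdeal ev ^ 2)
    (hVΛ : ∀ u v, V (Λ u v) = Λ (V u) v + Λ u (V v))
    (hVK : ∀ f f' v, V (K f f' v) = K (V f) f' v + K f (V f') v + K f f' (V v))
    (hK1 : ∀ f g f' v, K (f * g) f' v = f * K g f' v + g * K f f' v)
    (hK1a : ∀ f g f' v, K (f + g) f' v = K f f' v + K g f' v)
    (hK2 : ∀ f f' v, K f f' v = K f' f v)
    (hK : ∀ f f' v w, K f f' (v * w) =
      w * K f f' v + v * K f f' w + Λ f w * Λ f' v + Λ f' w * Λ f v)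
    {X Y : Module.End 𝕜 A} (hX : IsLeibniz X) (hY : IsLeibniz Y) (v : A) :
    ev (X (Y (V v))) = 0 := by
  have two : ∀ a : 𝕜, a = -a → a = 0 := fun a h => self_eq_neg.1 h
  have evV : ∀ {D : Module.End 𝕜 A}, IsLeibniz D → ∀ f, ev (D (V f)) = 0 :=
    fun hD f => hD.ev_sq (hV f)
  -- `P` and `Q` are twice the skew and the symmetric parts of `Λ`; both are invariant under `V`.
  let P : A → Module.End 𝕜 A := fun u => Λ u - Λ.flip u
  let Q : A → Module.End 𝕜 A := fun u => Λ u + Λ.flip u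
  have hP : ∀ u, IsLeibniz (P u) := fun u => (hΛ u).sub (hΛ' u)
  have hQ : ∀ u, IsLeibniz (Q u) := fun u => (hΛ u).add (hΛ' u)
  have hPs : ∀ u v, P u v = -P v u := fun u v => by simp [P]
  have hQs : ∀ u v, Q u v = Q v u := fun u v => by simp [Q, add_comm]
  have hPV : ∀ u v, V (P u v) = P (V u) v + P u (V v) := fun u v => by
    simp only [P, LinearMap.sub_apply, LinearMap.flip_apply, map_sub, hVΛ]; abel
  have hQV : ∀ u v, V (Q u v) = Q (V u) v + Q u (V v) := fun u v => by
    simp only [Q, LinearMap.add_apply, LinearMap.flip_apply, map_add, hVΛ]; abel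
  have nd : ∀ X : Module.End 𝕜 A, IsLeibniz X → ∃ u, ∀ g, ev (X g) = ev (P u g) :=
    fun X hX => hnd X hX
  -- Nondegeneracy of `P` turns `Q` into an endomorphism of differentials at the point: `Q u` agrees
  -- there with `P (s u)`.
  choose s hs using fun u => nd (Q u) (hQ u)
  -- `t` is the two-jet of `V` contracted with Hamiltonian directions. It is symmetric in its first
  -- two slots (`t1`), and in its last two by invariance of `P` (`t2`): the usual symmetric
  -- three-tensors of symplectic geometry.
  let t : A → A → A → 𝕜 := fun u u' v => ev (P u (P u' (V v)))
  have t1 : ∀ u u' v, t u u' v = t u' u v := fun u u' v => ev_leibniz_comm (hP u) (hP u') (hV v)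
  have t2 : ∀ x u w, t x u w = t x w u := fun x u w => by
    have := evV (hP x) (P u w)
    rw [hPV, hPs (V u), map_add, map_add, map_neg, map_neg] at this
    exact (neg_add_eq_zero.1 this).symm
  -- Invariance of `Q`, rewritten through `s`.
  have t3 : ∀ x u w, t x (s u) w = -t x (s w) u := fun x u w => by
    have := evV (hP x) (Q u w)
    rw [hQV, hQs (V u), map_add, map_add,
      ev_leibniz_congr (hP x) (hQ w) (hP x) (hP (s w)) (fun _ => rfl) (hs w) (hV u),
      ev_leibniz_congr (hP x) (hQ u) (hP x) (hP (s u)) (fun _ => rfl) (hs u) (hV w)] at this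
    exact eq_neg_of_add_eq_zero_right this
  -- Moving `s` from one argument to another changes the sign. Taking it through all three arguments
  -- and back costs three signs, so the value is its own opposite.
  have t4 : ∀ x u w, t x u (s w) = 0 := fun x u w => by
    refine two _ ?_
    have a : ∀ x u w, t x u (s w) = -t x w (s u) := fun x u w => by
      rw [t2, t3, t2 x (s u) w]
    calc t x u (s w) = -t w x (s u) := by rw [a, t1]
      _ = t u w (s x) := by rw [a, neg_neg, t1]
      _ = -t x u (s w) := by rw [a, t1]
  -- Evaluate the invariance of `K` at the point. The terms with `V f` or `V f'` vanish, as `K` is a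
  -- derivation in these slots and `V` takes values in the squared ideal; in the remaining term `K f
  -- f'` acts on that ideal as `Λ f ∘ Λ f'`.
  have t5 : ∀ f f' v, ev (Λ f (Λ f' (V v))) = 0 := fun f f' v => by
    have key : ∀ {h : A}, h ∈ pointIdeal ev ^ 2 → ev (K f f' h) = ev (Λ f (Λ f' h)) := by
      intro h hh
      refine sq_induction (p := fun h => ev (K f f' h) = ev (Λ f (Λ f' h))) hh
        (fun g g' hg hg' => ?_) fun g g' hg hg' => ?_
      · rw [ev_leibniz_leibniz_mul (hΛ f) (hΛ f') hg hg', hK]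
        simp only [map_add, map_mul, hg, hg']
        ring
      · simp only [map_add, hg, hg']
    have key2 : ∀ {h : A} f', h ∈ pointIdeal ev ^ 2 → ev (K h f' v) = 0 := by
      intro h f' hh
      refine sq_induction (p := fun h => ev (K h f' v) = 0) hh
        (fun g g' hg hg' => ?_) fun g g' hg hg' => ?_
      · rw [hK1]; simp [hg, hg']
      · rw [hK1a, map_add, hg, hg', add_zero]
    have h0 : ev (V (K f f' v)) = 0 :=
      mem_pointIdeal.1 (Ideal.pow_le_self two_ne_zero (hV _))
    rw [hVK, hK2 f, map_add, map_add, key2 _ (hV f), key2 _ (hV f'), key (hV v), zero_add,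
      zero_add] at h0
    exact h0
  have sum : ∀ u g, ev (((2 : 𝕜) • Λ u) g) = ev ((P u + P (s u)) g) := fun u g => by
    rw [LinearMap.add_apply, map_add, ← hs, ← map_add]
    congr 1
    simp only [P, Q, LinearMap.sub_apply, LinearMap.add_apply, two_smul]
    abel
  have hL2 : ∀ u, IsLeibniz ((2 : 𝕜) • Λ u) := fun u => by
    rw [two_smul]; exact (hΛ u).add (hΛ u)
  -- By `sum`, `2 Λ f` agrees at the point with `P f + P (s f)`. Expanding the product of two such
  -- operators gives `t f f' v` plus terms containing `s`, which vanish by `t4`.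
  have t6 : ∀ f f' v, t f f' v = 0 := fun f f' v => by
    have h := ev_leibniz_congr (hL2 f) (hL2 f') ((hP f).add (hP (s f)))
      ((hP f').add (hP (s f'))) (sum f) (sum f') (hV v)
    simp only [LinearMap.smul_apply, map_smul, t5, smul_zero, LinearMap.add_apply, map_add] at h
    change 0 = t f f' v + t (s f) f' v + (t f (s f') v + t (s f) (s f') v) at h
    rw [t2 f (s f'), t4, t1 (s f) f', t2 f' (s f), t4, t2 (s f) (s f'), t4] at h
    simpa using h.symm
  obtain ⟨u, hu⟩ := nd X hX
  obtain ⟨u', hu'⟩ := nd Y hY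
  rw [ev_leibniz_congr hX hY (hP u) (hP u') hu hu' (hV v)]
  exact t6 u u' v

end DerivationAlgebra

/-! ### Lowering the order of a differential operator through its symbol -/

section OrderReduction

variable {𝕜 : Type*} [Field 𝕜] {A : Type*} [CommRing A] [Algebra 𝕜 A]

/-- The commutator with the multiplication by `f`, as an operator on operators. -/
def adMul (f : A) : Module.End 𝕜 (Module.End 𝕜 A) :=
  LinearMap.mulRight 𝕜 (LinearMap.mulLeft 𝕜 f) - LinearMap.mulLeft 𝕜 (LinearMap.mulLeft 𝕜 f)

theorem adMul_apply (f : A) (D : Module.End 𝕜 A) :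
    adMul f D = D * LinearMap.mulLeft 𝕜 f - LinearMap.mulLeft 𝕜 f * D := rfl

theorem adMul_apply_apply (f : A) (D : Module.End 𝕜 A) (u : A) :
    adMul f D u = D (f * u) - f * D u := rfl

theorem adMul_mul (f : A) (D E : Module.End 𝕜 A) :
    adMul f (D * E) = D * adMul f E + adMul f D * E := by
  simp only [adMul_apply]; noncomm_ring

theorem adMul_add_smul (f g : A) (t : 𝕜) : adMul (𝕜 := 𝕜) (f + t • g) = adMul f + t • adMul g := by
  ext D u
  simp only [LinearMap.add_apply, LinearMap.smul_apply, adMul_apply_apply, add_mul, smul_mul_assoc,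
    map_add, map_smul, smul_sub]
  abel

theorem adMul_comm (f g : A) : Commute (adMul (𝕜 := 𝕜) f) (adMul g) := by
  ext D u
  simp only [Module.End.mul_apply, adMul_apply_apply]
  rw [mul_left_comm f g u]
  ring

theorem adMul_pow_mul (f : A) (D E : Module.End 𝕜 A) (N : ℕ) :
    (adMul f ^ N) (D * E) = ∑ p ∈ Finset.HasAntidiagonal.antidiagonal N,
      N.choose p.1 • ((adMul f ^ p.1) D * (adMul f ^ p.2) E) := by
  induction N with
  | zero => simp
  | succ N ih =>
    rw [Finset.sum_antidiagonal_choose_succ_nsmul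
      (fun i j => (adMul f ^ i) D * (adMul f ^ j) E), pow_succ', Module.End.mul_apply, ih, map_sum,
      ← Finset.sum_add_distrib]
    refine Finset.sum_congr rfl fun p hp => ?_
    have h : N.choose p.2 = N.choose p.1 := by
      rw [Finset.HasAntidiagonal.mem_antidiagonal] at hp
      exact Nat.choose_symm_of_eq_add (by omega)
    rw [map_nsmul, adMul_mul, nsmul_add, h, pow_succ', pow_succ', Module.End.mul_apply,
      Module.End.mul_apply]

theorem IsDiffOpOfOrder.adMul_pow {k j : ℕ} {D : Module.End 𝕜 A} (h : IsDiffOpOfOrder (k + j) D)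
    (f : A) : IsDiffOpOfOrder k ((adMul f ^ j) D) := by
  induction j generalizing D with
  | zero => simpa using h
  | succ j ih =>
    rw [pow_succ, Module.End.mul_apply]
    exact ih (h f)

theorem IsDiffOpOfOrder.adMul_pow_eq_zero {k j : ℕ} {D : Module.End 𝕜 A}
    (h : IsDiffOpOfOrder k D) (hj : k < j) (f : A) : (adMul f ^ j) D = 0 := by
  obtain ⟨i, rfl⟩ := Nat.exists_eq_add_of_lt hj
  have h1 : IsDiffOpOfOrder 0 ((adMul f ^ k) D) := IsDiffOpOfOrder.adMul_pow (by simpa using h) f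
  have h2 : (adMul f ^ (k + 1)) D = 0 := by
    rw [pow_succ', Module.End.mul_apply]; exact h1 f
  rw [show k + i + 1 = i + (k + 1) by ring, pow_add, Module.End.mul_apply, h2, map_zero]

theorem IsDiffOpOfOrder.apply_eq_mul {D : Module.End 𝕜 A} (h : IsDiffOpOfOrder 0 D) (u : A) :
    D u = u * D 1 := by
  have := LinearMap.congr_fun (h u) 1
  simpa [sub_eq_zero] using this

/-- Linear functionals reduce this to a scalar polynomial that vanishes on an infinite field. -/
theorem eq_zero_of_forall_sum_pow_smul {M : Type*} [AddCommGroup M] [Module 𝕜 M] [Infinite 𝕜]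
    {N : ℕ} {c : ℕ → M} (h : ∀ t : 𝕜, ∑ j ∈ Finset.range N, t ^ j • c j = 0) {j : ℕ} (hj : j < N) :
    c j = 0 := by
  rw [← Module.forall_dual_apply_eq_zero_iff 𝕜]
  intro φ
  have hp : (∑ j ∈ Finset.range N, Polynomial.monomial j (φ (c j)) : Polynomial 𝕜) = 0 := by
    refine Polynomial.funext fun t => ?_
    have := congrArg φ (h t)
    simp only [map_sum, map_smul, smul_eq_mul, map_zero] at this
    simp only [Polynomial.eval_finsetSum, Polynomial.eval_monomial, Polynomial.eval_zero]
    rw [← this]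
    exact Finset.sum_congr rfl fun _ _ => mul_comm _ _
  have := congrArg (fun p => Polynomial.coeff p j) hp
  simpa [Polynomial.finsetSum_coeff, Polynomial.coeff_monomial, hj] using this

/-- Polarization: the symbol is a symmetric multilinear form, determined by its diagonal in
characteristic zero. The coefficient of `t` in the power of `adMul (f + t • g)` gives the hypothesis
for the commutator with `g`. -/
theorem IsDiffOpOfOrder.of_adMul_pow_eq_zero [CharZero 𝕜] {k : ℕ} {D : Module.End 𝕜 A}
    (h : IsDiffOpOfOrder (k + 1) D) (h0 : ∀ f, (adMul f ^ (k + 1)) D = 0) :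
    IsDiffOpOfOrder k D := by
  induction k generalizing D with
  | zero => intro f; rw [← adMul_apply]; simpa only [zero_add, pow_one] using h0 f
  | succ k ih =>
    intro g
    refine ih (h g) fun f => ?_
    have key : ∀ t : 𝕜, ∑ j ∈ Finset.range (k + 1 + 1 + 1),
        t ^ j • ((k + 1 + 1).choose j •
          (adMul (𝕜 := 𝕜) g ^ j * adMul f ^ (k + 1 + 1 - j) : Module.End 𝕜 (Module.End 𝕜 A)) D) = 0 := by
      intro t
      rw [← h0 (f + t • g), adMul_add_smul, add_comm (adMul f), Commute.add_pow, LinearMap.sum_apply]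
      · refine Finset.sum_congr rfl fun j _ => ?_
        rw [smul_pow, smul_mul_assoc, smul_mul_assoc, LinearMap.smul_apply, ← nsmul_eq_mul',
          LinearMap.smul_apply]
      · exact (adMul_comm g f).smul_left t
    have := eq_zero_of_forall_sum_pow_smul key (j := 1) (by omega)
    rw [← Nat.cast_smul_eq_nsmul 𝕜, smul_eq_zero] at this
    have h2 := this.resolve_left (Nat.cast_ne_zero.2 (by simp))
    rw [pow_one, ((adMul_comm g f).pow_right _).eq] at h2
    exact h2

/-- The symbol of `D * D` is the square of the symbol of `D`. In `adMul f ^ (2k + 2)` applied to `D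
* D`, only the middle binomial term survives; it is a multiple of the square of a multiplication
operator, and a reduced algebra has no nonzero element of square zero. -/
theorem IsDiffOpOfOrder.of_sq [CharZero 𝕜] [IsReduced A] {k : ℕ} {D : Module.End 𝕜 A}
    (h : IsDiffOpOfOrder (k + 1) D) (h2 : IsDiffOpOfOrder (2 * k + 1) (D * D)) :
    IsDiffOpOfOrder k D := by
  refine h.of_adMul_pow_eq_zero fun f => ?_
  set E := (adMul f ^ (k + 1)) D with hE
  have hE0 : IsDiffOpOfOrder 0 E := IsDiffOpOfOrder.adMul_pow (by simpa using h) f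
  have h3 := h2.adMul_pow_eq_zero (j := (k + 1) + (k + 1)) (by omega) f
  rw [adMul_pow_mul, Finset.sum_eq_single (k + 1, k + 1)] at h3
  · rw [← hE, ← Nat.cast_smul_eq_nsmul 𝕜, smul_eq_zero] at h3
    have h4 := h3.resolve_left (Nat.cast_ne_zero.2 (Nat.choose_pos (by omega)).ne')
    have h5 := LinearMap.congr_fun h4 1
    rw [Module.End.mul_apply, hE0.apply_eq_mul (E 1)] at h5
    have h6 : E 1 = 0 := by
      rw [← pow_eq_zero_iff two_ne_zero, pow_two]; exact h5
    ext u
    rw [hE0.apply_eq_mul, h6, mul_zero, LinearMap.zero_apply]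
  · rintro ⟨i, j⟩ hij hne
    rw [Finset.HasAntidiagonal.mem_antidiagonal] at hij
    simp only [ne_eq, Prod.mk.injEq, not_and] at hne hij
    rcases lt_trichotomy i (k + 1) with hi | hi | hi
    · rw [h.adMul_pow_eq_zero (j := j) (by omega), mul_zero, smul_zero]
    · exact absurd (by omega) (hne hi)
    · rw [h.adMul_pow_eq_zero (j := i) (by omega), zero_mul, smul_zero]
  · intro hn
    exact absurd (by simp) hn

theorem IsDiffOpOfOrder.neg {k : ℕ} {D : Module.End 𝕜 A} (h : IsDiffOpOfOrder k D) :
    IsDiffOpOfOrder k (-D) := by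
  induction k generalizing D with
  | zero =>
    intro a
    have := h a
    rw [← neg_eq_zero] at this
    rw [← this]; noncomm_ring
  | succ k ih =>
    intro a
    have := ih (h a)
    convert this using 1
    noncomm_ring

theorem isDiffOpOfOrder_mulLeft (a : A) : IsDiffOpOfOrder 0 (LinearMap.mulLeft 𝕜 a) := by
  intro b
  ext u
  simp [mul_left_comm]

end OrderReduction

/-! ### Symbols of the first two cochains of a natural associative product -/

section NaturalProduct

variable {𝕜 : Type*} [Field 𝕜] {A : Type*} [CommRing A] [Algebra 𝕜 A]
  {C₁ C₂ : A →ₗ[𝕜] A →ₗ[𝕜] A}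

/-- If the second cochain of an associative product has order at most two, then the
first one has order at most one. -/
theorem isDiffOpOfOrder_one_of_natural [CharZero 𝕜] [IsReduced A]
    (h2 : ∀ u v w, C₂ (u * v) w + C₁ (C₁ u v) w + C₂ u v * w =
      C₂ u (v * w) + C₁ u (C₁ v w) + u * C₂ v w)
    (hN : ∀ v, IsDiffOpOfOrder 2 (C₂.flip v)) {M : ℕ}
    (hM : ∀ v, IsDiffOpOfOrder M (C₁.flip v)) (v : A) : IsDiffOpOfOrder 1 (C₁.flip v) := by
  induction M generalizing v with
  | zero => exact (hM v).mono zero_le_one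
  | succ M ih =>
    rcases Nat.eq_zero_or_pos M with rfl | hpos
    · exact hM v
    refine ih (fun v => (hM v).of_sq ?_) v
    -- Associativity at order two on `(u, v, v)`, read as an identity of operators in `u`. The right
    -- side has order at most `max (M + 1) 2`, which is at most `2 * M + 1` for `M ≥ 1`, so `of_sq`
    -- lowers the order from `M + 1` to `M`.
    have e : C₁.flip v * C₁.flip v = (C₁.flip (C₁ v v) + LinearMap.mulLeft 𝕜 (C₂ v v)) +
        (C₂.flip (v * v) + -(LinearMap.mulLeft 𝕜 v * C₂.flip v + C₂.flip v *
          LinearMap.mulLeft 𝕜 v)) := by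
      ext u
      simp only [Module.End.mul_apply, LinearMap.flip_apply, LinearMap.add_apply,
        LinearMap.mulLeft_apply, LinearMap.neg_apply]
      have := h2 u v v
      rw [mul_comm v u]
      linear_combination this
    rw [e]
    refine (((hM _).mono (by omega)).add ((isDiffOpOfOrder_mulLeft _).mono (by omega))).add
      (((hN _).mono (by omega)).add (IsDiffOpOfOrder.neg ?_))
    exact ((IsDiffOpOfOrder.mul (m := 2) (by simp) (isDiffOpOfOrder_mulLeft v) (hN v)).add
      (IsDiffOpOfOrder.mul (m := 2) (by simp) (hN v) (isDiffOpOfOrder_mulLeft v))).mono (by omega)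

/-- The normalization `C₁(u, w) - u C₁(1, w)` of a bilinear map. -/
def normalized (C₁ : A →ₗ[𝕜] A →ₗ[𝕜] A) : A →ₗ[𝕜] A →ₗ[𝕜] A :=
  C₁ - (LinearMap.mul 𝕜 A).compl₁₂ LinearMap.id (C₁ 1)

theorem normalized_apply (u w : A) : normalized C₁ u w = C₁ u w - u * C₁ 1 w := rfl

/-- The symbol of second order of `C₂` in the first argument. -/
def secondSymbol (C₂ : A →ₗ[𝕜] A →ₗ[𝕜] A) (f f' : A) : A →ₗ[𝕜] A :=
  C₂ (f * f') - LinearMap.mulLeft 𝕜 f ∘ₗ C₂ f' - LinearMap.mulLeft 𝕜 f' ∘ₗ C₂ f +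
    LinearMap.mulLeft 𝕜 (f * f') ∘ₗ C₂ 1

theorem secondSymbol_apply (f f' v : A) : secondSymbol C₂ f f' v =
    C₂ (f * f') v - f * C₂ f' v - f' * C₂ f v + f * f' * C₂ 1 v := rfl

theorem secondSymbol_comm (f f' v : A) : secondSymbol C₂ f f' v = secondSymbol C₂ f' f v := by
  simp only [secondSymbol_apply, mul_comm f' f]; ring

theorem secondSymbol_add_left (f g f' v : A) :
    secondSymbol C₂ (f + g) f' v = secondSymbol C₂ f f' v + secondSymbol C₂ g f' v := by
  simp only [secondSymbol_apply, add_mul, map_add, LinearMap.add_apply]; ring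

theorem normalized_isLeibniz_flip (h : ∀ v, IsDiffOpOfOrder 1 (C₁.flip v)) (w : A) :
    IsLeibniz ((normalized C₁).flip w) := by
  intro f g
  have := (h w f).apply_eq_mul g
  change C₁ (f * g) w - f * C₁ g w = g * (C₁ (f * 1) w - f * C₁ 1 w) at this
  simp only [LinearMap.flip_apply, normalized_apply]
  rw [mul_one] at this
  linear_combination this

/-- The Hochschild cocycle identity carries the Leibniz rule from the first argument to the second.
Its instances at `(1, 1, ·)` give `C₁(1, w) = w C₁(1, 1)`, which accounts for the normalization. -/
theorem normalized_isLeibniz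
    (h1 : ∀ u v w, C₁ (u * v) w + C₁ u v * w = C₁ u (v * w) + u * C₁ v w)
    (h : ∀ v, IsDiffOpOfOrder 1 (C₁.flip v)) (u : A) : IsLeibniz (normalized C₁ u) := by
  intro v w
  have a := normalized_isLeibniz_flip h w u v
  have b := h1 u v w
  have d := h1 1 1 v
  have e := h1 1 1 (v * w)
  simp only [one_mul, LinearMap.flip_apply, normalized_apply] at a d e ⊢
  linear_combination a - b + u * e - u * w * d

/-- This is the vanishing of the triple commutator of an operator of order two, applied to `1`. -/
theorem secondSymbol_mul_left (hN : ∀ v, IsDiffOpOfOrder 2 (C₂.flip v)) (f g f' v : A) :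
    secondSymbol C₂ (f * g) f' v = f * secondSymbol C₂ g f' v + g * secondSymbol C₂ f f' v := by
  have h := LinearMap.congr_fun (hN v f g f') 1
  simp only [LinearMap.sub_apply, Module.End.mul_apply, LinearMap.mulLeft_apply,
    LinearMap.flip_apply, mul_one, LinearMap.zero_apply] at h
  simp only [secondSymbol_apply]
  rw [show f * (g * f') = f * g * f' by ring] at h
  linear_combination h

/-- Take the second order symbol in `u` of the associativity identity. The term `C₁(u, C₁(v, w))`
has order one in `u` and drops out, while `C₁(C₁(u, v), w)` is a composition of two first order
operators and leaves the products of `Λ`. -/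
theorem secondSymbol_mul_right
    (h2 : ∀ u v w, C₂ (u * v) w + C₁ (C₁ u v) w + C₂ u v * w =
      C₂ u (v * w) + C₁ u (C₁ v w) + u * C₂ v w)
    (hN : ∀ v, IsDiffOpOfOrder 2 (C₂.flip v)) (h : ∀ v, IsDiffOpOfOrder 1 (C₁.flip v))
    (f f' v w : A) :
    secondSymbol C₂ f f' (v * w) = w * secondSymbol C₂ f f' v + v * secondSymbol C₂ f f' w +
      normalized C₁ f w * normalized C₁ f' v + normalized C₁ f' w * normalized C₁ f v := by
  have hR : ∀ a b w, C₁ (a * b) w = a * C₁ b w + b * C₁ a w - a * b * C₁ 1 w := fun a b w => by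
    have := normalized_isLeibniz_flip h w a b
    simp only [LinearMap.flip_apply, normalized_apply] at this
    linear_combination this
  have hv := LinearMap.congr_fun (hN w f f' v) 1
  simp only [LinearMap.sub_apply, Module.End.mul_apply, LinearMap.mulLeft_apply,
    LinearMap.flip_apply, mul_one, LinearMap.zero_apply] at hv
  have e1 := h2 (f * f') v w
  have e2 := h2 f v w
  have e3 := h2 f' v w
  have e4 := h2 1 v w
  rw [hR f f' v, hR f f' (C₁ v w)] at e1
  simp only [map_add, map_sub, LinearMap.add_apply, LinearMap.sub_apply, hR f, hR f',
    hR (f * f')] at e1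
  simp only [secondSymbol_apply, normalized_apply]
  rw [one_mul] at e4
  rw [show f * (f' * v) = f * f' * v by ring] at hv
  linear_combination hv - e1 + f * e3 + f' * e2 - f * f' * e4

end NaturalProduct

/-! ### Induction on the enveloping algebra -/

section EnvelopingInduction

variable {𝕜 : Type*} [RCLike 𝕜] {𝔰 : Type*} [LieRing 𝔰] [LieAlgebra ℝ 𝔰]

/-- By the universal property, `ι` corestricted to the subalgebra it generates extends to the whole
algebra; followed by the inclusion, this extension is the identity. -/
theorem universalEnvelopingAlgebra_adjoin_range :
    Algebra.adjoin ℝ (Set.range (UniversalEnvelopingAlgebra.ι ℝ (L := 𝔰))) = ⊤ := by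
  set Q := Algebra.adjoin ℝ (Set.range (UniversalEnvelopingAlgebra.ι ℝ (L := 𝔰)))
  let j : 𝔰 →ₗ⁅ℝ⁆ Q :=
    { toFun := fun X => ⟨UniversalEnvelopingAlgebra.ι ℝ X, Algebra.subset_adjoin ⟨X, rfl⟩⟩
      map_add' := fun X Y => Subtype.ext (map_add _ _ _)
      map_smul' := fun c X => Subtype.ext (map_smul _ _ _)
      map_lie' := fun {X Y} => Subtype.ext (LieHom.map_lie _ _ _) }
  have h : Q.val.comp (UniversalEnvelopingAlgebra.lift ℝ j) = AlgHom.id ℝ _ := by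
    apply UniversalEnvelopingAlgebra.hom_ext
    ext X
    simp [j]
  rw [eq_top_iff]
  intro a _
  have := AlgHom.congr_fun h a
  rw [AlgHom.id_apply] at this
  rw [← this]
  exact (UniversalEnvelopingAlgebra.lift ℝ j a).2

theorem envAlg_induction {p : EnvAlg 𝕜 𝔰 → Prop} (algebraMap : ∀ c : 𝕜, p (algebraMap 𝕜 _ c))
    (ι : ∀ X : 𝔰, p ((1 : 𝕜) ⊗ₜ[ℝ] UniversalEnvelopingAlgebra.ι ℝ X))
    (add : ∀ a b, p a → p b → p (a + b)) (mul : ∀ a b, p a → p b → p (a * b))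
    (a : EnvAlg 𝕜 𝔰) : p a := by
  have hu : ∀ u : UniversalEnvelopingAlgebra ℝ 𝔰, p ((1 : 𝕜) ⊗ₜ[ℝ] u) := by
    intro u
    have hu : u ∈ Algebra.adjoin ℝ (Set.range (UniversalEnvelopingAlgebra.ι ℝ (L := 𝔰))) := by
      rw [universalEnvelopingAlgebra_adjoin_range]; trivial
    induction hu using Algebra.adjoin_induction with
    | mem x hx => obtain ⟨X, rfl⟩ := hx; exact ι X
    | algebraMap r =>
      have := algebraMap (r : 𝕜)
      convert this using 1
      rw [Algebra.algebraMap_eq_smul_one, TensorProduct.tmul_smul, TensorProduct.smul_tmul',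
        Algebra.TensorProduct.algebraMap_apply, RCLike.real_smul_eq_coe_mul, mul_one]
      rfl
    | add x y _ _ hx hy => rw [TensorProduct.tmul_add]; exact add _ _ hx hy
    | mul x y _ _ hx hy =>
      have := mul _ _ hx hy
      rwa [Algebra.TensorProduct.tmul_mul_tmul, one_mul] at this
  induction a using TensorProduct.induction_on with
  | zero => simpa using algebraMap 0
  | tmul c u =>
    have := mul _ _ (algebraMap c) (hu u)
    rwa [Algebra.TensorProduct.algebraMap_apply, Algebra.TensorProduct.tmul_mul_tmul, mul_one,
      one_mul] at this
  | add x y hx hy => exact add _ _ hx hy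

theorem comul_ι (X : 𝔰) : comul 𝕜 𝔰 ((1 : 𝕜) ⊗ₜ[ℝ] UniversalEnvelopingAlgebra.ι ℝ X) =
    ((1 : 𝕜) ⊗ₜ[ℝ] UniversalEnvelopingAlgebra.ι ℝ X) ⊗ₜ[𝕜] (1 : EnvAlg 𝕜 𝔰) +
      (1 : EnvAlg 𝕜 𝔰) ⊗ₜ[𝕜] ((1 : 𝕜) ⊗ₜ[ℝ] UniversalEnvelopingAlgebra.ι ℝ X) := by
  refine (Algebra.TensorProduct.lift_tmul _ _ _ _ _).trans ?_
  rw [map_one, one_mul, UniversalEnvelopingAlgebra.lift_ι_apply]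
  rfl

end EnvelopingInduction

/-! ### From the twist cocycle to associativity of the cochains -/

section TwistProduct

variable {𝕜 : Type*} [RCLike 𝕜] {n : ℕ} {S : Type*} [TopologicalSpace S]
  [ChartedSpace (EuclideanSpace ℝ (Fin n)) S] [Group S] [LieGroup (𝓡 n) ∞ S]

theorem leftInvOp_ι (X : GroupLieAlgebra (𝓡 n) S) :
    leftInvOp 𝕜 ((1 : 𝕜) ⊗ₜ[ℝ] UniversalEnvelopingAlgebra.ι ℝ X) = leftAction 𝕜 X := by
  refine (Algebra.TensorProduct.lift_tmul _ _ _ _ _).trans ?_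
  rw [map_one, one_mul, UniversalEnvelopingAlgebra.lift_ι_apply]

theorem vfOp_isLeibniz {V : ∀ x : S, TangentSpace (𝓡 n) x} (hV : IsSmoothVF V) :
    IsLeibniz (vfOp 𝕜 V hV) := by
  intro f g
  ext x
  have hf := ((SmoothFn.contMDiff f).mdifferentiable (by simp) x).hasMFDerivAt
  have hg := ((SmoothFn.contMDiff g).mdifferentiable (by simp) x).hasMFDerivAt
  have h := DFunLike.congr_fun (hf.mul hg).mfderiv (V x)
  exact h

theorem leftAction_isLeibniz (X : GroupLieAlgebra (𝓡 n) S) : IsLeibniz (leftAction 𝕜 X) :=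
  vfOp_isLeibniz (isSmoothVF_mulInvariantVectorField X)

theorem leftInvBidiffOp_tmul (a b : EnvAlg 𝕜 (GroupLieAlgebra (𝓡 n) S))
    (u v : SmoothFn 𝕜 n S) :
    leftInvBidiffOp (a ⊗ₜ[𝕜] b) u v = leftInvOp 𝕜 a u * leftInvOp 𝕜 b v := by
  simp [leftInvBidiffOp]

theorem leftInvBidiffOp_add
    (w w' : EnvAlg 𝕜 (GroupLieAlgebra (𝓡 n) S) ⊗[𝕜] EnvAlg 𝕜 (GroupLieAlgebra (𝓡 n) S)) :
    leftInvBidiffOp (w + w') = leftInvBidiffOp w + leftInvBidiffOp w' := map_add _ _ _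

theorem leftInvBidiffOp_zero :
    leftInvBidiffOp (0 : EnvAlg 𝕜 (GroupLieAlgebra (𝓡 n) S) ⊗[𝕜]
      EnvAlg 𝕜 (GroupLieAlgebra (𝓡 n) S)) = 0 := map_zero _

theorem leftInvBidiffOp_smul (c : 𝕜)
    (w : EnvAlg 𝕜 (GroupLieAlgebra (𝓡 n) S) ⊗[𝕜] EnvAlg 𝕜 (GroupLieAlgebra (𝓡 n) S)) :
    leftInvBidiffOp (c • w) = c • leftInvBidiffOp w := map_smul _ _ _

/-- The coproduct encodes the Leibniz rule: this is clear for primitive elements, and both sides are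
multiplicative in `a`. -/
theorem leftInvOp_leftInvBidiffOp (a : EnvAlg 𝕜 (GroupLieAlgebra (𝓡 n) S))
    (w : EnvAlg 𝕜 (GroupLieAlgebra (𝓡 n) S) ⊗[𝕜] EnvAlg 𝕜 (GroupLieAlgebra (𝓡 n) S))
    (u v : SmoothFn 𝕜 n S) :
    leftInvOp 𝕜 a (leftInvBidiffOp w u v) = leftInvBidiffOp (comul 𝕜 _ a * w) u v := by
  induction a using envAlg_induction generalizing w with
  | algebraMap c =>
    rw [AlgHom.commutes, AlgHom.commutes, Algebra.algebraMap_eq_smul_one,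
      Algebra.algebraMap_eq_smul_one, smul_mul_assoc, one_mul, leftInvBidiffOp_smul]
    rfl
  | ι X =>
    rw [comul_ι, leftInvOp_ι]
    induction w using TensorProduct.induction_on with
    | zero => simp [leftInvBidiffOp_zero]
    | tmul c d =>
      rw [leftInvBidiffOp_tmul, leftAction_isLeibniz, add_mul, Algebra.TensorProduct.tmul_mul_tmul,
        Algebra.TensorProduct.tmul_mul_tmul, leftInvBidiffOp_add, LinearMap.add_apply,
        LinearMap.add_apply, leftInvBidiffOp_tmul, leftInvBidiffOp_tmul, one_mul, one_mul,
        map_mul, map_mul, leftInvOp_ι, Module.End.mul_apply, Module.End.mul_apply]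
      ring
    | add x y hx hy =>
      simp only [mul_add, leftInvBidiffOp_add, LinearMap.add_apply, map_add, hx, hy]
  | add a b ha hb => simp only [map_add, add_mul, leftInvBidiffOp_add, LinearMap.add_apply, ha, hb]
  | mul a b ha hb => rw [map_mul, map_mul, Module.End.mul_apply, hb, ha, mul_assoc]

theorem isDiffOp_leftInvOp (a : EnvAlg 𝕜 (GroupLieAlgebra (𝓡 n) S)) :
    IsDiffOp (leftInvOp 𝕜 a) := by
  induction a using envAlg_induction with
  | algebraMap c =>
    rw [AlgHom.commutes, Algebra.algebraMap_eq_smul_one]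
    refine IsDiffOp.smul c ⟨0, fun a => by simp⟩
  | ι X =>
    rw [leftInvOp_ι]
    refine ⟨1, fun f g => ?_⟩
    ext1 u
    have h := leftAction_isLeibniz (𝕜 := 𝕜) X
    simp only [LinearMap.sub_apply, Module.End.mul_apply, LinearMap.mulLeft_apply, h f, h g,
      LinearMap.zero_apply]
    ring
  | add a b ha hb => rw [map_add]; exact ha.add hb
  | mul a b ha hb => rw [map_mul]; exact ha.mul hb

theorem exists_isDiffOpOfOrder_flip
    (w : EnvAlg 𝕜 (GroupLieAlgebra (𝓡 n) S) ⊗[𝕜] EnvAlg 𝕜 (GroupLieAlgebra (𝓡 n) S)) :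
    ∃ M, ∀ v, IsDiffOpOfOrder M ((leftInvBidiffOp w).flip v) := by
  induction w using TensorProduct.induction_on with
  | zero =>
    refine ⟨0, fun v => ?_⟩
    rw [leftInvBidiffOp_zero]
    exact IsDiffOpOfOrder.zero 0
  | tmul a b =>
    obtain ⟨M, hM⟩ := isDiffOp_leftInvOp (𝕜 := 𝕜) a
    refine ⟨0 + M, fun v => ?_⟩
    have e : (leftInvBidiffOp (a ⊗ₜ[𝕜] b)).flip v =
        LinearMap.mulLeft 𝕜 (leftInvOp 𝕜 b v) * leftInvOp 𝕜 a := by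
      ext1 u
      rw [LinearMap.flip_apply, leftInvBidiffOp_tmul, mul_comm]
      rfl
    rw [e]
    exact IsDiffOpOfOrder.mul le_rfl (isDiffOpOfOrder_mulLeft _) hM
  | add x y hx hy =>
    obtain ⟨M, hM⟩ := hx
    obtain ⟨N, hN⟩ := hy
    refine ⟨max M N, fun v => ?_⟩
    rw [leftInvBidiffOp_add]
    exact ((hM v).mono (le_max_left _ _)).add ((hN v).mono (le_max_right _ _))

/-- The value on three functions of the left-invariant tridifferential operator associated
with an element of `U(𝔰) ⊗ U(𝔰) ⊗ U(𝔰)`. -/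
def tridiffEval (u v w : SmoothFn 𝕜 n S) :
    EnvAlg 𝕜 (GroupLieAlgebra (𝓡 n) S) ⊗[𝕜] (EnvAlg 𝕜 (GroupLieAlgebra (𝓡 n) S) ⊗[𝕜]
      EnvAlg 𝕜 (GroupLieAlgebra (𝓡 n) S)) →ₗ[𝕜] SmoothFn 𝕜 n S :=
  let P := fun u : SmoothFn 𝕜 n S => (LinearMap.applyₗ u) ∘ₗ (leftInvOp 𝕜 (S := S)).toLinearMap
  LinearMap.mul' 𝕜 _ ∘ₗ TensorProduct.map (P u)
    (LinearMap.mul' 𝕜 _ ∘ₗ TensorProduct.map (P v) (P w))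

theorem tridiffEval_tmul (u v w : SmoothFn 𝕜 n S) (a : EnvAlg 𝕜 (GroupLieAlgebra (𝓡 n) S))
    (y : EnvAlg 𝕜 (GroupLieAlgebra (𝓡 n) S) ⊗[𝕜] EnvAlg 𝕜 (GroupLieAlgebra (𝓡 n) S)) :
    tridiffEval u v w (a ⊗ₜ[𝕜] y) = leftInvOp 𝕜 a u * leftInvBidiffOp y v w := by
  induction y using TensorProduct.induction_on with
  | zero => simp [leftInvBidiffOp_zero]
  | tmul c d => rw [leftInvBidiffOp_tmul]; simp [tridiffEval]
  | add x y hx hy =>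
    rw [TensorProduct.tmul_add, map_add, hx, hy, leftInvBidiffOp_add, LinearMap.add_apply,
      LinearMap.add_apply, mul_add]

theorem tridiffEval_assoc (u v w : SmoothFn 𝕜 n S) (b : EnvAlg 𝕜 (GroupLieAlgebra (𝓡 n) S))
    (y : EnvAlg 𝕜 (GroupLieAlgebra (𝓡 n) S) ⊗[𝕜] EnvAlg 𝕜 (GroupLieAlgebra (𝓡 n) S)) :
    tridiffEval u v w (Algebra.TensorProduct.assoc 𝕜 𝕜 𝕜 _ _ _ (y ⊗ₜ[𝕜] b)) =
      leftInvBidiffOp y u v * leftInvOp 𝕜 b w := by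
  induction y using TensorProduct.induction_on with
  | zero => simp [leftInvBidiffOp_zero]
  | tmul c d =>
    rw [Algebra.TensorProduct.assoc_tmul, tridiffEval_tmul, leftInvBidiffOp_tmul,
      leftInvBidiffOp_tmul, mul_assoc]
  | add x y hx hy =>
    rw [TensorProduct.add_tmul, map_add, map_add, hx, hy, leftInvBidiffOp_add,
      LinearMap.add_apply, LinearMap.add_apply, add_mul]

theorem leftInvBidiffOp_comp_left
    (z z' : EnvAlg 𝕜 (GroupLieAlgebra (𝓡 n) S) ⊗[𝕜] EnvAlg 𝕜 (GroupLieAlgebra (𝓡 n) S))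
    (u v w : SmoothFn 𝕜 n S) :
    leftInvBidiffOp z (leftInvBidiffOp z' u v) w =
      tridiffEval u v w (Algebra.TensorProduct.assoc 𝕜 𝕜 𝕜 _ _ _
        (Algebra.TensorProduct.map (comul 𝕜 _) (AlgHom.id 𝕜 _) z) *
        Algebra.TensorProduct.assoc 𝕜 𝕜 𝕜 _ _ _ (z' ⊗ₜ[𝕜] 1)) := by
  rw [← map_mul]
  induction z using TensorProduct.induction_on with
  | zero => simp [leftInvBidiffOp_zero]
  | tmul a b =>
    rw [Algebra.TensorProduct.map_tmul, Algebra.TensorProduct.tmul_mul_tmul, tridiffEval_assoc,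
      leftInvBidiffOp_tmul, leftInvOp_leftInvBidiffOp, mul_one, AlgHom.id_apply]
  | add x y hx hy =>
    simp only [map_add, add_mul, leftInvBidiffOp_add, LinearMap.add_apply, hx, hy]

theorem leftInvBidiffOp_comp_right
    (z z' : EnvAlg 𝕜 (GroupLieAlgebra (𝓡 n) S) ⊗[𝕜] EnvAlg 𝕜 (GroupLieAlgebra (𝓡 n) S))
    (u v w : SmoothFn 𝕜 n S) :
    leftInvBidiffOp z u (leftInvBidiffOp z' v w) =
      tridiffEval u v w (Algebra.TensorProduct.map (AlgHom.id 𝕜 _) (comul 𝕜 _) z *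
        ((1 : EnvAlg 𝕜 (GroupLieAlgebra (𝓡 n) S)) ⊗ₜ[𝕜] z')) := by
  induction z using TensorProduct.induction_on with
  | zero => simp [leftInvBidiffOp_zero]
  | tmul a b =>
    rw [Algebra.TensorProduct.map_tmul, Algebra.TensorProduct.tmul_mul_tmul, tridiffEval_tmul,
      leftInvBidiffOp_tmul, leftInvOp_leftInvBidiffOp, mul_one, AlgHom.id_apply]
  | add x y hx hy =>
    simp only [map_add, add_mul, leftInvBidiffOp_add, LinearMap.add_apply, hx, hy]

variable {F : (EnvAlg 𝕜 (GroupLieAlgebra (𝓡 n) S) ⊗[𝕜] EnvAlg 𝕜 (GroupLieAlgebra (𝓡 n) S))⟦X⟧}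

/-- The `N`-th coefficient of the cocycle relation, evaluated as a tridifferential operator on `(u,
v, w)`. -/
theorem twistCochains_assoc (hF : IsTwist F) (N : ℕ) (u v w : SmoothFn 𝕜 n S) :
    ∑ p ∈ Finset.HasAntidiagonal.antidiagonal N,
      twistCochains F p.1 (twistCochains F p.2 u v) w =
    ∑ p ∈ Finset.HasAntidiagonal.antidiagonal N,
      twistCochains F p.1 u (twistCochains F p.2 v w) := by
  have h := congrArg (fun x => tridiffEval u v w (PowerSeries.coeff N x)) hF.cocycle
  simp only [PowerSeries.coeff_mul, PowerSeries.coeff_map, map_sum] at h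
  simp only [twistCochains, leftInvBidiffOp_comp_left, leftInvBidiffOp_comp_right]
  exact h

theorem twistCochains_zero (hF : IsTwist F) (u v : SmoothFn 𝕜 n S) :
    twistCochains F 0 u v = u * v := by
  rw [twistCochains, hF.coeff_zero, Algebra.TensorProduct.one_def, leftInvBidiffOp_tmul, map_one]
  rfl

theorem twistCochains_one_cocycle (hF : IsTwist F) (u v w : SmoothFn 𝕜 n S) :
    twistCochains F 1 (u * v) w + twistCochains F 1 u v * w =
      twistCochains F 1 u (v * w) + u * twistCochains F 1 v w := by
  have h := twistCochains_assoc hF 1 u v w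
  simp [Finset.Nat.sum_antidiagonal_succ, twistCochains_zero hF] at h
  linear_combination h

theorem twistCochains_two_cocycle (hF : IsTwist F) (u v w : SmoothFn 𝕜 n S) :
    twistCochains F 2 (u * v) w + twistCochains F 1 (twistCochains F 1 u v) w +
        twistCochains F 2 u v * w =
      twistCochains F 2 u (v * w) + twistCochains F 1 u (twistCochains F 1 v w) +
        u * twistCochains F 2 v w := by
  have h := twistCochains_assoc hF 2 u v w
  simp [Finset.Nat.sum_antidiagonal_succ, twistCochains_zero hF] at h
  linear_combination h

end TwistProduct

/-! ### Smooth parametric integrals and Hadamard's lemma -/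

section ParametricIntegral

universe u

/-- Induction on `N` by differentiation under the integral sign, with the target generalized because
the derivative takes values in `E →L[ℝ] F`. Having `E : Type` keeps this space in the universe of
`F`. -/
theorem contDiff_parametric_integral {E : Type} [NormedAddCommGroup E] [NormedSpace ℝ E]
    [FiniteDimensional ℝ E] (N : ℕ) : ∀ {F : Type u} [NormedAddCommGroup F] [NormedSpace ℝ F]
    [CompleteSpace F] {f : ℝ × E → F}, ContDiff ℝ ∞ f →
      ContDiff ℝ N (fun y => ∫ t in (0 : ℝ)..1, f (t, y)) := by
  have cont : ∀ {F : Type u} [NormedAddCommGroup F] [NormedSpace ℝ F] (f : ℝ × E → F),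
      Continuous f → Continuous (fun y => ∫ t in (0 : ℝ)..1, f (t, y)) := fun f hf =>
    intervalIntegral.continuous_parametric_intervalIntegral_of_continuous'
      (f := fun y t => f (t, y)) (hf.comp continuous_swap) 0 1
  induction N with
  | zero =>
    intro F _ _ _ f hf
    exact contDiff_zero.2 (cont f hf.continuous)
  | succ N ih =>
    intro F _ _ _ f hf
    let g : ℝ × E → E →L[ℝ] F := fun p =>
      (fderiv ℝ f p).comp (ContinuousLinearMap.inr ℝ ℝ E)
    have hg : ContDiff ℝ ∞ g :=
      (hf.fderiv_right (m := ∞) (by simp)).clm_comp contDiff_const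
    have hfg : ∀ t y, HasFDerivAt (fun z => f (t, z)) (g (t, y)) y := fun t y =>
      ((hf.differentiable (by simp)) (t, y)).hasFDerivAt.comp y (hasFDerivAt_prodMk_right t y)
    refine contDiff_succ_iff_hasFDerivAt.2 ⟨_, ih hg, fun y₀ => ?_⟩
    have hK : IsCompact (Set.Icc (0 : ℝ) 1 ×ˢ Metric.closedBall y₀ 1) :=
      isCompact_Icc.prod (isCompact_closedBall y₀ 1)
    obtain ⟨B, hB⟩ := hK.exists_bound_of_continuousOn hg.continuous.continuousOn
    refine intervalIntegral.hasFDerivAt_integral_of_dominated_of_fderiv_le (𝕜 := ℝ)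
      (F := fun y t => f (t, y)) (F' := fun y t => g (t, y)) (bound := fun _ => B)
      (Metric.closedBall_mem_nhds y₀ one_pos) ?_ ?_ ?_ ?_ ?_ ?_
    · exact Filter.Eventually.of_forall fun y =>
        (hf.continuous.comp (Continuous.prodMk_left y)).aestronglyMeasurable
    · exact (hf.continuous.comp (Continuous.prodMk_left y₀)).intervalIntegrable _ _
    · exact (hg.continuous.comp (Continuous.prodMk_left y₀)).aestronglyMeasurable
    · refine Filter.Eventually.of_forall fun t ht y hy => hB _ ⟨?_, hy⟩
      rw [Set.uIoc_of_le zero_le_one] at ht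
      exact ⟨ht.1.le, ht.2⟩
    · exact intervalIntegrable_const
    · exact Filter.Eventually.of_forall fun t _ y _ => hfg t y

/-- Hadamard's lemma. -/
theorem exists_contDiff_apply_sub {E : Type} [NormedAddCommGroup E] [NormedSpace ℝ E]
    [FiniteDimensional ℝ E] {F : Type u} [NormedAddCommGroup F] [NormedSpace ℝ F]
    [CompleteSpace F] {G : E → F} (hG : ContDiff ℝ ∞ G) (y₀ : E) (h0 : G y₀ = 0) :
    ∃ H : E → E →L[ℝ] F, ContDiff ℝ ∞ H ∧ H y₀ = fderiv ℝ G y₀ ∧ ∀ y, G y = H y (y - y₀) := by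
  have hG' : ContDiff ℝ ∞ (fderiv ℝ G) := hG.fderiv_right (m := ∞) (by simp)
  have hline : ContDiff ℝ ∞ (fun p : ℝ × E => fderiv ℝ G (y₀ + p.1 • (p.2 - y₀))) :=
    hG'.comp (contDiff_const.add (contDiff_fst.smul (contDiff_snd.sub contDiff_const)))
  -- The mean of the derivative over the segment from `y₀` to `y`.
  refine ⟨fun y => ∫ t in (0 : ℝ)..1, fderiv ℝ G (y₀ + t • (y - y₀)), ?_, by simp, fun y => ?_⟩
  · exact contDiff_infty.2 fun N => contDiff_parametric_integral N hline
  · have hd : ∀ t : ℝ, HasDerivAt (fun s : ℝ => G (y₀ + s • (y - y₀)))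
        (fderiv ℝ G (y₀ + t • (y - y₀)) (y - y₀)) t := fun t => by
      have h1 : HasDerivAt (fun s : ℝ => y₀ + s • (y - y₀)) (y - y₀) t := by
        simpa using ((hasDerivAt_id t).smul_const (y - y₀)).const_add y₀
      exact (hG.differentiable (by simp) _).hasFDerivAt.comp_hasDerivAt t h1
    have hc : Continuous fun t : ℝ => fderiv ℝ G (y₀ + t • (y - y₀)) :=
      hline.continuous.comp (Continuous.prodMk_left y)
    have := intervalIntegral.integral_eq_sub_of_hasDerivAt (a := 0) (b := 1) (fun t _ => hd t)
      ((hc.clm_apply continuous_const).intervalIntegrable _ _)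
    rw [ContinuousLinearMap.intervalIntegral_apply (hc.intervalIntegrable _ _), this]
    simp [h0]

end ParametricIntegral

/-! ### Cut-off coordinates and the square of the ideal of a point -/

section Coordinates

variable {𝕜 : Type*} [RCLike 𝕜] {n : ℕ} {S : Type*} [TopologicalSpace S]
  [ChartedSpace (EuclideanSpace ℝ (Fin n)) S]

variable (𝕜 n) in
/-- The evaluation of functions at a point. -/
def evalAt (p : S) : SmoothFn 𝕜 n S →ₐ[𝕜] 𝕜 := (Pi.evalAlgHom 𝕜 (fun _ : S => 𝕜) p).comp
  (SmoothFn 𝕜 n S).val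

theorem evalAt_apply (p : S) (f : SmoothFn 𝕜 n S) : evalAt 𝕜 n p f = (f : S → 𝕜) p := rfl

theorem differential_eq_fderiv {f : S → 𝕜} {c : S} (hf : MDifferentiableAt (𝓡 n) 𝓘(ℝ, 𝕜) f c)
    (v : TangentSpace (𝓡 n) c) : differential f c v =
      fderiv ℝ (f ∘ (extChartAt (𝓡 n) c).symm) (extChartAt (𝓡 n) c c) v := by
  refine (DFunLike.congr_fun hf.mfderiv v).trans ?_
  change fderivWithin ℝ (f ∘ (extChartAt (𝓡 n) c).symm) (Set.range (𝓡 n))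
    (extChartAt (𝓡 n) c c) (v : EuclideanSpace ℝ (Fin n)) = _
  rw [modelWithCornersSelf_coe, Set.range_id, fderivWithin_univ]

variable [IsManifold (𝓡 n) ∞ S]

theorem vfOp_apply (V : ∀ x : S, TangentSpace (𝓡 n) x) (hV : IsSmoothVF V)
    (f : SmoothFn 𝕜 n S) (x : S) :
    (vfOp 𝕜 V hV f : S → 𝕜) x = differential (f : S → 𝕜) x (V x) := rfl

theorem contDiffAt_comp_extChartAt_symm (f : SmoothFn 𝕜 n S) (c : S)
    {y : EuclideanSpace ℝ (Fin n)} (hy : y ∈ (extChartAt (𝓡 n) c).target) :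
    ContDiffAt ℝ ∞ ((f : S → 𝕜) ∘ (extChartAt (𝓡 n) c).symm) y := by
  have h := (contMDiffOn_extChartAt_symm (I := 𝓡 n) (n := ∞) c).contMDiffAt
    ((isOpen_extChartAt_target c).mem_nhds hy)
  exact ((SmoothFn.contMDiff f).contMDiffAt.comp y h).contDiffAt

variable [T2Space S]

variable (𝕜) in
/-- A bump function at `c` as a smooth function. -/
def bumpFn {c : S} (χ : SmoothBumpFunction (𝓡 n) c) : SmoothFn 𝕜 n S :=
  ⟨fun x => (χ x : 𝕜), (RCLike.ofRealCLM (K := 𝕜)).contDiff.contMDiff.comp χ.contMDiff⟩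

/-- A smooth function on the model space, cut off near `c` and pulled back by the chart. -/
def cutoffFn {c : S} (χ : SmoothBumpFunction (𝓡 n) c) {g : EuclideanSpace ℝ (Fin n) → 𝕜}
    (hg : ContDiff ℝ ∞ g) : SmoothFn 𝕜 n S :=
  ⟨fun x => χ x • g (extChartAt (𝓡 n) c x),
    χ.contMDiff_smul (hg.contMDiff.comp_contMDiffOn contMDiffOn_extChartAt)⟩

theorem contDiff_coord (y₀ : EuclideanSpace ℝ (Fin n)) (i : Fin n) :
    ContDiff ℝ ∞ (fun y : EuclideanSpace ℝ (Fin n) => (((y - y₀) i : ℝ) : 𝕜)) :=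
  (RCLike.ofRealCLM (K := 𝕜)).contDiff.comp
    ((EuclideanSpace.proj (𝕜 := ℝ) i).contDiff.comp (contDiff_id.sub contDiff_const))

variable (𝕜) in
/-- Globally defined functions that are coordinates, centered at `c`, near `c`. -/
def coordFn (c : S) (i : Fin n) : SmoothFn 𝕜 n S :=
  cutoffFn (Classical.arbitrary (SmoothBumpFunction (𝓡 n) c)) (contDiff_coord (extChartAt (𝓡 n) c c) i)

theorem coordFn_self (c : S) (i : Fin n) : (coordFn 𝕜 c i : S → 𝕜) c = 0 := by
  simp [coordFn, cutoffFn]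

theorem cutoffFn_comp_symm_eventuallyEq {c : S} (χ : SmoothBumpFunction (𝓡 n) c)
    {g : EuclideanSpace ℝ (Fin n) → 𝕜} (hg : ContDiff ℝ ∞ g) :
    (cutoffFn χ hg : S → 𝕜) ∘ (extChartAt (𝓡 n) c).symm
      =ᶠ[nhds (extChartAt (𝓡 n) c c)] g := by
  have h1 : ∀ᶠ y in nhds (extChartAt (𝓡 n) c c), χ ((extChartAt (𝓡 n) c).symm y) = 1 := by
    have := (continuousAt_extChartAt_symm (I := 𝓡 n) c)
    rw [ContinuousAt, extChartAt_to_inv] at this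
    exact this.eventually χ.eventuallyEq_one
  filter_upwards [h1, extChartAt_target_mem_nhds (I := 𝓡 n) c] with y hy hy'
  simp only [Function.comp_apply, cutoffFn, hy, one_smul, (extChartAt (𝓡 n) c).right_inv hy']

theorem differential_cutoffFn {c : S} (χ : SmoothBumpFunction (𝓡 n) c)
    {g : EuclideanSpace ℝ (Fin n) → 𝕜} (hg : ContDiff ℝ ∞ g) (v : TangentSpace (𝓡 n) c) :
    differential (cutoffFn χ hg : S → 𝕜) c v = fderiv ℝ g (extChartAt (𝓡 n) c c) v := by
  rw [differential_eq_fderiv ((SmoothFn.contMDiff _).mdifferentiable (by simp) c),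
    (cutoffFn_comp_symm_eventuallyEq χ hg).fderiv_eq]

theorem differential_coordFn (c : S) (i : Fin n) (v : EuclideanSpace ℝ (Fin n)) :
    differential (coordFn 𝕜 c i : S → 𝕜) c v = ((v i : ℝ) : 𝕜) := by
  have h : HasFDerivAt (fun y : EuclideanSpace ℝ (Fin n) =>
      (((y - extChartAt (𝓡 n) c c) i : ℝ) : 𝕜))
      ((RCLike.ofRealCLM (K := 𝕜)).comp (EuclideanSpace.proj (𝕜 := ℝ) i)) (extChartAt (𝓡 n) c c) :=
    (RCLike.ofRealCLM (K := 𝕜)).hasFDerivAt.comp _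
      ((EuclideanSpace.proj (𝕜 := ℝ) i).hasFDerivAt.comp _ ((hasFDerivAt_id _).sub_const _))
  refine (differential_cutoffFn _ (contDiff_coord _ i) _).trans ?_
  rw [h.fderiv]
  rfl

/-- A function that vanishes at `c` together with its differential lies in the square of the
maximal ideal of `c`. -/
theorem mem_pointIdeal_sq {c : S} {f : SmoothFn 𝕜 n S} (h0 : (f : S → 𝕜) c = 0)
    (h1 : ∀ v, differential (n := n) (f : S → 𝕜) c v = 0) : f ∈ pointIdeal (evalAt 𝕜 n c) ^ 2 := by
  set y₀ := extChartAt (𝓡 n) c c with hy₀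
  let χ : SmoothBumpFunction (𝓡 n) c := Classical.arbitrary _
  -- The chart expression of `f`, cut off so that it is smooth on the whole model space and
  -- Hadamard's lemma applies globally.
  let G : EuclideanSpace ℝ (Fin n) → 𝕜 := fun y =>
    χ.toContDiffBump y • ((f : S → 𝕜) ∘ (extChartAt (𝓡 n) c).symm) y
  have hG : ContDiff ℝ ∞ G := contDiff_iff_contDiffAt.2 fun y => by
    by_cases hy : y ∈ (extChartAt (𝓡 n) c).target
    · exact χ.toContDiffBump.contDiffAt.smul (contDiffAt_comp_extChartAt_symm f c hy)
    · have hy' : y ∉ tsupport χ.toContDiffBump := by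
        rw [χ.toContDiffBump.tsupport_eq]
        exact fun h => hy (χ.closedBall_subset ⟨h, by simp⟩)
      have : G =ᶠ[nhds y] fun _ => 0 := by
        filter_upwards [(isClosed_tsupport _).isOpen_compl.mem_nhds hy'] with z hz
        simp only [G, image_eq_zero_of_notMem_tsupport hz, zero_smul]
      exact contDiffAt_const.congr_of_eventuallyEq this
  have hG0 : G y₀ = 0 := by simp [G, hy₀, h0]
  have hG1 : fderiv ℝ G y₀ = 0 := by
    have : G =ᶠ[nhds y₀] (f : S → 𝕜) ∘ (extChartAt (𝓡 n) c).symm := by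
      filter_upwards [χ.toContDiffBump.eventuallyEq_one] with y hy
      simp only [G, hy, Pi.one_apply, one_smul]
    rw [this.fderiv_eq]
    ext1 v
    exact (differential_eq_fderiv ((SmoothFn.contMDiff f).mdifferentiable (by simp) c) v).symm.trans
      (h1 v)
  obtain ⟨H, hH, hH0, hGH⟩ := exists_contDiff_apply_sub hG y₀ hG0
  let b := (EuclideanSpace.basisFun (Fin n) ℝ).toBasis
  have hHi : ∀ i, ContDiff ℝ ∞ (fun y => H y (b i)) := fun i => hH.clm_apply contDiff_const
  -- Write `f = χ³ f + (1 - χ)(1 + χ + χ²) f`. One factor `χ` is already in `G`, the other two cut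
  -- off the coordinate and its Hadamard coefficient. Every product displayed has both factors
  -- vanishing at `c`.
  have e : f = ∑ i, cutoffFn χ (contDiff_coord y₀ i) * cutoffFn χ (hHi i) +
      (1 - bumpFn 𝕜 χ) * ((1 + bumpFn 𝕜 χ + bumpFn 𝕜 χ ^ 2) * f) := by
    have e1 : ∑ i, cutoffFn χ (contDiff_coord y₀ i) * cutoffFn χ (hHi i) =
        bumpFn 𝕜 χ ^ 3 * f := by
      ext x
      have e2 : ((∑ i, cutoffFn χ (contDiff_coord y₀ i) * cutoffFn χ (hHi i) :
          SmoothFn 𝕜 n S) : S → 𝕜) x = ∑ i, (χ x • (((extChartAt (𝓡 n) c x - y₀) i : ℝ) : 𝕜)) *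
            (χ x • H (extChartAt (𝓡 n) c x) (b i)) := by
        rw [← evalAt_apply, map_sum]
        rfl
      rw [e2]
      change _ = ((χ x : ℝ) : 𝕜) ^ 3 * (f : S → 𝕜) x
      by_cases hx : x ∈ (chartAt (EuclideanSpace ℝ (Fin n)) c).source
      · have hx' : x ∈ (extChartAt (𝓡 n) c).source := by rwa [extChartAt_source]
        have e3 : H (extChartAt (𝓡 n) c x) (extChartAt (𝓡 n) c x - y₀) =
            ((χ x : ℝ) : 𝕜) * (f : S → 𝕜) x := by
          rw [← hGH, χ.eqOn_source hx, ← RCLike.real_smul_eq_coe_mul]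
          simp only [G, Function.comp_apply, (extChartAt (𝓡 n) c).left_inv hx']
        rw [pow_succ, mul_assoc, ← e3]
        conv_rhs => rw [← b.sum_repr (extChartAt (𝓡 n) c x - y₀)]
        rw [map_sum, Finset.mul_sum]
        refine Finset.sum_congr rfl fun i _ => ?_
        simp only [map_smul, RCLike.real_smul_eq_coe_mul, b, OrthonormalBasis.coe_toBasis_repr_apply,
          EuclideanSpace.basisFun_repr]
        ring
      · have : χ x = 0 := by rw [χ.coe_def, Set.indicator_of_notMem hx]
        simp [this]
    rw [e1]
    ring
  rw [e, pow_two]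
  refine add_mem (sum_mem fun i _ => Ideal.mul_mem_mul ?_ ?_) (Ideal.mul_mem_mul ?_ ?_)
  · rw [mem_pointIdeal, evalAt_apply]
    simp [cutoffFn, hy₀]
  · rw [mem_pointIdeal, evalAt_apply]
    change χ c • H y₀ (b i) = 0
    simp [hH0, hG1]
  · rw [mem_pointIdeal, evalAt_apply]
    change 1 - ((χ c : ℝ) : 𝕜) = 0
    simp
  · rw [mem_pointIdeal, map_mul, evalAt_apply c f, h0, mul_zero]

end Coordinates

/-! ### Left translations and components in the left-invariant frame -/

section Translation

variable {𝕜 : Type*} [RCLike 𝕜] {n : ℕ} {S : Type*} [TopologicalSpace S]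
  [ChartedSpace (EuclideanSpace ℝ (Fin n)) S] [Group S] [LieGroup (𝓡 n) ∞ S]

theorem leftTranslate_apply (g : S) (f : SmoothFn 𝕜 n S) (x : S) :
    (leftTranslate g f : S → 𝕜) x = (f : S → 𝕜) (g * x) := rfl

theorem leftTranslate_leftTranslate (g h : S) (f : SmoothFn 𝕜 n S) :
    leftTranslate g (leftTranslate h f) = leftTranslate (h * g) f := by
  ext x
  simp only [leftTranslate_apply, mul_assoc]

theorem leftTranslate_one (f : SmoothFn 𝕜 n S) : leftTranslate 1 f = f := by
  ext x
  simp only [leftTranslate_apply, one_mul]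

theorem leftTranslate_mul (g : S) (f h : SmoothFn 𝕜 n S) :
    leftTranslate g (f * h) = leftTranslate g f * leftTranslate g h := rfl

variable (𝕜 n) in
/-- The pull-back by a left translation, as a linear operator. -/
def translateOp (g : S) : Op 𝕜 n S where
  toFun := leftTranslate g
  map_add' _ _ := rfl
  map_smul' _ _ := rfl

/-- The conjugation of operators by a left translation. -/
def conjOp (g : S) (D : Op 𝕜 n S) : Op 𝕜 n S := translateOp 𝕜 n g * D * translateOp 𝕜 n g⁻¹

theorem conjOp_apply (g : S) (D : Op 𝕜 n S) (f : SmoothFn 𝕜 n S) :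
    conjOp g D f = leftTranslate g (D (leftTranslate g⁻¹ f)) := rfl

theorem conjOp_leftTranslate (g : S) (D : Op 𝕜 n S) (f : SmoothFn 𝕜 n S) :
    conjOp g D (leftTranslate g f) = leftTranslate g (D f) := by
  rw [conjOp_apply, leftTranslate_leftTranslate, mul_inv_cancel, leftTranslate_one]

theorem IsLeibniz.conjOp {D : Op 𝕜 n S} (hD : IsLeibniz D) (g : S) : IsLeibniz (conjOp g D) :=
  fun f h => by
    simp only [conjOp_apply, leftTranslate_mul, hD (leftTranslate g⁻¹ f)]
    ext x
    simp [leftTranslate_apply]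

theorem leftAction_apply (X : GroupLieAlgebra (𝓡 n) S) (f : SmoothFn 𝕜 n S) (x : S) :
    (leftAction 𝕜 X f : S → 𝕜) x = differential (leftTranslate x f : S → 𝕜) 1 X := by
  have hf : MDifferentiableAt (𝓡 n) 𝓘(ℝ, 𝕜) (f : S → 𝕜) (x * 1) :=
    (SmoothFn.contMDiff f).mdifferentiable (by simp) _
  have hx : MDifferentiableAt (𝓡 n) (𝓡 n) (fun y : S => x * y) 1 :=
    (contMDiff_mul_left (I := 𝓡 n) (n := ∞)).mdifferentiable (by simp) 1
  have h := DFunLike.congr_fun (mfderiv_comp (1 : S) hf hx) X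
  refine Eq.trans ?_ h.symm
  have e : ∀ y : S, y = x → ∀ v : EuclideanSpace ℝ (Fin n),
      (mfderiv (𝓡 n) 𝓘(ℝ, 𝕜) (f : S → 𝕜) x v : 𝕜) = mfderiv (𝓡 n) 𝓘(ℝ, 𝕜) (f : S → 𝕜) y v := by
    rintro _ rfl _; rfl
  exact e _ (mul_one x) _

theorem starOp_apply (X : GroupLieAlgebra (𝓡 n) S) (f : SmoothFn 𝕜 n S) (x : S) :
    (starOp 𝕜 X f : S → 𝕜) x = -differential (fun y : S => (f : S → 𝕜) (y * x)) 1 X := by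
  have hf : MDifferentiableAt (𝓡 n) 𝓘(ℝ, 𝕜) (f : S → 𝕜) (1 * x) :=
    (SmoothFn.contMDiff f).mdifferentiable (by simp) _
  have hx : MDifferentiableAt (𝓡 n) (𝓡 n) (fun y : S => y * x) 1 :=
    (contMDiff_mul_right (I := 𝓡 n) (n := ∞)).mdifferentiable (by simp) 1
  have h := DFunLike.congr_fun (mfderiv_comp (1 : S) hf hx) X
  have e : ∀ y : S, y = x → ∀ v : EuclideanSpace ℝ (Fin n),
      (mfderiv (𝓡 n) 𝓘(ℝ, 𝕜) (f : S → 𝕜) x v : 𝕜) = mfderiv (𝓡 n) 𝓘(ℝ, 𝕜) (f : S → 𝕜) y v := by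
    rintro _ rfl _; rfl
  refine Eq.trans (map_neg (differential (f : S → 𝕜) x) _) (congrArg Neg.neg ?_)
  exact (e _ (one_mul x) _).trans h.symm

theorem leftAction_leftTranslate (X : GroupLieAlgebra (𝓡 n) S) (g : S) (f : SmoothFn 𝕜 n S) :
    leftAction 𝕜 X (leftTranslate g f) = leftTranslate g (leftAction 𝕜 X f) := by
  ext x
  rw [leftTranslate_apply, leftAction_apply, leftAction_apply, leftTranslate_leftTranslate]

theorem leftAction_apply_one (X : GroupLieAlgebra (𝓡 n) S) (f : SmoothFn 𝕜 n S) :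
    (leftAction 𝕜 X f : S → 𝕜) 1 = differential (f : S → 𝕜) 1 X := by
  rw [leftAction_apply, leftTranslate_one]

variable (n S) in
/-- The standard basis of the Lie algebra, in the preferred chart at the unit. -/
def frameVector (a : Fin n) : GroupLieAlgebra (𝓡 n) S :=
  (EuclideanSpace.single a (1 : ℝ) : EuclideanSpace ℝ (Fin n))

variable (𝕜 n S) in
/-- The left-invariant frame. -/
def leftFrame (a : Fin n) : Op 𝕜 n S := leftAction 𝕜 (frameVector n S a)

theorem leftFrame_apply_one (a : Fin n) (f : SmoothFn 𝕜 n S) :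
    (leftFrame 𝕜 n S a f : S → 𝕜) 1 =
      differential (f : S → 𝕜) (1 : S) (EuclideanSpace.single a (1 : ℝ) : EuclideanSpace ℝ (Fin n)) :=
  leftAction_apply_one _ _

theorem leftFrame_isLeibniz (a : Fin n) : IsLeibniz (leftFrame 𝕜 n S a) := leftAction_isLeibniz _

theorem leftFrame_leftTranslate (a : Fin n) (g : S) (f : SmoothFn 𝕜 n S) :
    leftFrame 𝕜 n S a (leftTranslate g f) = leftTranslate g (leftFrame 𝕜 n S a f) :=
  leftAction_leftTranslate _ _ _

theorem differential_one_eq_sum (f : SmoothFn 𝕜 n S) (v : EuclideanSpace ℝ (Fin n)) :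
    differential (f : S → 𝕜) (1 : S) v = ∑ a, v a • (leftFrame 𝕜 n S a f : S → 𝕜) 1 := by
  have hv : v = ∑ a, v a • (EuclideanSpace.single a (1 : ℝ) : EuclideanSpace ℝ (Fin n)) := by
    ext i
    simp [Pi.single_apply]
  let L : EuclideanSpace ℝ (Fin n) →ₗ[ℝ] 𝕜 := differential (f : S → 𝕜) (1 : S)
  calc L v = L (∑ a, v a • (EuclideanSpace.single a (1 : ℝ) : EuclideanSpace ℝ (Fin n))) := by
        rw [← hv]
    _ = _ := by
        rw [map_sum]
        refine Finset.sum_congr rfl fun a _ => ?_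
        rw [map_smul, leftFrame_apply_one]
        rfl

variable [T2Space S]

theorem leftFrame_coordFn (a b : Fin n) :
    (leftFrame 𝕜 n S a (coordFn 𝕜 1 b) : S → 𝕜) 1 = if a = b then 1 else 0 := by
  refine (leftFrame_apply_one a _).trans ?_
  refine (differential_coordFn (1 : S) b _).trans ?_
  simp [eq_comm]

theorem mem_sq_of_leftFrame {f : SmoothFn 𝕜 n S} (h0 : (f : S → 𝕜) 1 = 0)
    (h1 : ∀ a, (leftFrame 𝕜 n S a f : S → 𝕜) 1 = 0) : f ∈ pointIdeal (evalAt 𝕜 n (1 : S)) ^ 2 := by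
  refine mem_pointIdeal_sq h0 fun v => ?_
  rw [show differential (n := n) (f : S → 𝕜) (1 : S) v = _ from differential_one_eq_sum f v]
  simp [h1]

/-- The difference of `f` and its first order Taylor polynomial in the cut-off coordinates lies in
the squared ideal, where derivations vanish at the unit. -/
theorem IsLeibniz.apply_one {D : Op 𝕜 n S} (hD : IsLeibniz D) (f : SmoothFn 𝕜 n S) :
    (D f : S → 𝕜) 1 = ∑ a, (D (coordFn 𝕜 1 a) : S → 𝕜) 1 * (leftFrame 𝕜 n S a f : S → 𝕜) 1 := by
  let r : SmoothFn 𝕜 n S := f - ((f : S → 𝕜) 1 • 1 +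
    ∑ a, (leftFrame 𝕜 n S a f : S → 𝕜) 1 • coordFn 𝕜 1 a)
  have hr : r ∈ pointIdeal (evalAt 𝕜 n (1 : S)) ^ 2 := by
    refine mem_sq_of_leftFrame ?_ fun b => ?_
    · rw [← evalAt_apply]
      simp only [r, map_sub, map_add, map_smul, map_sum]
      simp [evalAt_apply, coordFn_self]
    · rw [← evalAt_apply]
      simp only [r, map_sub, map_add, map_smul, map_sum, (leftFrame_isLeibniz b).map_one]
      simp [evalAt_apply, leftFrame_coordFn]
  have h := hD.ev_sq hr
  simp only [r, map_sub, map_add, map_smul, map_sum, hD.map_one, smul_zero, zero_add,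
    sub_eq_zero] at h
  rw [← evalAt_apply, h]
  exact Finset.sum_congr rfl fun a _ => mul_comm _ _

/-- The components of a derivation in the left-invariant frame. -/
def frameComponent (D : Op 𝕜 n S) (a : Fin n) (p : S) : 𝕜 :=
  (conjOp p D (coordFn 𝕜 1 a) : S → 𝕜) 1

theorem IsLeibniz.apply_eq_sum {D : Op 𝕜 n S} (hD : IsLeibniz D) (f : SmoothFn 𝕜 n S) (p : S) :
    (D f : S → 𝕜) p = ∑ a, frameComponent D a p * (leftFrame 𝕜 n S a f : S → 𝕜) p := by
  have h := (hD.conjOp p).apply_one (leftTranslate p f)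
  simp only [conjOp_leftTranslate, leftFrame_leftTranslate, leftTranslate_apply, mul_one] at h
  exact h

theorem frameComponent_conjOp (D : Op 𝕜 n S) (a : Fin n) (g p : S) :
    frameComponent (conjOp g D) a p = frameComponent D a (g * p) := by
  simp only [frameComponent, conjOp_apply, leftTranslate_leftTranslate, mul_inv_rev]

/-- Near `p`, apply `D` to the coordinates translated to `p` and solve for the components by
Cramer's rule: the matrix of the frame on these coordinates has smooth entries and is the identity
at `p`. -/
theorem contMDiff_frameComponent {D : Op 𝕜 n S} (hD : IsLeibniz D) (a : Fin n) :
    ContMDiff (𝓡 n) 𝓘(ℝ, 𝕜) ∞ (frameComponent D a) := by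
  intro p
  let x : Fin n → SmoothFn 𝕜 n S := fun k => leftTranslate p⁻¹ (coordFn 𝕜 1 k)
  let N : Matrix (Fin n) (Fin n) (SmoothFn 𝕜 n S) := Matrix.of fun k b => leftFrame 𝕜 n S b (x k)
  have key : ∀ q, evalAt 𝕜 n q N.det * frameComponent D a q =
      evalAt 𝕜 n q (N.adjugate.mulVec (fun k => D (x k)) a) := fun q => by
    let M : Matrix (Fin n) (Fin n) 𝕜 := N.map (evalAt 𝕜 n q)
    have h1 : (fun k => evalAt 𝕜 n q (D (x k))) = M.mulVec (fun b => frameComponent D b q) := by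
      ext k
      rw [evalAt_apply, hD.apply_eq_sum]
      exact Finset.sum_congr rfl fun b _ => mul_comm _ _
    have h2 : evalAt 𝕜 n q (N.adjugate.mulVec (fun k => D (x k)) a) =
        M.adjugate.mulVec (fun k => evalAt 𝕜 n q (D (x k))) a := by
      have h3 : N.adjugate.map (evalAt 𝕜 n q) = M.adjugate :=
        (evalAt 𝕜 n q).toRingHom.map_adjugate N
      rw [← h3]
      simp [Matrix.mulVec, dotProduct]
    have h4 : evalAt 𝕜 n q N.det = M.det := (evalAt 𝕜 n q).toRingHom.map_det N
    rw [h2, h1, Matrix.mulVec_mulVec, Matrix.adjugate_mul, h4, Matrix.smul_mulVec,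
      Matrix.one_mulVec]
    rfl
  have hdet : evalAt 𝕜 n p N.det = 1 := by
    have h1 : N.map (evalAt 𝕜 n p) = 1 := by
      ext k b
      simp only [N, Matrix.map_apply, Matrix.of_apply, x, leftFrame_leftTranslate]
      rw [evalAt_apply, leftTranslate_apply, inv_mul_cancel, leftFrame_coordFn, Matrix.one_apply]
      simp only [eq_comm]
    have h2 : evalAt 𝕜 n p N.det = (N.map (evalAt 𝕜 n p)).det :=
      (evalAt 𝕜 n p).toRingHom.map_det N
    rw [h2, h1, Matrix.det_one]
  have hcont : ContinuousAt (N.det : S → 𝕜) p := (SmoothFn.contMDiff N.det).continuous.continuousAt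
  have hne : ∀ᶠ q in nhds p, (N.det : S → 𝕜) q ≠ 0 :=
    hcont.eventually_ne (by rw [← evalAt_apply, hdet]; exact one_ne_zero)
  have hinv : ContMDiffAt (𝓡 n) 𝓘(ℝ, 𝕜) ∞ (fun q => ((N.det : S → 𝕜) q)⁻¹) p :=
    (contDiffAt_inv ℝ (hne.self_of_nhds)).contMDiffAt.comp p (SmoothFn.contMDiff N.det p)
  have hprod : ContMDiffAt (𝓡 n) 𝓘(ℝ, 𝕜) ∞ (fun q => ((N.det : S → 𝕜) q)⁻¹ *
      ((N.adjugate.mulVec (fun k => D (x k)) a : SmoothFn 𝕜 n S) : S → 𝕜) q) p :=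
    (contDiff_mul (𝕜 := ℝ) (𝔸 := 𝕜)).contMDiff.contMDiffAt.comp p
      (hinv.prodMk_space (SmoothFn.contMDiff _ p))
  refine hprod.congr_of_eventuallyEq ?_
  filter_upwards [hne] with q hq
  have := key q
  rw [evalAt_apply, evalAt_apply] at this
  rw [← this, inv_mul_cancel_left₀ hq]

/-- The components of a derivation in the left-invariant frame, as smooth functions. -/
def componentFn {D : Op 𝕜 n S} (hD : IsLeibniz D) (a : Fin n) : SmoothFn 𝕜 n S :=
  ⟨frameComponent D a, contMDiff_frameComponent hD a⟩

theorem IsLeibniz.apply_eq_sum_componentFn {D : Op 𝕜 n S} (hD : IsLeibniz D)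
    (f : SmoothFn 𝕜 n S) : D f = ∑ a, componentFn hD a * leftFrame 𝕜 n S a f := by
  ext p
  rw [hD.apply_eq_sum, ← evalAt_apply, map_sum]
  rfl

theorem frameComponent_one (D : Op 𝕜 n S) (a : Fin n) :
    frameComponent D a 1 = (D (coordFn 𝕜 1 a) : S → 𝕜) 1 := by
  simp only [frameComponent, conjOp_apply, inv_one, leftTranslate_one]

theorem IsLeibniz.eq_zero_of_frameComponent {D : Op 𝕜 n S} (hD : IsLeibniz D)
    (h : ∀ a p, frameComponent D a p = 0) : D = 0 := by
  ext f p
  rw [hD.apply_eq_sum]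
  simp [h]

end Translation

/-! ### Unique continuation for linear systems along a frame -/

section Uniqueness

variable {𝕜 : Type*} [RCLike 𝕜] {n : ℕ} {S : Type*} [TopologicalSpace S]
  [ChartedSpace (EuclideanSpace ℝ (Fin n)) S] [IsManifold (𝓡 n) ∞ S]

theorem differential_eq_fderiv_comp {c q : S} (hq : q ∈ (chartAt (EuclideanSpace ℝ (Fin n)) c).source)
    (f : SmoothFn 𝕜 n S) (V : TangentSpace (𝓡 n) q) :
    differential (f : S → 𝕜) q V =
      fderiv ℝ ((f : S → 𝕜) ∘ (extChartAt (𝓡 n) c).symm) (extChartAt (𝓡 n) c q)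
        (mfderiv (𝓡 n) 𝓘(ℝ, EuclideanSpace ℝ (Fin n)) (extChartAt (𝓡 n) c) q V) := by
  have hq' : q ∈ (extChartAt (𝓡 n) c).source := by rwa [extChartAt_source]
  have h1 : MDifferentiableAt (𝓡 n) 𝓘(ℝ, EuclideanSpace ℝ (Fin n)) (extChartAt (𝓡 n) c) q :=
    (contMDiffAt_extChartAt' (n := ∞) hq).mdifferentiableAt (by simp)
  have h2 : DifferentiableAt ℝ ((f : S → 𝕜) ∘ (extChartAt (𝓡 n) c).symm)
      (extChartAt (𝓡 n) c q) :=
    (contDiffAt_comp_extChartAt_symm f c ((extChartAt (𝓡 n) c).map_source hq')).differentiableAt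
      (by simp)
  have h3 : (f : S → 𝕜) =ᶠ[nhds q]
      ((f : S → 𝕜) ∘ (extChartAt (𝓡 n) c).symm) ∘ (extChartAt (𝓡 n) c) := by
    filter_upwards [extChartAt_source_mem_nhds' hq'] with z hz
    simp only [Function.comp_apply, (extChartAt (𝓡 n) c).left_inv hz]
  have h4 := (h2.mdifferentiableAt.hasMFDerivAt.comp q h1.hasMFDerivAt).congr_of_eventuallyEq h3
  refine (DFunLike.congr_fun h4.mfderiv V).trans ?_
  rw [mfderiv_eq_fderiv]
  rfl

variable [T2Space S]

/-- The cutoff equals `1` on a whole neighbourhood of `c`, so the cut-off coordinates are genuine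
ones at nearby points too, as the estimates along segments require. -/
theorem eventually_fderiv_coordFn (c : S) : ∀ᶠ q in nhds c, ∀ (k : Fin n)
    (w : EuclideanSpace ℝ (Fin n)),
    fderiv ℝ ((coordFn 𝕜 c k : S → 𝕜) ∘ (extChartAt (𝓡 n) c).symm) (extChartAt (𝓡 n) c q) w =
      ((w k : ℝ) : 𝕜) := by
  let χ := Classical.arbitrary (SmoothBumpFunction (𝓡 n) c)
  filter_upwards [(χ.eventuallyEq_one).eventually_nhds, extChartAt_source_mem_nhds (I := 𝓡 n) c]
    with q hq hq' k w
  have h1 : ∀ᶠ y in nhds (extChartAt (𝓡 n) c q), χ ((extChartAt (𝓡 n) c).symm y) = 1 := by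
    have := continuousAt_extChartAt_symm' (I := 𝓡 n) hq'
    rw [ContinuousAt, (extChartAt (𝓡 n) c).left_inv hq'] at this
    exact this.eventually hq
  have h2 : (coordFn 𝕜 c k : S → 𝕜) ∘ (extChartAt (𝓡 n) c).symm =ᶠ[nhds (extChartAt (𝓡 n) c q)]
      fun y => (((y - extChartAt (𝓡 n) c c) k : ℝ) : 𝕜) := by
    filter_upwards [h1, extChartAt_target_mem_nhds' ((extChartAt (𝓡 n) c).map_source hq')]
      with y hy hy'
    change χ ((extChartAt (𝓡 n) c).symm y) • ((((extChartAt (𝓡 n) c)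
      ((extChartAt (𝓡 n) c).symm y) - extChartAt (𝓡 n) c c) k : ℝ) : 𝕜) = _
    rw [hy, one_smul, (extChartAt (𝓡 n) c).right_inv hy']
  have h3 : HasFDerivAt (fun y : EuclideanSpace ℝ (Fin n) =>
      (((y - extChartAt (𝓡 n) c c) k : ℝ) : 𝕜))
      ((RCLike.ofRealCLM (K := 𝕜)).comp (EuclideanSpace.proj (𝕜 := ℝ) k)) (extChartAt (𝓡 n) c q) :=
    (RCLike.ofRealCLM (K := 𝕜)).hasFDerivAt.comp _
      ((EuclideanSpace.proj (𝕜 := ℝ) k).hasFDerivAt.comp _ ((hasFDerivAt_id _).sub_const _))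
  rw [h2.fderiv_eq, h3.fderiv]
  rfl

/-- In a chart, the derivatives of functions that satisfy a linear system along a frame are
bounded by the functions. -/
theorem exists_fderiv_bound {ι : Type*} [Fintype ι]
    {U : Fin n → ∀ x : S, TangentSpace (𝓡 n) x} (hU : ∀ a, IsSmoothVF (U a))
    (hli : ∀ (x : S) (z : Fin n → ℝ),
      ∑ a, z a • (U a x : EuclideanSpace ℝ (Fin n)) = 0 → z = 0)
    {f : ι → SmoothFn 𝕜 n S} {M : Fin n → ι → ι → 𝕜}
    (hf : ∀ a i, vfOp 𝕜 (U a) (hU a) (f i) = ∑ j, M a i j • f j) (c : S) :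
    ∃ K : ℝ, ∀ᶠ q in nhds c, ∀ (i : ι) (w : EuclideanSpace ℝ (Fin n)),
      ‖fderiv ℝ ((f i : S → 𝕜) ∘ (extChartAt (𝓡 n) c).symm) (extChartAt (𝓡 n) c q) w‖ ≤
        K * ‖w‖ * ‖fun j => (f j : S → 𝕜) q‖ := by
  -- `N` expresses the frame in the coordinate directions. It is invertible at `c`, hence nearby,
  -- and its inverse turns the equations along the frame into bounds on partial derivatives.
  let N : Matrix (Fin n) (Fin n) (SmoothFn 𝕜 n S) :=
    Matrix.of fun a k => vfOp 𝕜 (U a) (hU a) (coordFn 𝕜 c k)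
  have hdet : (N.det : S → 𝕜) c ≠ 0 := by
    let u : Fin n → EuclideanSpace ℝ (Fin n) := fun a => U a c
    let R : Matrix (Fin n) (Fin n) ℝ := Matrix.of fun a k => u a k
    have h1 : N.map (evalAt 𝕜 n c) = R.map (algebraMap ℝ 𝕜) := by
      ext a k
      exact differential_coordFn (𝕜 := 𝕜) c k (U a c)
    have h2 : (N.det : S → 𝕜) c = (N.map (evalAt 𝕜 n c)).det :=
      (evalAt 𝕜 n c).toRingHom.map_det N
    have h3 : (R.map (algebraMap ℝ 𝕜)).det = algebraMap ℝ 𝕜 R.det :=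
      ((algebraMap ℝ 𝕜).map_det R).symm
    rw [h2, h1, h3, Ne, map_eq_zero]
    intro h4
    obtain ⟨z, hz, hz'⟩ := Matrix.exists_vecMul_eq_zero_iff.2 h4
    refine hz (hli c z ?_)
    change ∑ a, z a • u a = 0
    ext k
    have := congrFun hz' k
    simpa [Matrix.vecMul, dotProduct, R] using this
  have hcont : ∀ g : SmoothFn 𝕜 n S, Continuous (g : S → 𝕜) := fun g =>
    (SmoothFn.contMDiff g).continuous
  let B : Fin n → Fin n → S → 𝕜 := fun k a q =>
    ((N.det : S → 𝕜) q)⁻¹ * (N.adjugate k a : S → 𝕜) q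
  have hB : ∀ k a, ContinuousAt (B k a) c := fun k a =>
    ((hcont _).continuousAt.inv₀ hdet).mul (hcont _).continuousAt
  have hBb : ∀ᶠ q in nhds c, ∀ k a, ‖B k a q‖ < ‖B k a c‖ + 1 :=
    Filter.eventually_all.2 fun k => Filter.eventually_all.2 fun a =>
      (hB k a).norm.eventually_lt continuousAt_const (by simp)
  -- The entries of the inverse matrix `B` stay below their norm at `c` plus one; the sums over `M`
  -- bound all the coefficients of the system.
  refine ⟨∑ k, ∑ a, (‖B k a c‖ + 1) * ∑ i, ∑ j, ‖M a i j‖, ?_⟩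
  filter_upwards [hBb, eventually_fderiv_coordFn (𝕜 := 𝕜) (n := n) c,
    (hcont N.det).continuousAt.eventually_ne hdet,
    (chartAt (EuclideanSpace ℝ (Fin n)) c).open_source.mem_nhds (mem_chart_source _ c)]
    with q hq hcoord hdetq hqs i w
  set L := fderiv ℝ ((f i : S → 𝕜) ∘ (extChartAt (𝓡 n) c).symm) (extChartAt (𝓡 n) c q) with hL
  let e : Fin n → EuclideanSpace ℝ (Fin n) := fun k => EuclideanSpace.single k 1
  let Nq : Matrix (Fin n) (Fin n) 𝕜 := N.map (evalAt 𝕜 n q)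
  have hw : ∀ w : EuclideanSpace ℝ (Fin n), L w = ∑ k, ((w k : ℝ) : 𝕜) * L (e k) := fun w => by
    have : w = ∑ k, w k • e k := by ext i; simp [e, Pi.single_apply]
    conv_lhs => rw [this]
    simp only [map_sum, map_smul, RCLike.real_smul_eq_coe_mul]
  have h1 : Nq.mulVec (fun k => L (e k)) = fun a => ∑ j, M a i j * (f j : S → 𝕜) q := by
    ext a
    have h2 : (vfOp 𝕜 (U a) (hU a) (f i) : S → 𝕜) q = ∑ j, M a i j * (f j : S → 𝕜) q := by
      rw [hf, ← evalAt_apply, map_sum]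
      rfl
    rw [← h2, vfOp_apply, differential_eq_fderiv_comp hqs]
    refine Eq.trans ?_ (hw _).symm
    change ∑ k, Nq a k * L (e k) = _
    refine Finset.sum_congr rfl fun k _ => ?_
    congr 1
    refine Eq.trans ?_ (hcoord k _)
    exact differential_eq_fderiv_comp hqs _ _
  have h2 : ∀ k, L (e k) = ∑ a, B k a q * ∑ j, M a i j * (f j : S → 𝕜) q := fun k => by
    have h3 : N.adjugate.map (evalAt 𝕜 n q) = Nq.adjugate :=
      (evalAt 𝕜 n q).toRingHom.map_adjugate N
    have h4 : (N.det : S → 𝕜) q = Nq.det := (evalAt 𝕜 n q).toRingHom.map_det N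
    have h5 := congrFun (congrArg (fun v => Nq.adjugate.mulVec v) h1) k
    simp only [Matrix.mulVec_mulVec, Matrix.adjugate_mul, Matrix.smul_mulVec,
      Matrix.one_mulVec] at h5
    rw [← h4, Pi.smul_apply, smul_eq_mul] at h5
    rw [← inv_mul_cancel_left₀ hdetq (L (e k)), h5, Matrix.mulVec, dotProduct, Finset.mul_sum]
    refine Finset.sum_congr rfl fun a _ => ?_
    rw [← h3, ← mul_assoc]
    rfl
  set φ : ℝ := ‖fun j => (f j : S → 𝕜) q‖ with hφ
  have hs : ∀ a, ‖∑ j, M a i j * (f j : S → 𝕜) q‖ ≤ (∑ i, ∑ j, ‖M a i j‖) * φ := fun a => by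
    calc _ ≤ ∑ j, ‖M a i j‖ * φ := by
          refine (norm_sum_le _ _).trans (Finset.sum_le_sum fun j _ => ?_)
          rw [norm_mul]
          exact mul_le_mul_of_nonneg_left (norm_le_pi_norm (fun j => (f j : S → 𝕜) q) j)
            (norm_nonneg _)
      _ = (∑ j, ‖M a i j‖) * φ := by rw [Finset.sum_mul]
      _ ≤ _ := mul_le_mul_of_nonneg_right (Finset.single_le_sum
          (f := fun i => ∑ j, ‖M a i j‖) (fun i _ => by positivity) (Finset.mem_univ i))
          (norm_nonneg _)
  have hLk : ∀ k, ‖L (e k)‖ ≤ ∑ a, (‖B k a c‖ + 1) * ((∑ i, ∑ j, ‖M a i j‖) * φ) := fun k => by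
    rw [h2]
    refine (norm_sum_le _ _).trans (Finset.sum_le_sum fun a _ => ?_)
    rw [norm_mul]
    exact mul_le_mul (hq k a).le (hs a) (norm_nonneg _) (by positivity)
  rw [hw]
  calc _ ≤ ∑ k, ‖w‖ * ∑ a, (‖B k a c‖ + 1) * ((∑ i, ∑ j, ‖M a i j‖) * φ) := by
        refine (norm_sum_le _ _).trans (Finset.sum_le_sum fun k _ => ?_)
        rw [norm_mul, RCLike.norm_ofReal]
        exact mul_le_mul (PiLp.norm_apply_le w k) (hLk k) (norm_nonneg _) (norm_nonneg _)
    _ = _ := by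
        rw [← Finset.mul_sum, mul_comm _ ‖w‖, mul_assoc, Finset.sum_mul]
        congr 1
        refine Finset.sum_congr rfl fun k _ => ?_
        rw [Finset.sum_mul]
        exact Finset.sum_congr rfl fun a _ => (mul_assoc _ _ _).symm

/-- On a connected manifold, a solution of a linear system along a frame of vector fields that
vanishes at a point vanishes. -/
theorem eq_zero_of_frame_system [ConnectedSpace S] {ι : Type*} [Fintype ι]
    {U : Fin n → ∀ x : S, TangentSpace (𝓡 n) x} (hU : ∀ a, IsSmoothVF (U a))
    (hli : ∀ (x : S) (z : Fin n → ℝ),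
      ∑ a, z a • (U a x : EuclideanSpace ℝ (Fin n)) = 0 → z = 0)
    {f : ι → SmoothFn 𝕜 n S} {M : Fin n → ι → ι → 𝕜}
    (hf : ∀ a i, vfOp 𝕜 (U a) (hU a) (f i) = ∑ j, M a i j • f j) {p : S}
    (hp : ∀ i, (f i : S → 𝕜) p = 0) (i : ι) : f i = 0 := by
  -- The common zero set is closed, nonempty and, by Gronwall along segments in a chart, open.
  let Z : Set S := {x | ∀ i, (f i : S → 𝕜) x = 0}
  have hclosed : IsClosed Z := by
    simp only [Z, Set.ofPred_forall]
    exact isClosed_iInter fun i =>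
      isClosed_eq (SmoothFn.contMDiff (f i)).continuous continuous_const
  have hopen : IsOpen Z := by
    rw [isOpen_iff_mem_nhds]
    intro c hc
    obtain ⟨K, hK⟩ := exists_fderiv_bound hU hli hf c
    set φ := extChartAt (𝓡 n) c with hφ
    have h1 : ∀ᶠ y in nhds (φ c), y ∈ φ.target ∧ ∀ (i : ι) (w : EuclideanSpace ℝ (Fin n)),
        ‖fderiv ℝ ((f i : S → 𝕜) ∘ φ.symm) y w‖ ≤ K * ‖w‖ * ‖fun j => (f j : S → 𝕜) (φ.symm y)‖ := by
      have h2 := continuousAt_extChartAt_symm (I := 𝓡 n) c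
      rw [ContinuousAt, extChartAt_to_inv] at h2
      filter_upwards [h2.eventually hK, extChartAt_target_mem_nhds (I := 𝓡 n) c] with y hy hy'
      refine ⟨hy', fun i w => ?_⟩
      have := hy i w
      rwa [φ.right_inv hy'] at this
    obtain ⟨r, hr, hball⟩ := Metric.eventually_nhds_iff_ball.1 h1
    filter_upwards [(continuousAt_extChartAt (I := 𝓡 n) c).preimage_mem_nhds
      (Metric.ball_mem_nhds _ hr), extChartAt_source_mem_nhds (I := 𝓡 n) c] with q hq hqs
    let γ : ℝ → EuclideanSpace ℝ (Fin n) := fun t => φ c + t • (φ q - φ c)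
    have hγ : ∀ t ∈ Set.Icc (0 : ℝ) 1, γ t ∈ Metric.ball (φ c) r := fun t ht => by
      have hq2 : ‖φ q - φ c‖ < r := by rw [← dist_eq_norm]; exact hq
      simp only [γ, Metric.mem_ball, dist_eq_norm, add_sub_cancel_left, norm_smul,
        Real.norm_eq_abs, abs_of_nonneg ht.1]
      exact (mul_le_of_le_one_left (norm_nonneg _) ht.2).trans_lt hq2
    have hγd : ∀ t, HasDerivAt γ (φ q - φ c) t := fun t => by
      simpa [γ] using ((hasDerivAt_id t).smul_const (φ q - φ c)).const_add (φ c)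
    let g : ℝ → ι → 𝕜 := fun t j => (f j : S → 𝕜) (φ.symm (γ t))
    let g' : ℝ → ι → 𝕜 := fun t j => fderiv ℝ ((f j : S → 𝕜) ∘ φ.symm) (γ t) (φ q - φ c)
    have hg : ∀ t ∈ Set.Icc (0 : ℝ) 1, HasDerivAt g (g' t) t := fun t ht =>
      hasDerivAt_pi.2 fun j =>
        ((contDiffAt_comp_extChartAt_symm (f j) c (hball _ (hγ t ht)).1).differentiableAt
          (by simp)).hasFDerivAt.comp_hasDerivAt t (hγd t)
    have hz := eq_zero_of_abs_deriv_le_mul_abs_self_of_eq_zero_right (f := g) (f' := g')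
      (K := K * ‖φ q - φ c‖) (a := 0) (b := 1)
      (fun t ht => (hg t ht).continuousAt.continuousWithinAt)
      (fun t ht => (hg t ⟨ht.1, ht.2.le⟩).hasDerivWithinAt)
      (by
        ext j
        simp only [g, γ, zero_smul, add_zero, hφ, extChartAt_to_inv]
        exact hc j)
      (fun t ht => by
        have hb := (hball _ (hγ t ⟨ht.1, ht.2.le⟩)).2
        -- The sign of `K` is not recorded, so bounding the sup norm componentwise requires an
        -- index; without any, both sides vanish.
        by_cases hι : Nonempty ι
        · exact (pi_norm_le_iff_of_nonempty _).2 fun j => hb j _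
        · rw [not_nonempty_iff] at hι
          rw [Subsingleton.elim (g' t) 0, Subsingleton.elim (g t) 0]
          simp) 1 ⟨zero_le_one, le_rfl⟩
    intro j
    have := congrFun hz j
    simpa only [g, γ, one_smul, add_sub_cancel, φ.left_inv hqs, Pi.zero_apply] using this
  have huniv : Z = Set.univ := IsClopen.eq_univ ⟨hclosed, hopen⟩ ⟨p, hp⟩
  ext x
  have : x ∈ Z := huniv ▸ Set.mem_univ x
  exact this i

end Uniqueness

/-! ### Symmetry of mixed partial derivatives -/

section MixedPartials

theorem fderiv_fderiv_prodMk {E F : Type*} [NormedAddCommGroup E] [NormedSpace ℝ E]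
    [NormedAddCommGroup F] [NormedSpace ℝ F] {H : E × E → F} {y : E}
    (hH : ContDiffAt ℝ ∞ H (y, y)) (X Y : E) :
    fderiv ℝ (fun s => fderiv ℝ (fun t => H (s, t)) y Y) y X =
      fderiv ℝ (fun t => fderiv ℝ (fun s => H (s, t)) y X) y Y := by
  have h1 : ∀ᶠ p in nhds (y, y), DifferentiableAt ℝ H p :=
    ((hH.of_le (m := 1) (by exact_mod_cast le_top)).eventually (by simp)).mono
      fun p hp => hp.differentiableAt one_ne_zero
  have h2 : DifferentiableAt ℝ (fderiv ℝ H) (y, y) :=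
    (hH.fderiv_right (m := ∞) (by simp)).differentiableAt (by simp)
  have a1 : (fun s => fderiv ℝ (fun t => H (s, t)) y Y) =ᶠ[nhds y]
      fun s => fderiv ℝ H (s, y) (0, Y) := by
    have : Filter.Tendsto (fun s : E => (s, y)) (nhds y) (nhds (y, y)) :=
      (Continuous.prodMk_left y).continuousAt
    filter_upwards [this.eventually h1] with s hs
    have := hs.hasFDerivAt.comp y (hasFDerivAt_prodMk_right s y)
    rw [show (fun t => H (s, t)) = H ∘ (fun t => (s, t)) from rfl, this.fderiv]
    rfl
  have a2 : (fun t => fderiv ℝ (fun s => H (s, t)) y X) =ᶠ[nhds y]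
      fun t => fderiv ℝ H (y, t) (X, 0) := by
    have : Filter.Tendsto (fun t : E => (y, t)) (nhds y) (nhds (y, y)) :=
      (Continuous.prodMk_right y).continuousAt
    filter_upwards [this.eventually h1] with t ht
    have := HasFDerivAt.comp (f := fun s => (s, t)) y ht.hasFDerivAt
      (hasFDerivAt_prodMk_left (𝕜 := ℝ) y t)
    rw [show (fun s => H (s, t)) = H ∘ (fun s => (s, t)) from rfl, this.fderiv]
    rfl
  have b1 : HasFDerivAt (fun s => fderiv ℝ H (s, y) (0, Y))
      ((ContinuousLinearMap.apply ℝ F (0, Y)).comp ((fderiv ℝ (fderiv ℝ H) (y, y)).comp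
        (ContinuousLinearMap.inl ℝ E E))) y :=
    (ContinuousLinearMap.apply ℝ F ((0, Y) : E × E)).hasFDerivAt.comp y
      (HasFDerivAt.comp (g := fderiv ℝ H) y h2.hasFDerivAt (hasFDerivAt_prodMk_left y y))
  have b2 : HasFDerivAt (fun t => fderiv ℝ H (y, t) (X, 0))
      ((ContinuousLinearMap.apply ℝ F (X, 0)).comp ((fderiv ℝ (fderiv ℝ H) (y, y)).comp
        (ContinuousLinearMap.inr ℝ E E))) y :=
    (ContinuousLinearMap.apply ℝ F ((X, 0) : E × E)).hasFDerivAt.comp y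
      (HasFDerivAt.comp (g := fderiv ℝ H) y h2.hasFDerivAt (hasFDerivAt_prodMk_right y y))
  rw [a1.fderiv_eq, a2.fderiv_eq, b1.fderiv, b2.fderiv]
  have hs : IsSymmSndFDerivAt ℝ H (y, y) :=
    hH.isSymmSndFDerivAt (by simpa using ENat.LEInfty.out)
  exact hs.eq (X, 0) (0, Y)

end MixedPartials

/-! ### Operators that preserve every cochain -/

section Cochains

variable {𝕜 : Type*} [RCLike 𝕜] {n : ℕ} {S : Type*} [TopologicalSpace S]
  [ChartedSpace (EuclideanSpace ℝ (Fin n)) S]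

/-- An operator that is a derivation of each cochain. -/
def PreservesCochains (C : Cochains 𝕜 n S) (D : Op 𝕜 n S) : Prop :=
  ∀ k u v, D (C k u v) = C k (D u) v + C k u (D v)

theorem coeff_opApply_C (D : Op 𝕜 n S) (u : (SmoothFn 𝕜 n S)⟦X⟧) (N : ℕ) :
    PowerSeries.coeff N (opApply (PowerSeries.C D) u) = D (PowerSeries.coeff N u) := by
  rw [opApply, PowerSeries.coeff_mk, Finset.sum_eq_single (0, N)]
  · simp
  · rintro ⟨i, j⟩ hij hne
    rw [Finset.HasAntidiagonal.mem_antidiagonal] at hij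
    have hi : i ≠ 0 := by
      rintro rfl
      simp only [zero_add] at hij
      exact hne (by rw [hij])
    rw [PowerSeries.coeff_C, if_neg hi, LinearMap.zero_apply]
  · intro h
    simp at h

theorem PreservesCochains.mem_Der {C : Cochains 𝕜 n S} {D : Op 𝕜 n S}
    (h : PreservesCochains C D) (hD : IsDiffOp D) : (PowerSeries.C D : OpSeries 𝕜 n S) ∈ Der C := by
  refine ⟨fun k => ?_, fun u v => ?_⟩
  · rw [PowerSeries.coeff_C]
    split_ifs
    exacts [hD, IsDiffOp.zero]
  · ext1 N
    rw [coeff_opApply_C, map_add]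
    simp only [starMul, PowerSeries.coeff_mk, map_sum, h _ _ _, coeff_opApply_C,
      Finset.sum_add_distrib]

/-- An operator without `ν` acts on each coefficient of a product of two functions separately. -/
theorem preservesCochains_of_mem_Der {C : Cochains 𝕜 n S} {D : Op 𝕜 n S}
    (h : (PowerSeries.C D : OpSeries 𝕜 n S) ∈ Der C) : PreservesCochains C D := by
  have aux : ∀ (u v : SmoothFn 𝕜 n S) N, PowerSeries.coeff N
      (starMul C (PowerSeries.C u) (PowerSeries.C v)) = C N u v := fun u v N => by
    rw [starMul, PowerSeries.coeff_mk, Finset.sum_eq_single (N, 0)]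
    · simp
    · rintro ⟨i, j⟩ hij hne
      rw [Finset.HasAntidiagonal.mem_antidiagonal] at hij
      refine Finset.sum_eq_zero fun q hq => ?_
      rw [Finset.HasAntidiagonal.mem_antidiagonal] at hq
      simp only at hij hq
      have hj : j ≠ 0 := by
        rintro rfl
        exact hne (by rw [← hij, add_zero])
      rw [PowerSeries.coeff_C, PowerSeries.coeff_C]
      rcases Nat.eq_zero_or_pos q.1 with h0 | h0
      · rw [if_neg (by omega : q.2 ≠ 0), map_zero]
      · rw [if_neg (by omega : q.1 ≠ 0), map_zero, LinearMap.zero_apply]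
    · intro h
      simp at h
  have hC : ∀ u : SmoothFn 𝕜 n S, opApply (PowerSeries.C D) (PowerSeries.C u) =
      PowerSeries.C (D u) := fun u => by
    ext1 N
    rw [coeff_opApply_C, PowerSeries.coeff_C, PowerSeries.coeff_C]
    split_ifs
    exacts [rfl, map_zero D]
  intro k u v
  have h1 := congrArg (PowerSeries.coeff k) (h.2 (PowerSeries.C u) (PowerSeries.C v))
  rwa [coeff_opApply_C, map_add, hC, hC, aux, aux, aux] at h1

theorem isDiffOp_of_isLeibniz {D : Op 𝕜 n S} (h : IsLeibniz D) : IsDiffOp D := by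
  refine ⟨1, fun f g => ?_⟩
  ext1 u
  simp only [LinearMap.sub_apply, Module.End.mul_apply, LinearMap.mulLeft_apply, h f, h g,
    LinearMap.zero_apply]
  ring

end Cochains

/-! ### Left-invariant operators commute with the fields `X^⋆` -/

section Commutation

variable {𝕜 : Type*} [RCLike 𝕜] {n : ℕ} {S : Type*} [TopologicalSpace S]
  [ChartedSpace (EuclideanSpace ℝ (Fin n)) S] [Group S] [LieGroup (𝓡 n) ∞ S]

/-- Left and right multiplication commute: up to sign, both sides are the mixed derivatives at the
unit of `(s, t) ↦ f(s x t)`. -/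
theorem starOp_leftAction (X Y : GroupLieAlgebra (𝓡 n) S) (f : SmoothFn 𝕜 n S) :
    starOp 𝕜 X (leftAction 𝕜 Y f) = leftAction 𝕜 Y (starOp 𝕜 X f) := by
  ext x
  set φ := extChartAt (𝓡 n) (1 : S) with hφ
  let H : EuclideanSpace ℝ (Fin n) × EuclideanSpace ℝ (Fin n) → 𝕜 :=
    fun p => (f : S → 𝕜) (φ.symm p.1 * x * φ.symm p.2)
  have hH : ContDiffAt ℝ ∞ H (φ 1, φ 1) := by
    have hs : ContMDiffAt 𝓘(ℝ, EuclideanSpace ℝ (Fin n)) (𝓡 n) ∞ φ.symm (φ 1) :=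
      (contMDiffOn_extChartAt_symm (I := 𝓡 n) (n := ∞) (1 : S)).contMDiffAt
        (extChartAt_target_mem_nhds (I := 𝓡 n) (1 : S))
    have h1 : ContMDiffAt 𝓘(ℝ, EuclideanSpace ℝ (Fin n) × EuclideanSpace ℝ (Fin n)) (𝓡 n) ∞
        (fun p : EuclideanSpace ℝ (Fin n) × EuclideanSpace ℝ (Fin n) => φ.symm p.1) (φ 1, φ 1) :=
      ContMDiffAt.comp (g := φ.symm) _ hs contDiff_fst.contMDiff.contMDiffAt
    have h2 : ContMDiffAt 𝓘(ℝ, EuclideanSpace ℝ (Fin n) × EuclideanSpace ℝ (Fin n)) (𝓡 n) ∞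
        (fun p : EuclideanSpace ℝ (Fin n) × EuclideanSpace ℝ (Fin n) => φ.symm p.2) (φ 1, φ 1) :=
      ContMDiffAt.comp (g := φ.symm) _ hs contDiff_snd.contMDiff.contMDiffAt
    exact ((SmoothFn.contMDiff f).contMDiffAt.comp _
      ((h1.mul contMDiffAt_const).mul h2)).contDiffAt
  have hd : ∀ (g : SmoothFn 𝕜 n S) (Z : EuclideanSpace ℝ (Fin n)),
      differential (g : S → 𝕜) (1 : S) Z = fderiv ℝ ((g : S → 𝕜) ∘ φ.symm) (φ 1) Z := fun g Z =>
    differential_eq_fderiv ((SmoothFn.contMDiff g).mdifferentiable (by simp) 1) Z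
  have hr : ∀ (g : SmoothFn 𝕜 n S) (y : S) (Z : GroupLieAlgebra (𝓡 n) S),
      (starOp 𝕜 Z g : S → 𝕜) y = -fderiv ℝ (fun s => (g : S → 𝕜) (φ.symm s * y)) (φ 1)
        (Z : EuclideanSpace ℝ (Fin n)) := fun g y Z => by
    rw [starOp_apply]
    exact congrArg Neg.neg (hd ⟨fun z => (g : S → 𝕜) (z * y), (SmoothFn.contMDiff g).comp
      (contMDiff_mul_right (I := 𝓡 n) (n := ∞))⟩ Z)
  have hl : ∀ (g : SmoothFn 𝕜 n S) (y : S) (Z : GroupLieAlgebra (𝓡 n) S),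
      (leftAction 𝕜 Z g : S → 𝕜) y = fderiv ℝ (fun t => (g : S → 𝕜) (y * φ.symm t)) (φ 1)
        (Z : EuclideanSpace ℝ (Fin n)) := fun g y Z => by
    rw [leftAction_apply]
    exact hd (leftTranslate y g) Z
  rw [hr, hl]
  simp only [hl, hr]
  have e : (fun t => -fderiv ℝ (fun s => (f : S → 𝕜) (φ.symm s * (x * φ.symm t))) (φ 1)
      (X : EuclideanSpace ℝ (Fin n))) =
      -(fun t => fderiv ℝ (fun s => H (s, t)) (φ 1) (X : EuclideanSpace ℝ (Fin n))) := by
    ext t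
    simp only [H, Pi.neg_apply, mul_assoc]
  rw [e, fderiv_neg]
  exact congrArg Neg.neg (fderiv_fderiv_prodMk hH (X : EuclideanSpace ℝ (Fin n))
    (Y : EuclideanSpace ℝ (Fin n)))

theorem starOp_isLeibniz (X : GroupLieAlgebra (𝓡 n) S) : IsLeibniz (starOp 𝕜 X) :=
  vfOp_isLeibniz (isSmoothVF_starField X)

theorem starOp_leftInvOp (X : GroupLieAlgebra (𝓡 n) S) (a : EnvAlg 𝕜 (GroupLieAlgebra (𝓡 n) S))
    (f : SmoothFn 𝕜 n S) : starOp 𝕜 X (leftInvOp 𝕜 a f) = leftInvOp 𝕜 a (starOp 𝕜 X f) := by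
  induction a using envAlg_induction generalizing f with
  | algebraMap c =>
    rw [AlgHom.commutes, Algebra.algebraMap_eq_smul_one]
    exact (starOp 𝕜 X).map_smul c f
  | ι Y => rw [leftInvOp_ι, starOp_leftAction]
  | add a b ha hb => simp only [map_add, LinearMap.add_apply, ha, hb]
  | mul a b ha hb => rw [map_mul, Module.End.mul_apply, ha, hb, Module.End.mul_apply]

theorem starOp_leftInvBidiffOp (X : GroupLieAlgebra (𝓡 n) S)
    (w : EnvAlg 𝕜 (GroupLieAlgebra (𝓡 n) S) ⊗[𝕜] EnvAlg 𝕜 (GroupLieAlgebra (𝓡 n) S))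
    (u v : SmoothFn 𝕜 n S) : starOp 𝕜 X (leftInvBidiffOp w u v) =
      leftInvBidiffOp w (starOp 𝕜 X u) v + leftInvBidiffOp w u (starOp 𝕜 X v) := by
  induction w using TensorProduct.induction_on with
  | zero => simp [leftInvBidiffOp_zero]
  | tmul a b =>
    simp only [leftInvBidiffOp_tmul, starOp_isLeibniz X _ _, starOp_leftInvOp]
    ring
  | add x y hx hy =>
    simp only [leftInvBidiffOp_add, LinearMap.add_apply, map_add, hx, hy]
    abel

theorem leftTranslate_leftInvOp (g : S) (a : EnvAlg 𝕜 (GroupLieAlgebra (𝓡 n) S))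
    (f : SmoothFn 𝕜 n S) :
    leftInvOp 𝕜 a (leftTranslate g f) = leftTranslate g (leftInvOp 𝕜 a f) := by
  induction a using envAlg_induction generalizing f with
  | algebraMap c => rw [AlgHom.commutes, Algebra.algebraMap_eq_smul_one]; rfl
  | ι Y => rw [leftInvOp_ι, leftAction_leftTranslate]
  | add a b ha hb => simp only [map_add, LinearMap.add_apply, ha, hb]; rfl
  | mul a b ha hb => rw [map_mul, Module.End.mul_apply, hb, ha, Module.End.mul_apply]

theorem leftTranslate_leftInvBidiffOp (g : S)
    (w : EnvAlg 𝕜 (GroupLieAlgebra (𝓡 n) S) ⊗[𝕜] EnvAlg 𝕜 (GroupLieAlgebra (𝓡 n) S))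
    (u v : SmoothFn 𝕜 n S) : leftInvBidiffOp w (leftTranslate g u) (leftTranslate g v) =
      leftTranslate g (leftInvBidiffOp w u v) := by
  induction w using TensorProduct.induction_on with
  | zero => simp only [leftInvBidiffOp_zero]; rfl
  | tmul a b => simp only [leftInvBidiffOp_tmul, leftTranslate_leftInvOp]; rfl
  | add x y hx hy =>
    simp only [leftInvBidiffOp_add, LinearMap.add_apply, hx, hy]
    rfl

theorem starOp_mem_internalSymmetry
    (F : (EnvAlg 𝕜 (GroupLieAlgebra (𝓡 n) S) ⊗[𝕜] EnvAlg 𝕜 (GroupLieAlgebra (𝓡 n) S))⟦X⟧)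
    (X : GroupLieAlgebra (𝓡 n) S) : starOp 𝕜 X ∈ InternalSymmetry (twistCochains F) :=
  ⟨⟨_, isSmoothVF_starField X, rfl⟩, PreservesCochains.mem_Der
    (fun _ u v => starOp_leftInvBidiffOp X _ u v) (isDiffOp_of_isLeibniz (starOp_isLeibniz X))⟩

theorem PreservesCochains.conjOp
    {F : (EnvAlg 𝕜 (GroupLieAlgebra (𝓡 n) S) ⊗[𝕜] EnvAlg 𝕜 (GroupLieAlgebra (𝓡 n) S))⟦X⟧}
    {D : Op 𝕜 n S} (h : PreservesCochains (twistCochains F) D) (g : S) :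
    PreservesCochains (twistCochains F) (conjOp g D) := fun k u v => by
  have e : ∀ u v, twistCochains F k (leftTranslate g u) (leftTranslate g v) =
    leftTranslate g (twistCochains F k u v) := fun u v => leftTranslate_leftInvBidiffOp g _ u v
  have e' : ∀ u v, leftTranslate g⁻¹ (twistCochains F k u v) =
      twistCochains F k (leftTranslate g⁻¹ u) (leftTranslate g⁻¹ v) := fun u v =>
    (leftTranslate_leftInvBidiffOp g⁻¹ _ u v).symm
  have hu : ∀ u : SmoothFn 𝕜 n S, u = leftTranslate g (leftTranslate g⁻¹ u) := fun u => by
    rw [leftTranslate_leftTranslate, inv_mul_cancel, leftTranslate_one]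
  have h1 : twistCochains F k (DrinfeldTwist.conjOp g D u) v =
      leftTranslate g (twistCochains F k (D (leftTranslate g⁻¹ u)) (leftTranslate g⁻¹ v)) := by
    rw [← e, ← hu v]; rfl
  have h2 : twistCochains F k u (DrinfeldTwist.conjOp g D v) =
      leftTranslate g (twistCochains F k (leftTranslate g⁻¹ u) (D (leftTranslate g⁻¹ v))) := by
    rw [← e, ← hu u]; rfl
  rw [h1, h2, conjOp_apply, e', h k]
  rfl

/-- The left-invariant frame is pointwise linearly independent. -/
theorem leftFrame_linearIndependent (x : S) (z : Fin n → ℝ)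
    (h : ∑ a, z a • (mulInvariantVectorField (frameVector n S a) x : EuclideanSpace ℝ (Fin n)) = 0) :
    z = 0 := by
  let L : EuclideanSpace ℝ (Fin n) →ₗ[ℝ] EuclideanSpace ℝ (Fin n) :=
    (mfderiv (𝓡 n) (𝓡 n) (fun y : S => x * y) 1).toLinearMap
  have hsurj : Function.Surjective L := fun u => exists_invariant_eq x u
  have hinj : Function.Injective L := LinearMap.injective_iff_surjective.2 hsurj
  have h1 : L (∑ a, z a • (EuclideanSpace.single a (1 : ℝ) : EuclideanSpace ℝ (Fin n))) = 0 := by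
    rw [map_sum]
    exact (Finset.sum_congr rfl fun a _ => map_smul L _ _).trans h
  have h2 := hinj (h1.trans (map_zero L).symm)
  ext i
  have := congrArg (fun v : EuclideanSpace ℝ (Fin n) => v i) h2
  simpa [Pi.single_apply] using this

theorem starField_linearIndependent (x : S) (z : Fin n → ℝ)
    (h : ∑ a, z a • (starField (frameVector n S a) x : EuclideanSpace ℝ (Fin n)) = 0) :
    z = 0 := by
  let L : EuclideanSpace ℝ (Fin n) →ₗ[ℝ] EuclideanSpace ℝ (Fin n) :=
    (mfderiv (𝓡 n) (𝓡 n) (fun y : S => y * x) 1).toLinearMap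
  let L' : EuclideanSpace ℝ (Fin n) →ₗ[ℝ] EuclideanSpace ℝ (Fin n) :=
    (mfderiv (𝓡 n) (𝓡 n) (fun y : S => y * x⁻¹) x).toLinearMap
  have hLL : ∀ v, L' (L v) = v := fun v => by
    have hd : ∀ a b : S, MDifferentiableAt (𝓡 n) (𝓡 n) (fun y : S => y * a) b := fun a b =>
      (contMDiff_mul_right (I := 𝓡 n) (n := ∞)).mdifferentiable (by simp) b
    have h := mfderiv_comp_of_eq (I := 𝓡 n) (I' := 𝓡 n) (I'' := 𝓡 n) (x := (1 : S)) (y := x)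
      (g := fun y : S => y * x⁻¹) (f := fun y : S => y * x) (hd _ _) (hd _ _) (by simp)
    have e : (fun y : S => y * x⁻¹) ∘ (fun y : S => y * x) = id := by ext y; simp
    rw [e, mfderiv_id] at h
    have e2 : ∀ b : S, b = x → ∀ v : EuclideanSpace ℝ (Fin n),
        (mfderiv (𝓡 n) (𝓡 n) (fun y : S => y * x⁻¹) b v : EuclideanSpace ℝ (Fin n)) =
          mfderiv (𝓡 n) (𝓡 n) (fun y : S => y * x⁻¹) x v := by
      rintro _ rfl _; rfl
    have h1 := DFunLike.congr_fun h v
    exact (e2 _ (one_mul x) _).symm.trans h1.symm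
  have h1 : L (∑ a, z a • (EuclideanSpace.single a (1 : ℝ) : EuclideanSpace ℝ (Fin n))) = 0 := by
    rw [map_sum, ← neg_eq_zero, ← Finset.sum_neg_distrib]
    refine (Finset.sum_congr rfl fun a _ => ?_).trans h
    rw [map_smul, ← smul_neg]
    rfl
  have h2 := hLL (∑ a, z a • (EuclideanSpace.single a (1 : ℝ) : EuclideanSpace ℝ (Fin n)))
  rw [h1, map_zero] at h2
  ext i
  have := congrArg (fun v : EuclideanSpace ℝ (Fin n) => v i) h2.symm
  simpa [Pi.single_apply] using this

end Commutation

/-- Converts the statement that some jet values determine another one into a linear relation with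
constant coefficients, with no dimension assumption on `E`. -/
theorem exists_sum_smul_eq {ι 𝕜 E : Type*} [Fintype ι] [Field 𝕜] [AddCommMonoid E] [Module 𝕜 E]
    {L : ι → E →ₗ[𝕜] 𝕜} {K : E →ₗ[𝕜] 𝕜} (h : ∀ x, (∀ i, L i x = 0) → K x = 0) :
    ∃ c : ι → 𝕜, ∑ i, c i • L i = K := by
  let _ : AddCommGroup E := Module.addCommMonoidToAddCommGroup 𝕜
  refine (Submodule.mem_span_range_iff_exists_fun 𝕜).1
    (mem_span_of_iInf_ker_le_ker (L := L) (K := K) fun x hx => h x ?_)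
  simpa only [Submodule.mem_iInf, LinearMap.mem_ker] using hx

/-! ### Finite-dimensionality of the internal symmetry algebra -/

section SymmetryAlgebra

variable {𝕜 : Type*} [RCLike 𝕜] {n : ℕ} {S : Type*} [TopologicalSpace S] [T2Space S]
  [ChartedSpace (EuclideanSpace ℝ (Fin n)) S] [Group S] [LieGroup (𝓡 n) ∞ S]

/-- Every derivation at the unit is given by a Hamiltonian vector field. -/
theorem InvariantSymplecticForm.exists_poisson_eq (ωS : InvariantSymplecticForm n S)
    {X : Op 𝕜 n S} (hX : IsLeibniz X) :
    ∃ u : SmoothFn 𝕜 n S, ∀ g : SmoothFn 𝕜 n S, (X g : S → 𝕜) 1 = ωS.poisson u g 1 := by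
  let E := EuclideanSpace ℝ (Fin n)
  let ξ : Fin n → 𝕜 := fun a => (X (coordFn 𝕜 1 a) : S → 𝕜) 1
  let ξr : E := WithLp.toLp 2 fun a => RCLike.re (ξ a)
  let ξi : E := WithLp.toLp 2 fun a => RCLike.im (ξ a)
  let α : E →ₗ[ℝ] E →ₗ[ℝ] ℝ := ωS.form 1
  -- The coefficients are chosen so that the real and imaginary parts of `du` at the unit are `ω(ξr,
  -- ·)` and `ω(ξi, ·)`, where `ξr` and `ξi` are the real and imaginary parts of `X` there.
  let c : Fin n → 𝕜 := fun b => ((α ξr (EuclideanSpace.single b 1) : ℝ) : 𝕜) +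
    ((α ξi (EuclideanSpace.single b 1) : ℝ) : 𝕜) * RCLike.I
  let u : SmoothFn 𝕜 n S := ∑ b, c b • coordFn 𝕜 1 b
  have hframe : ∀ a, (leftFrame 𝕜 n S a u : S → 𝕜) 1 = c a := fun a => by
    rw [← evalAt_apply]
    simp only [u, map_sum, map_smul, evalAt_apply, leftFrame_coordFn]
    simp
  have hsum : ∀ (β : E →ₗ[ℝ] ℝ) (v : E), ∑ b, v b * β (EuclideanSpace.single b 1) = β v := by
    intro β v
    have hv : v = ∑ a, v a • (EuclideanSpace.single a (1 : ℝ) : E) := by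
      ext i
      simp [Pi.single_apply]
    conv_rhs => rw [hv, map_sum]
    simp
  -- Uniform over both fields: in the complex case the scalar is `1`, in the real case `ξi` itself
  -- is zero.
  have him : (RCLike.im (RCLike.I : 𝕜)) • ξi = ξi := by
    ext a
    change RCLike.im (RCLike.I : 𝕜) * RCLike.im (ξ a) = RCLike.im (ξ a)
    rw [mul_comm, RCLike.I_im]
  have hre' : ∀ v : E, RCLike.re (differential (n := n) (u : S → 𝕜) 1 v) = α ξr v := fun v => by
    rw [show differential (n := n) (u : S → 𝕜) (1 : S) v = _ from differential_one_eq_sum u v]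
    simp only [hframe, map_sum, c, RCLike.smul_re, map_add, RCLike.ofReal_re, RCLike.mul_re,
      RCLike.I_re, RCLike.ofReal_im, mul_zero, zero_mul, sub_zero, add_zero]
    exact hsum (α ξr) v
  have him' : ∀ v : E, RCLike.im (differential (n := n) (u : S → 𝕜) 1 v) = α ξi v := fun v => by
    rw [show differential (n := n) (u : S → 𝕜) (1 : S) v = _ from differential_one_eq_sum u v]
    simp only [hframe, map_sum, c, RCLike.smul_im, map_add, RCLike.ofReal_re, RCLike.mul_im,
      RCLike.I_re, RCLike.ofReal_im, mul_zero, add_zero, zero_add]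
    conv_rhs => rw [← him, map_smul, ← hsum (RCLike.im (RCLike.I : 𝕜) • α ξi) v]
    refine Finset.sum_congr rfl fun b _ => ?_
    simp only [LinearMap.smul_apply, smul_eq_mul]
    ring
  have e1 : (ωS.flat 1).symm ((RCLike.reCLM : 𝕜 →L[ℝ] ℝ).toLinearMap ∘ₗ
      differential (u : S → 𝕜) 1) = ξr :=
    (LinearEquiv.symm_apply_eq _).2 (LinearMap.ext fun v => hre' v)
  have e2 : (ωS.flat 1).symm ((RCLike.imCLM : 𝕜 →L[ℝ] ℝ).toLinearMap ∘ₗ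
      differential (u : S → 𝕜) 1) = ξi :=
    (LinearEquiv.symm_apply_eq _).2 (LinearMap.ext fun v => him' v)
  refine ⟨u, fun g => ?_⟩
  rw [InvariantSymplecticForm.poisson, e1, e2, hX.apply_one,
    show differential (n := n) (g : S → 𝕜) (1 : S) ξr = _ from differential_one_eq_sum g ξr,
    show differential (n := n) (g : S → 𝕜) (1 : S) ξi = _ from differential_one_eq_sum g ξi,
    Finset.mul_sum, ← Finset.sum_add_distrib]
  refine Finset.sum_congr rfl fun a _ => ?_
  change ξ a * _ = (RCLike.re (ξ a)) • _ + _ * ((RCLike.im (ξ a)) • _)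
  rw [RCLike.real_smul_eq_coe_mul, RCLike.real_smul_eq_coe_mul]
  conv_lhs => rw [← RCLike.re_add_im (ξ a)]
  ring

instance : IsReduced (SmoothFn 𝕜 n S) :=
  isReduced_of_injective (SmoothFn 𝕜 n S).val Subtype.val_injective

section Twist

variable {ωS : InvariantSymplecticForm n S}
  {F : (EnvAlg 𝕜 (GroupLieAlgebra (𝓡 n) S) ⊗[𝕜] EnvAlg 𝕜 (GroupLieAlgebra (𝓡 n) S))⟦X⟧}

/-- A derivation of the product of a natural twist whose one-jet at the unit vanishes has
vanishing two-jet at the unit. -/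
theorem PreservesCochains.leibniz_leibniz_apply_one (hF : IsTwistBasedOn ωS F)
    (hnat : IsNatural (twistCochains F)) {D : Op 𝕜 n S} (hD : IsLeibniz D)
    (hC : PreservesCochains (twistCochains F) D)
    (hsq : ∀ f, D f ∈ pointIdeal (evalAt 𝕜 n (1 : S)) ^ 2) {X Y : Op 𝕜 n S} (hX : IsLeibniz X)
    (hY : IsLeibniz Y) (v : SmoothFn 𝕜 n S) : evalAt 𝕜 n (1 : S) (X (Y (D v))) = 0 := by
  have h2 := twistCochains_two_cocycle hF.isTwist
  have h1 := twistCochains_one_cocycle hF.isTwist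
  obtain ⟨M, hM⟩ := exists_isDiffOpOfOrder_flip (PowerSeries.coeff 1 F)
  have h : ∀ v, IsDiffOpOfOrder 1 ((twistCochains F 1).flip v) :=
    isDiffOpOfOrder_one_of_natural h2 hnat.2 hM
  have hΛ := normalized_isLeibniz h1 h
  have hΛ' := normalized_isLeibniz_flip h
  -- `D` kills constants, so the correction terms with argument `1` in `normalized` and
  -- `secondSymbol` are preserved as well.
  have hC1 : ∀ k v, D (twistCochains F k 1 v) = twistCochains F k 1 (D v) := fun k v => by
    rw [hC, hD.map_one, map_zero, LinearMap.zero_apply, zero_add]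
  refine ev_leibniz_leibniz_eq_zero hΛ hΛ' (fun Z hZ => ?_) hsq (fun u v => ?_)
    (K := secondSymbol (twistCochains F 2)) (fun f f' v => ?_)
    (secondSymbol_mul_left hnat.2) secondSymbol_add_left secondSymbol_comm
    (secondSymbol_mul_right h2 hnat.2 h) hX hY v
  · obtain ⟨u, hu⟩ := ωS.exists_poisson_eq hZ
    -- Hence normalization changes `C₁` by a symmetric term only, and its skew-symmetrization
    -- remains the Poisson bracket.
    have hone : ∀ w, twistCochains F 1 1 w = w * twistCochains F 1 1 1 := fun w => by
      have := h1 1 1 w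
      simp only [one_mul] at this
      rw [add_left_cancel_iff] at this
      rw [← this, mul_comm]
    refine ⟨u, fun g => ?_⟩
    refine (hu g).trans ((hF.poisson_eq u g 1).symm.trans ?_)
    have e : normalized (twistCochains F 1) u g - normalized (twistCochains F 1) g u =
        twistCochains F 1 u g - twistCochains F 1 g u := by
      rw [normalized_apply, normalized_apply, hone g, hone u]
      ring
    rw [e]
    rfl
  · simp only [normalized_apply, map_sub, hD u, hC 1 u v, hC1]
    ring
  · simp only [secondSymbol_apply, map_add, map_sub, hD _ (twistCochains F 2 _ _), hC1]
    have e : D (f * f') = D f * f' + f * D f' := by rw [hD]; ring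
    simp only [hC 2, e, map_add, LinearMap.add_apply]
    ring

/-- The derivations of `C^∞(S)` that are derivations of each cochain. -/
def symmetrySpace (C : Cochains 𝕜 n S) : Submodule 𝕜 (Op 𝕜 n S) where
  carrier := {D | IsLeibniz D ∧ PreservesCochains C D}
  zero_mem' := ⟨fun f g => by simp, fun k u v => by simp⟩
  add_mem' h h' := ⟨h.1.add h'.1, fun k u v => by
    simp only [LinearMap.add_apply, h.2 k u v, h'.2 k u v, map_add]
    abel⟩
  smul_mem' c D h := ⟨fun f g => by
    simp only [LinearMap.smul_apply, h.1 f g, smul_add, mul_smul_comm], fun k u v => by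
    simp only [LinearMap.smul_apply, h.2 k u v, map_smul, smul_add]⟩

variable (C : Cochains 𝕜 n S)

/-- The components in the left-invariant frame of the elements of the symmetry space, and their
first derivatives along the frame. -/
def jetFn (i : Fin n ⊕ Fin n × Fin n) : symmetrySpace C →ₗ[𝕜] SmoothFn 𝕜 n S :=
  let comp : Fin n → symmetrySpace C →ₗ[𝕜] SmoothFn 𝕜 n S := fun a =>
    { toFun := fun D => componentFn D.2.1 a
      map_add' := fun _ _ => rfl
      map_smul' := fun _ _ => rfl }
  i.elim comp fun p => leftFrame 𝕜 n S p.1 ∘ₗ comp p.2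

variable {C}

theorem jetFn_leftTranslate {D D' : symmetrySpace C} {g : S}
    (h : (D' : Op 𝕜 n S) = conjOp g (D : Op 𝕜 n S)) (i : Fin n ⊕ Fin n × Fin n) :
    jetFn C i D' = leftTranslate g (jetFn C i D) := by
  have hc : ∀ a, componentFn D'.2.1 a = leftTranslate g (componentFn D.2.1 a) := fun a => by
    ext p
    change frameComponent (D' : Op 𝕜 n S) a p = frameComponent (D : Op 𝕜 n S) a (g * p)
    rw [h, frameComponent_conjOp]
  rcases i with a | ⟨b, a⟩
  · exact hc a
  · change leftFrame 𝕜 n S b (componentFn D'.2.1 a) = _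
    rw [hc, leftFrame_leftTranslate]
    rfl

/-- Vanishing one-jets of the components place them, and so all values of `D`, in the squared ideal
of the unit. The vanishing of the two-jet, tested on coordinates, then kills their second frame
derivatives. -/
theorem leftFrame_jetFn_apply_one (hF : IsTwistBasedOn ωS F)
    (hnat : IsNatural (twistCochains F)) {D : symmetrySpace (twistCochains F)}
    (h : ∀ i, evalAt 𝕜 n (1 : S) (jetFn _ i D) = 0) (c : Fin n) (i : Fin n ⊕ Fin n × Fin n) :
    evalAt 𝕜 n (1 : S) (leftFrame 𝕜 n S c (jetFn _ i D)) = 0 := by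
  rcases i with a | ⟨b, a⟩
  · exact h (Sum.inr (c, a))
  · have hm : ∀ d, componentFn D.2.1 d ∈ pointIdeal (evalAt 𝕜 n (1 : S)) ^ 2 := fun d =>
      mem_sq_of_leftFrame (h (Sum.inl d)) fun b => h (Sum.inr (b, d))
    have hsq : ∀ f, (D : Op 𝕜 n S) f ∈ pointIdeal (evalAt 𝕜 n (1 : S)) ^ 2 := fun f => by
      rw [D.2.1.apply_eq_sum_componentFn]
      exact sum_mem fun d _ => Ideal.mul_mem_right _ _ (hm d)
    have h0 := PreservesCochains.leibniz_leibniz_apply_one hF hnat D.2.1 D.2.2 hsq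
      (leftFrame_isLeibniz c) (leftFrame_isLeibniz b) (coordFn 𝕜 1 a)
    rw [D.2.1.apply_eq_sum_componentFn] at h0
    -- Both derivatives must fall on the component, which vanishes to second order at the unit.
    have key : ∀ d, evalAt 𝕜 n (1 : S) (leftFrame 𝕜 n S c (leftFrame 𝕜 n S b
        (componentFn D.2.1 d * leftFrame 𝕜 n S d (coordFn 𝕜 1 a)))) =
        evalAt 𝕜 n (1 : S) (leftFrame 𝕜 n S c (leftFrame 𝕜 n S b (componentFn D.2.1 d))) *
          if d = a then 1 else 0 := fun d => by
      rw [leftFrame_isLeibniz b, map_add, leftFrame_isLeibniz c, leftFrame_isLeibniz c,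
        ← leftFrame_coordFn (𝕜 := 𝕜) (S := S) d a, ← evalAt_apply]
      simp only [map_add, map_mul, (leftFrame_isLeibniz _).ev_sq (hm d),
        mem_pointIdeal.1 (Ideal.pow_le_self two_ne_zero (hm d))]
      ring
    simp only [map_sum, key] at h0
    simp only [mul_ite, mul_one, mul_zero, Finset.sum_ite_eq', Finset.mem_univ, if_true] at h0
    exact h0

/-- At the unit the constants exist because the one-jet determines its derivatives. They do not
depend on `D`, so applying the relation to the translates of `D` spreads it over the group. -/
theorem exists_leftFrame_jetFn_eq (hF : IsTwistBasedOn ωS F)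
    (hnat : IsNatural (twistCochains F)) :
    ∃ M : Fin n → Fin n ⊕ Fin n × Fin n → Fin n ⊕ Fin n × Fin n → 𝕜,
      ∀ c i (D : symmetrySpace (twistCochains F)),
        leftFrame 𝕜 n S c (jetFn _ i D) = ∑ j, M c i j • jetFn _ j D := by
  let J : Fin n ⊕ Fin n × Fin n → symmetrySpace (twistCochains F) →ₗ[𝕜] 𝕜 := fun i =>
    (evalAt 𝕜 n (1 : S)).toLinearMap ∘ₗ jetFn _ i
  let J' : Fin n → Fin n ⊕ Fin n × Fin n → symmetrySpace (twistCochains F) →ₗ[𝕜] 𝕜 := fun c i =>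
    (evalAt 𝕜 n (1 : S)).toLinearMap ∘ₗ leftFrame 𝕜 n S c ∘ₗ jetFn _ i
  have h : ∀ c i, ∃ m : Fin n ⊕ Fin n × Fin n → 𝕜, ∑ j, m j • J j = J' c i := fun c i =>
    exists_sum_smul_eq fun D hD => leftFrame_jetFn_apply_one hF hnat hD c i
  choose M hM using h
  refine ⟨M, fun c i D => ?_⟩
  ext p
  -- The jet of `D'` at the unit is the jet of `D` at `p`.
  let D' : symmetrySpace (twistCochains F) := ⟨conjOp p D, D.2.1.conjOp p, D.2.2.conjOp p⟩
  have h1 := LinearMap.congr_fun (hM c i) D'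
  simp only [LinearMap.sum_apply, LinearMap.smul_apply, J, J', LinearMap.comp_apply,
    jetFn_leftTranslate (D := D) (D' := D') rfl, leftFrame_leftTranslate] at h1
  have e : ∀ f : SmoothFn 𝕜 n S, (evalAt 𝕜 n (1 : S)).toLinearMap (leftTranslate p f) =
      evalAt 𝕜 n p f := fun f => by
    change (f : S → 𝕜) (p * 1) = (f : S → 𝕜) p
    rw [mul_one]
  simp only [e] at h1
  rw [← evalAt_apply, ← evalAt_apply, ← h1, map_sum]
  simp only [map_smul]

theorem eq_zero_of_jetFn_apply_one [ConnectedSpace S] (hF : IsTwistBasedOn ωS F)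
    (hnat : IsNatural (twistCochains F)) {D : symmetrySpace (twistCochains F)}
    (h : ∀ i, evalAt 𝕜 n (1 : S) (jetFn _ i D) = 0) : D = 0 := by
  obtain ⟨M, hM⟩ := exists_leftFrame_jetFn_eq hF hnat
  refine Subtype.ext (D.2.1.eq_zero_of_frameComponent fun a p => ?_)
  have := eq_zero_of_frame_system
    (U := fun a => mulInvariantVectorField (frameVector n S a))
    (fun a => isSmoothVF_mulInvariantVectorField (frameVector n S a)) leftFrame_linearIndependent
    (f := fun i => jetFn _ i D) (M := M) (fun c i => hM c i D) (p := 1) h (Sum.inl a)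
  exact congrArg (evalAt 𝕜 n p) this

/-- The internal symmetry algebra of a natural twist is finite-dimensional. -/
theorem finiteDimensional_internalSymmetry [ConnectedSpace S] (hF : IsTwistBasedOn ωS F)
    (hnat : IsNatural (twistCochains F)) :
    FiniteDimensional ℝ (InternalSymmetry (twistCochains F)) := by
  have hmem : ∀ D ∈ InternalSymmetry (twistCochains F), D ∈ symmetrySpace (twistCochains F) := by
    rintro D ⟨⟨V, hV, rfl⟩, h⟩
    exact ⟨vfOp_isLeibniz hV, preservesCochains_of_mem_Der h⟩
  let J : InternalSymmetry (twistCochains F) →ₗ[ℝ] (Fin n ⊕ Fin n × Fin n → 𝕜) :=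
    { toFun := fun D i => evalAt 𝕜 n (1 : S) (jetFn _ i ⟨D, hmem D D.2⟩)
      map_add' := fun D E => by
        ext i
        rw [Pi.add_apply, ← map_add, ← map_add]
        rfl
      map_smul' := fun c D => by
        ext i
        have e : (⟨((c • D : InternalSymmetry (twistCochains F)) : Op 𝕜 n S), hmem _ (c • D).2⟩ :
            symmetrySpace (twistCochains F)) = (c : 𝕜) • ⟨D, hmem D D.2⟩ := by
          ext f p
          exact RCLike.real_smul_eq_coe_mul c (((D : Op 𝕜 n S) f : S → 𝕜) p)
        rw [e, map_smul, map_smul]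
        exact (RCLike.real_smul_eq_coe_smul (K := 𝕜) c _).symm }
  refine FiniteDimensional.of_injective J ((injective_iff_map_eq_zero J).2 fun D hD => ?_)
  have h := eq_zero_of_jetFn_apply_one hF hnat (D := ⟨D, hmem D D.2⟩) fun i => congrFun hD i
  exact Subtype.ext (congrArg Subtype.val h :)

end Twist

end SymmetryAlgebra

/-! ### Lowest order terms of derivations of a deformed product -/

section StarDerivations

variable {𝕜 : Type*} [RCLike 𝕜] {n : ℕ} {S : Type*} [TopologicalSpace S]
  [ChartedSpace (EuclideanSpace ℝ (Fin n)) S]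

/-- The lowest order coefficient of a derivation of a deformation of the pointwise product is a
derivation. -/
theorem isLeibniz_coeff_of_mem_Der {C : Cochains 𝕜 n S} (h0 : ∀ u v, C 0 u v = u * v)
    {D : OpSeries 𝕜 n S} (hD : D ∈ Der C) {k : ℕ}
    (hlow : ∀ j < k, PowerSeries.coeff j D = 0) : IsLeibniz (PowerSeries.coeff k D) := by
  have happ : ∀ (u : SmoothFn 𝕜 n S) j, PowerSeries.coeff j (opApply D (PowerSeries.C u)) =
      PowerSeries.coeff j D u := fun u j => by
    rw [opApply, PowerSeries.coeff_mk, Finset.sum_eq_single (j, 0)]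
    · simp
    · rintro ⟨a, b⟩ hab hne
      rw [Finset.HasAntidiagonal.mem_antidiagonal] at hab
      have hb : b ≠ 0 := by
        rintro rfl
        exact hne (by rw [← hab, add_zero])
      rw [PowerSeries.coeff_C, if_neg hb, map_zero]
    · intro h
      simp at h
  have hmul : ∀ w z : (SmoothFn 𝕜 n S)⟦X⟧, PowerSeries.coeff k (starMul C w z) =
      ∑ p ∈ Finset.HasAntidiagonal.antidiagonal k,
        ∑ q ∈ Finset.HasAntidiagonal.antidiagonal p.2,
          C p.1 (PowerSeries.coeff q.1 w) (PowerSeries.coeff q.2 z) := fun w z => by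
    rw [starMul, PowerSeries.coeff_mk]
  intro u v
  have h := congrArg (PowerSeries.coeff k) (hD.2 (PowerSeries.C u) (PowerSeries.C v))
  rw [map_add, hmul, hmul, opApply, PowerSeries.coeff_mk, Finset.sum_eq_single (k, 0),
    Finset.sum_eq_single (0, k), Finset.sum_eq_single (k, 0), Finset.sum_eq_single (0, k),
    Finset.sum_eq_single (0, k)] at h
  · simp only [happ, h0, starMul, PowerSeries.coeff_mk, Finset.HasAntidiagonal.antidiagonal_zero,
      Finset.sum_singleton, PowerSeries.coeff_zero_C] at h
    rw [h]
    ring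
  -- Every discarded term contains a coefficient of `D` of index below `k`.
  all_goals first
    | (intro h; simp at h)
    | (rintro ⟨a, b⟩ hab hne
       rw [Finset.HasAntidiagonal.mem_antidiagonal] at hab
       simp only at hab
       first
       | (have ha : a < k := by
            rcases Nat.lt_or_ge a k with h | h
            · exact h
            · exact absurd (by rw [Prod.mk.injEq]; omega) hne
          first
          | (rw [hlow a ha, LinearMap.zero_apply])
          | (rw [happ, hlow a ha, LinearMap.zero_apply, map_zero, LinearMap.zero_apply]))
       | (have hb : b < k := by
            rcases Nat.lt_or_ge b k with h | h
            · exact h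
            · exact absurd (by rw [Prod.mk.injEq]; omega) hne
          first
          | (rw [happ, hlow b hb, LinearMap.zero_apply, map_zero])
          | (refine Finset.sum_eq_zero fun q hq => ?_
             rw [Finset.HasAntidiagonal.mem_antidiagonal] at hq
             simp only at hq
             simp only [happ]
             first
             | (rw [hlow q.1 (by omega), LinearMap.zero_apply, map_zero, LinearMap.zero_apply])
             | (rw [hlow q.2 (by omega), LinearMap.zero_apply, map_zero]))))

/-- The coefficientwise extension to series of a functional. -/
def seriesFunctional (l : Op 𝕜 n S →ₗ[ℝ] ℝ) : OpSeries 𝕜 n S →ₗ[ℝ⟦X⟧] ℝ⟦X⟧ where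
  toFun D := PowerSeries.mk fun k => l (PowerSeries.coeff k D)
  map_add' D E := by
    ext k
    simp
  map_smul' c D := by
    ext k
    rw [RingHom.id_apply, smul_eq_mul, PowerSeries.coeff_mk, Algebra.smul_def,
      PowerSeries.coeff_mul, PowerSeries.coeff_mul, map_sum]
    refine Finset.sum_congr rfl fun p _ => ?_
    change l (algebraMap ℝ (Op 𝕜 n S) (PowerSeries.coeff p.1 c) * PowerSeries.coeff p.2 D) = _
    rw [PowerSeries.coeff_mk, ← Algebra.smul_def, map_smul, smul_eq_mul]

end StarDerivations

/-! ### Equivariant maps and finite generation over `ℝ⟦X⟧` -/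

section RelativeHomomorphisms

variable {𝕜 : Type*} [RCLike 𝕜] {n : ℕ} {S : Type*} [TopologicalSpace S]
  [ChartedSpace (EuclideanSpace ℝ (Fin n)) S] [Group S] [LieGroup (𝓡 n) ∞ S]

/-- The vector field `X^⋆` as an internal symmetry. -/
def starSymmetry
    (F : (EnvAlg 𝕜 (GroupLieAlgebra (𝓡 n) S) ⊗[𝕜] EnvAlg 𝕜 (GroupLieAlgebra (𝓡 n) S))⟦X⟧)
    (X : GroupLieAlgebra (𝓡 n) S) : InternalSymmetry (twistCochains F) :=
  ⟨starOp 𝕜 X, starOp_mem_internalSymmetry F X⟩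

variable {F : (EnvAlg 𝕜 (GroupLieAlgebra (𝓡 n) S) ⊗[𝕜] EnvAlg 𝕜 (GroupLieAlgebra (𝓡 n) S))⟦X⟧}

/-- The linear maps from the internal symmetries to the derivations that are equivariant under the
vector fields `X^⋆`. -/
def equivariantMaps
    (F : (EnvAlg 𝕜 (GroupLieAlgebra (𝓡 n) S) ⊗[𝕜] EnvAlg 𝕜 (GroupLieAlgebra (𝓡 n) S))⟦X⟧)
    (C : Cochains 𝕜 n S) :
    Submodule ℝ⟦X⟧ (InternalSymmetry (twistCochains F) →ₗ[ℝ] Der C) where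
  carrier := {φ | ∀ X Y, (φ ⁅starSymmetry F X, Y⁆ : OpSeries 𝕜 n S) =
    PowerSeries.C (starOp 𝕜 X) * (φ Y : OpSeries 𝕜 n S) - φ Y * PowerSeries.C (starOp 𝕜 X)}
  zero_mem' X Y := by
    change (0 : OpSeries 𝕜 n S) = _ * (0 : OpSeries 𝕜 n S) - (0 : OpSeries 𝕜 n S) * _
    rw [mul_zero, zero_mul]
    exact (sub_zero (0 : OpSeries 𝕜 n S)).symm
  add_mem' {φ φ'} h h' X Y := by
    change (φ _ : OpSeries 𝕜 n S) + (φ' _ : OpSeries 𝕜 n S) =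
      _ * ((φ Y : OpSeries 𝕜 n S) + (φ' Y : OpSeries 𝕜 n S)) -
        ((φ Y : OpSeries 𝕜 n S) + (φ' Y : OpSeries 𝕜 n S)) * _
    rw [h, h']
    noncomm_ring
  smul_mem' c φ h X Y := by
    change c • (φ _ : OpSeries 𝕜 n S) =
      _ * (c • (φ Y : OpSeries 𝕜 n S)) - (c • (φ Y : OpSeries 𝕜 n S)) * _
    rw [h, smul_sub, mul_smul_comm, smul_mul_assoc]

/-- Only brackets with some `X^⋆` are used, where the value of the homomorphism is prescribed; this
makes the condition linear, hence inherited by the span. -/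
theorem relHom_subset_equivariantMaps (C : Cochains 𝕜 n S) :
    RelHom (twistCochains F) C ⊆ equivariantMaps F C := fun φ h X Y => by
  
  rw [h.1, LieSubalgebra.coe_bracket]
  exact congrArg (fun D => D * (φ Y : OpSeries 𝕜 n S) - φ Y * D) (h.2 X _)

variable [T2Space S]

/-- As `X^⋆` commutes with the left-invariant frame, its commutator with `D` only differentiates the
components. -/
theorem frameComponent_commutator_starOp (X : GroupLieAlgebra (𝓡 n) S) {D : Op 𝕜 n S}
    (hD : IsLeibniz D) (a : Fin n) (p : S) :
    frameComponent (starOp 𝕜 X * D - D * starOp 𝕜 X) a p = (starOp 𝕜 X (componentFn hD a) : S → 𝕜) p := by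
  have h1 : ∀ f, (starOp 𝕜 X * D - D * starOp 𝕜 X) f =
      ∑ b, starOp 𝕜 X (componentFn hD b) * leftFrame 𝕜 n S b f := fun f => by
    rw [LinearMap.sub_apply, Module.End.mul_apply, Module.End.mul_apply,
      hD.apply_eq_sum_componentFn f, hD.apply_eq_sum_componentFn, map_sum,
      ← Finset.sum_sub_distrib]
    refine Finset.sum_congr rfl fun b _ => ?_
    rw [starOp_isLeibniz X, leftFrame, starOp_leftAction]
    ring
  have h2 : frameComponent (starOp 𝕜 X * D - D * starOp 𝕜 X) a p =
      evalAt 𝕜 n p ((starOp 𝕜 X * D - D * starOp 𝕜 X) (leftTranslate p⁻¹ (coordFn 𝕜 1 a))) := by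
    rw [frameComponent, conjOp_apply, leftTranslate_apply, mul_one]
    rfl
  rw [h2, h1, map_sum, Finset.sum_eq_single a]
  · rw [map_mul, leftFrame_leftTranslate, evalAt_apply, evalAt_apply, leftTranslate_apply,
      inv_mul_cancel, leftFrame_coordFn, if_pos rfl, mul_one]
  · intro b _ hb
    rw [map_mul, leftFrame_leftTranslate, evalAt_apply, evalAt_apply, leftTranslate_apply,
      inv_mul_cancel, leftFrame_coordFn, if_neg hb, mul_zero]
  · intro h
    exact absurd (Finset.mem_univ a) h

/-- An equivariant linear map from a finite-dimensional space to the derivations of `C^∞(S)` that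
vanishes at the unit vanishes. -/
theorem equivariant_eq_zero [ConnectedSpace S] {V : Type*} [AddCommGroup V] [Module ℝ V]
    [FiniteDimensional ℝ V] {ρ : GroupLieAlgebra (𝓡 n) S → V → V} {ψ : V →ₗ[ℝ] Op 𝕜 n S}
    (hψ : ∀ Y, IsLeibniz (ψ Y)) (heq : ∀ X Y, ψ (ρ X Y) = starOp 𝕜 X * ψ Y - ψ Y * starOp 𝕜 X)
    (hone : ∀ i a, (ψ (Module.finBasis ℝ V i) (coordFn 𝕜 1 a) : S → 𝕜) 1 = 0) : ψ = 0 := by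
  let b := Module.finBasis ℝ V
  refine b.ext fun i => (hψ (b i)).eq_zero_of_frameComponent fun a p => ?_
  -- For fixed `a`, the `a`-th components of the images of the basis solve a system along the frame
  -- of the `X^⋆`; its constants are the matrix entries of `ρ` in the basis.
  have h := eq_zero_of_frame_system (U := fun c => starField (frameVector n S c))
    (fun c => isSmoothVF_starField (frameVector n S c)) starField_linearIndependent
    (f := fun i => componentFn (hψ (b i)) a)
    (M := fun c i j => ((b.repr (ρ (frameVector n S c) (b i)) j : ℝ) : 𝕜)) (p := 1)
    (fun c i => ?_) (fun i => (frameComponent_one _ _).trans (hone i a)) i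
  · exact congrArg (evalAt 𝕜 n p) h
  · ext q
    refine (frameComponent_commutator_starOp (frameVector n S c) (hψ (b i)) a q).symm.trans ?_
    rw [← heq, ← b.sum_repr (ρ (frameVector n S c) (b i)), map_sum, ← evalAt_apply, map_sum]
    simp only [map_smul]
    let ev : Op 𝕜 n S →ₗ[ℝ] 𝕜 :=
      { toFun := fun D => frameComponent D a q
        map_add' := fun _ _ => rfl
        map_smul' := fun _ _ => rfl }
    change ev (∑ j, _) = _
    rw [map_sum]
    refine Finset.sum_congr rfl fun j _ => ?_
    rw [map_smul, RCLike.real_smul_eq_coe_mul, b.sum_repr]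
    rfl

/-- Strong induction on the power of `ν`: once the lower coefficients vanish, the next one is valued
in derivations of the pointwise product and remains equivariant, so its values at the unit decide.
-/
theorem equivariantMaps_eq_zero [ConnectedSpace S]
    [FiniteDimensional ℝ (InternalSymmetry (twistCochains F))] {C : Cochains 𝕜 n S}
    (h0 : ∀ u v, C 0 u v = u * v) {φ : InternalSymmetry (twistCochains F) →ₗ[ℝ] Der C}
    (hφ : φ ∈ equivariantMaps F C)
    (hone : ∀ i a k, (PowerSeries.coeff k (φ (Module.finBasis ℝ _ i) : OpSeries 𝕜 n S)
      (coordFn 𝕜 1 a) : S → 𝕜) 1 = 0) : φ = 0 := by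
  have key : ∀ k Y, PowerSeries.coeff k (φ Y : OpSeries 𝕜 n S) = 0 := fun k => by
    induction k using Nat.strong_induction_on with
    | _ k ih =>
      let ψ : InternalSymmetry (twistCochains F) →ₗ[ℝ] Op 𝕜 n S :=
        { toFun := fun Y => PowerSeries.coeff k (φ Y : OpSeries 𝕜 n S)
          map_add' := fun Y Z => by rw [map_add]; rfl
          map_smul' := fun c Y => by rw [map_smul]; rfl }
      have hψ : ψ = 0 := equivariant_eq_zero
        (ρ := fun X Y => ⁅starSymmetry F X, Y⁆)
        (fun Y => isLeibniz_coeff_of_mem_Der h0 (φ Y).2 fun j hj => ih j hj Y)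
        (fun X Y => by
          refine (congrArg (PowerSeries.coeff k) (hφ X Y)).trans ?_
          rw [map_sub, PowerSeries.coeff_C_mul, PowerSeries.coeff_mul_C]
          rfl)
        fun i a => hone i a k
      exact fun Y => LinearMap.congr_fun hψ Y
  ext1 Y
  refine Subtype.ext (PowerSeries.ext fun k => ?_)
  rw [key]
  rfl

set_option synthInstance.maxHeartbeats 200000 in
theorem span_relHom_fg [ConnectedSpace S]
    [FiniteDimensional ℝ (InternalSymmetry (twistCochains F))] {C : Cochains 𝕜 n S}
    (h0 : ∀ u v, C 0 u v = u * v) :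
    (Submodule.span ℝ⟦X⟧ (RelHom (twistCochains F) C)).FG := by
  let jet : Fin n → (𝕜 →L[ℝ] ℝ) → Op 𝕜 n S →ₗ[ℝ] ℝ := fun a l =>
    { toFun := fun D => l ((D (coordFn 𝕜 1 a) : S → 𝕜) 1)
      map_add' := fun D E => map_add l _ _
      map_smul' := fun c D => map_smul l c _ }
  let ι := Fin (Module.finrank ℝ (InternalSymmetry (twistCochains F)))
  -- `Φ` records, for each basis symmetry, the series of values at the unit on the coordinates. Real
  -- and imaginary parts are kept apart so that the target is finite free over `ℝ⟦X⟧` for either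
  -- field.
  let Φ : equivariantMaps F C →ₗ[ℝ⟦X⟧] (ι × Fin n → ℝ⟦X⟧ × ℝ⟦X⟧) :=
    { toFun := fun φ i =>
        (seriesFunctional (jet i.2 RCLike.reCLM) (φ.1 (Module.finBasis ℝ _ i.1)),
          seriesFunctional (jet i.2 RCLike.imCLM) (φ.1 (Module.finBasis ℝ _ i.1)))
      map_add' := fun φ φ' => funext fun i => Prod.ext (map_add _ _ _) (map_add _ _ _)
      map_smul' := fun c φ => funext fun i => Prod.ext (map_smul _ _ _) (map_smul _ _ _) }
  have hΦ : Function.Injective Φ := (injective_iff_map_eq_zero Φ).2 fun φ hφ => by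
    refine Subtype.ext (equivariantMaps_eq_zero h0 φ.2 fun i a k => ?_)
    have h1 := congrFun hφ (i, a)
    have hr := congrArg (fun z => PowerSeries.coeff k z.1) h1
    have hi := congrArg (fun z => PowerSeries.coeff k z.2) h1
    refine RCLike.ext ?_ ?_
    · rw [map_zero]
      refine (PowerSeries.coeff_mk k fun k => jet a RCLike.reCLM (PowerSeries.coeff k
        (φ.1 (Module.finBasis ℝ _ i) : OpSeries 𝕜 n S))).symm.trans hr
    · rw [map_zero]
      refine (PowerSeries.coeff_mk k fun k => jet a RCLike.imCLM (PowerSeries.coeff k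
        (φ.1 (Module.finBasis ℝ _ i) : OpSeries 𝕜 n S))).symm.trans hi
  have hN : IsNoetherian ℝ⟦X⟧ (equivariantMaps F C) := isNoetherian_of_injective Φ hΦ
  have hle : Submodule.span ℝ⟦X⟧ (RelHom (twistCochains F) C) ≤ equivariantMaps F C :=
    Submodule.span_le.2 (relHom_subset_equivariantMaps C)
  exact isNoetherian_submodule.1 hN _ hle

end RelativeHomomorphisms

end DrinfeldTwist

end

open DrinfeldTwist

theorem mainTheorem5 (𝕜 : Type*) [RCLike 𝕜] (n : ℕ) (S : Type*) [TopologicalSpace S]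
    [T2Space S] [SecondCountableTopology S] [SimplyConnectedSpace S]
    [ChartedSpace (EuclideanSpace ℝ (Fin n)) S] [Group S] [LieGroup (𝓡 n) ∞ S] [Group.IsSolvable S]
    (ωS : InvariantSymplecticForm n S)
    (F F' : (EnvAlg 𝕜 (GroupLieAlgebra (𝓡 n) S) ⊗[𝕜] EnvAlg 𝕜 (GroupLieAlgebra (𝓡 n) S))⟦X⟧)
    (hF : IsTwistBasedOn ωS F) (hF' : IsTwistBasedOn ωS F')
    (hnat : IsNatural (twistCochains F))
    (hequiv : IsLeftEquivalent (twistCochains F) (twistCochains F')) :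
    FiniteDimensional ℝ (InternalSymmetry (twistCochains F)) ∧
      (Submodule.span ℝ⟦X⟧ (RelHom (twistCochains F) (twistCochains F'))).FG := by
  have hfin : FiniteDimensional ℝ (InternalSymmetry (twistCochains F)) :=
    finiteDimensional_internalSymmetry hF hnat
  exact ⟨hfin, span_relHom_fg (twistCochains_zero hF'.isTwist)⟩
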